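/- **Setting.** Let $\Sigma$ be a finite alphabet. A *parameterized enumeration problem* over $\Sigma$ is a triple $E=(Q,\kappa,\mathrm{Sol})$ where $Q\subseteq\Sigma^*$, $\kappa\colon\Sigma^*\to\mathbb N$ is computable in polynomial time, and $\mathrm{Sol}\colon\Sigma^*\to\mathcal P(\Sigma^*)$ is such that, for every $x\in\Sigma^*$, $\mathrm{Sol}(x)$ is finite, and $\mathrm{Sol}(x)\neq\emptyset$ if and only if $x\in Q$. Algorithms are deterministic multi-stack (equivalently, multi-tape) Turing machines. An *enumeration algorithm* moreover has output instructions, each of which outputs the word currently written in an output buffer and empties the buffer. On a given input, an algorithm enumerates a set $S\subseteq\Sigma^*$ *with delay at most $d$* if it terminates, outputs exactly the elements of $S$, without duplicates, and at most $d$ steps elapse from the start to the first output, between any two consecutive outputs, and from the last output to termination (if $S=\emptyset$, at most $d$ steps elapse from the start to termination). $E$ is in $\mathrm{DelayFPT}$ if there are an algorithm, a computable function $t\colon\mathbb N\to\mathbb N$ and a polynomial $p$ such that, on every input $x\in\Sigma^*$, the algorithm enumerates $\mathrm{Sol}(x)$ with delay at most $t(\kappa(x))\cdot p(|x|)$. A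 function whose values are sets of words is called *computable* if its values are finite and a list of all elements of the value can be computed from the argument. A polynomial-time computable function $K\colon\Sigma^*\to\Sigma^*$ is an *enum-kernelization* of $E$ if there exist 1. a computable function $h\colon\mathbb N\to\mathbb N$ such that, for all $x\in\Sigma^*$, $(x\in Q\Leftrightarrow K(x)\in Q)$ and $|K(x)|\le h(\kappa(x))$; and 2. a computable function $f\colon\Sigma^*\times\Sigma^*\to\mathcal P(\Sigma^*)$, with $f(x,w)\subseteq\mathrm{Sol}(x)$ for all $x\in Q$ and $w\in\mathrm{Sol}(K(x))$, such that for every $x\in Q$: (a) for all $w_1,w_2\in\mathrm{Sol}(K(x))$ with $w_1\ne w_2$, $f(x,w_1)\cap f(x,w_2)=\emptyset$; (b) $\bigcup_{w\in\mathrm{Sol}(K(x))}f(x,w)=\mathrm{Sol}(x)$; (c) there are an algorithm, a polynomial $p$ and a computable function $t\colon\mathbb N\to\mathbb N$ (all three independent of $x$ and $w$) such that, on every input $(x,w)$ with $x\in Q$ and $w\in\mathrm{Sol}(K(x))$, the algorithm enumerates $f(x,w)$ with delay at most $p(|x|)\cdot t(\kappa(x))$. **Theorem.** For every parameterized enumeration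 problem $E=(Q,\kappa,\mathrm{Sol})$ over $\Sigma$, the following are equivalent: 1. $E$ is in $\mathrm{DelayFPT}$. 2. The function $x\mapsto\mathrm{Sol}(x)$ is computable, and $E$ has an enum-kernelization. -/

import Mathlib

/-- A deterministic multi-stack Turing machine with output instructions.  The machine is one of
Mathlib's machines of type `Turing.FinTM2`, with input alphabet `I` on its input stack and output
alphabet `O` on its output stack (the output buffer).  Some of its labels are marked as output
instructions: see `EnumMachine.emit` and `EnumMachine.next`. -/
structure EnumMachine (I O : Type) extends Turing.TM2ComputableAux I O where
  /-- every stack has a finite alphabet -/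
  finite_alphabet : ∀ k, Finite (tm.Γ k)
  /-- the labels that are output instructions -/
  isOutput : tm.Λ → Bool

namespace EnumMachine

variable {I O : Type} (M : EnumMachine I O)

/-- Is the next instruction to be executed an output instruction? -/
def outputsAt (c : M.tm.Cfg) : Bool :=
  match c.l with
  | none => false
  | some l => M.isOutput l

/-- The word that is output in the configuration `c`, if any: an output instruction outputs the
whole content of the output stack (top symbol first). -/
def emit (c : M.tm.Cfg) : Option (List O) :=
  if M.outputsAt c then some ((c.stk M.tm.k₁).map M.outputAlphabet) else none

/-- An output instruction empties the output stack, so that every word that is output has to be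
written anew, symbol by symbol. -/
def flush (c : M.tm.Cfg) : M.tm.Cfg :=
  if M.outputsAt c then
    { l := c.l, var := c.var, stk := Function.update c.stk M.tm.k₁ [] }
  else c

/-- One step of the machine; a halted configuration does not change any more. -/
def next (c : M.tm.Cfg) : M.tm.Cfg :=
  (M.tm.step (M.flush c)).getD c

/-- The configuration after `n` steps on the input `u`. -/
def config (u : List I) : ℕ → M.tm.Cfg
  | 0 => Turing.initList M.tm (u.map M.inputAlphabet.symm)
  | n + 1 => M.next (config u n)

/-- On the input `u` the machine halts after exactly `T` steps. -/
def HaltsAt (u : List I) (T : ℕ) : Prop :=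
  (M.config u T).l = none ∧ ∀ i < T, (M.config u i).l ≠ none

/-- The words that are output on the input `u` during the first `T` steps, in order. -/
def outputs (u : List I) (T : ℕ) : List (List O) :=
  (List.range T).filterMap fun i => M.emit (M.config u i)

/-- The times, among the first `T` steps on the input `u`, at which a word is output. -/
def outputTimes (u : List I) (T : ℕ) : List ℕ :=
  (List.range T).filter fun i => M.outputsAt (M.config u i)

/-- The delays of the run on the input `u`, where `T` is the halting time.  If `n` words are output,
there are `n + 1` delays: the `0`-th one is the time until the first output (the precalculation
time), the `i`-th one is the time between the `i`-th and the `(i+1)`-st output, and the `n`-th one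
is the time from the last output until termination (the postcalculation time).  If there is no
output, the only delay is the total running time. -/
def delays (u : List I) (T : ℕ) : List ℕ :=
  List.zipWith (fun a b => b - a) (0 :: M.outputTimes u T) (M.outputTimes u T ++ [T])

/-- On the input `u` the machine terminates, outputs exactly the elements of `S`, without
duplicates, and all its delays are at most `d`. -/
def EnumeratesWithDelay (u : List I) (S : Set (List O)) (d : ℕ) : Prop :=
  ∃ T, M.HaltsAt u T ∧ (M.outputs u T).Nodup ∧ (∀ w, w ∈ M.outputs u T ↔ w ∈ S) ∧
    ∀ δ ∈ M.delays u T, δ ≤ d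

end EnumMachine

/-- `f` is computable in polynomial time, for encodings `ea` and `eb` of arguments and values by
words. -/
def PolyTimeComputable {α β αΓ βΓ : Type} (ea : α → List αΓ) (eb : β → List βΓ) (f : α → β) : Prop :=
  Nonempty (Turing.TM2ComputableInPolyTime ea eb f)

/-- A set-valued function is computable: its values are finite sets of words, and from the argument
one can compute a list of all elements of the value. -/
def ComputableFiniteSets {α A : Type} [Primcodable α] [Primcodable A]
    (S : α → Set (List A)) : Prop :=
  ∃ L : α → List (List A), Computable L ∧ ∀ a w, w ∈ L a ↔ w ∈ S a

/-- The word over `A ∪ {#}` (where `#` is `none`) that presents the pair `(x, w)` to a machine: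
`x#w`. -/
def encodePair {A : Type} (p : List A × List A) : List (Option A) :=
  p.1.map some ++ none :: p.2.map some

/-- A parameterized enumeration problem over the alphabet `A`. -/
structure ParamEnumProblem (A : Type) where
  /-- the instances that have a solution -/
  Q : Set (List A)
  /-- the parameterization -/
  κ : List A → ℕ
  /-- the parameterization is computable in polynomial time, with values written in binary -/
  κ_polyTime : PolyTimeComputable (id : List A → List A) Computability.encodeNat κ
  /-- the set of solutions of an instance -/
  Sol : List A → Set (List A)
  sol_finite : ∀ x, (Sol x).Finite
  sol_nonempty_iff : ∀ x, (Sol x).Nonempty ↔ x ∈ Q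

namespace ParamEnumProblem

variable {A : Type}

/-- The class of problems that have an enumeration algorithm with delay at most
`t (κ x) * p |x|`, for a computable function `t` and a polynomial `p`. -/
def DelayFPT (E : ParamEnumProblem A) : Prop :=
  ∃ (M : EnumMachine A A) (t : ℕ → ℕ) (p : Polynomial ℕ), Computable t ∧
    ∀ x, M.EnumeratesWithDelay x (E.Sol x) (t (E.κ x) * p.eval x.length)

/-- `K` is an enum-kernelization of `E`. -/
def IsEnumKernelization [Primcodable A] (E : ParamEnumProblem A) (K : List A → List A) : Prop :=
  PolyTimeComputable (id : List A → List A) (id : List A → List A) K ∧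
  (∃ h : ℕ → ℕ, Computable h ∧ ∀ x, (x ∈ E.Q ↔ K x ∈ E.Q) ∧ (K x).length ≤ h (E.κ x)) ∧
  ∃ f : List A × List A → Set (List A), ComputableFiniteSets f ∧
    (∀ x ∈ E.Q, ∀ w ∈ E.Sol (K x), f (x, w) ⊆ E.Sol x) ∧
    (∀ x ∈ E.Q, ∀ w₁ ∈ E.Sol (K x), ∀ w₂ ∈ E.Sol (K x), w₁ ≠ w₂ → f (x, w₁) ∩ f (x, w₂) = ∅) ∧
    (∀ x ∈ E.Q, ⋃ w ∈ E.Sol (K x), f (x, w) = E.Sol x) ∧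
    ∃ (M : EnumMachine (Option A) A) (t : ℕ → ℕ) (p : Polynomial ℕ), Computable t ∧
      ∀ x ∈ E.Q, ∀ w ∈ E.Sol (K x),
        M.EnumeratesWithDelay (encodePair (x, w)) (f (x, w)) (p.eval x.length * t (E.κ x))

end ParamEnumProblem

/-!
A problem in `DelayFPT` is kernelized by running its enumeration algorithm `M` on `x` for
`C * (|x| + 1) ^ e` steps, where `C * (n + 1) ^ (e - 1)` bounds the polynomial part `p n` of the
delay.  If `M` halts or reaches an output instruction meanwhile, then it is known whether `x` has
solutions, and `x` is replaced by a fixed instance with the same answer; otherwise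
`C * (|x| + 1) ^ e` is less than the delay `t (κ x) * p |x|`, hence `|x| < t (κ x)`, and `x` is
its own kernel (`ParamEnumProblem.exists_kernelization`).  All solutions of `x` are assigned to
the first solution in a computed list of the solutions of the kernel; `M` enumerates them.

Conversely, given an enum-kernelization `K`, the solutions `w` of `K x` can be listed in a time
that is computable from `K x`, and there are only finitely many words of length at most `h (κ x)`;
so this time, and the number and lengths of the `w`, are bounded by a computable function of `κ x`
(`exists_computable_bound`).  Enumerating the sets `f (x, w)` for all these `w`, one after the
other, enumerates `Sol x`, because these sets are disjoint.  Some of them may be empty, so that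
the delay is multiplied by the number of the `w`.

In both directions, machines have to be combined: the machine for `K` is run first, then a machine
that computes a list of words from `K x`, and then the enumeration machine on `x` and each word of
the list.  This is done once, by a program with the three machines as parameters
(`StackMachine.Driver`); in the first direction the list has one word or none, depending on
whether the given `w` is the distinguished solution.  Such combinations are written as structured
programs, `StackMachine.Prog`, with a big-step semantics `StackMachine.Run` that records every
step, and `StackMachine.Prog.trace_of_run` translates them into machines.  A program can simulate
a machine on some of its stacks, with outputs (`StackMachine.Layout.run_simulate`).  Three points
need care.

* The enumeration machine is started many times, and may leave its stacks filled.  Emptying them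
  would take time proportional to the length of the whole previous run, which the delay does not
  permit.  Instead, new bottom markers are pushed onto the old contents.  The output stack must
  not have markers, since its whole content is output, but it is emptied by every output, so that
  its height is bounded by the delay (`StackMachine.Trace.length_output_le`).
* A machine that computes in polynomial time in the sense of Mathlib has to end with empty stacks
  apart from the output stack, and may have infinite stack alphabets, whereas enumeration machines
  have finite ones.  See `StackMachine.Prog.polyTimeComputable` and `StackMachine.machineSymbols`.
* `Computable` is defined by partial recursive functions.  A machine for a computable function on
  words is obtained from Mathlib's stack machines for partial recursive functions on numbers, by
  coding words as numbers (`StackMachine.exists_machine_of_computable`), and a simulation of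
  machines by primitive recursive functions shows that the outputs and the halting time of a
  machine are computable (`EnumMachine.primrec_outputs`, `EnumMachine.exists_computable_haltsAt`).
-/

open Turing

set_option linter.unusedSectionVars false

namespace StackMachine

/-! ### Runs of stack machines -/

section Trace

variable {K : Type} [DecidableEq K] {Γ : K → Type} {Λ σ : Type}

/-- `Trace m o ko c τ c'`: the machine with program `m`, output labels `o` and output stack `ko`
runs from `c` to `c'`, and `τ` lists for each step the content of the output stack if the step is
an output instruction, and `none` otherwise.  The length of `τ` is the number of steps. -/
inductive Trace (m : Λ → TM2.Stmt Γ Λ σ) (o : Λ → Bool) (ko : K) :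
    TM2.Cfg Γ Λ σ → List (Option (List (Γ ko))) → TM2.Cfg Γ Λ σ → Prop
  | nil (c) : Trace m o ko c [] c
  | cons (l v S τ c')
      (h : Trace m o ko (TM2.stepAux (m l) v (if o l then Function.update S ko [] else S)) τ c') :
      Trace m o ko ⟨some l, v, S⟩ ((if o l then some (S ko) else none) :: τ) c'

variable {m : Λ → TM2.Stmt Γ Λ σ} {o : Λ → Bool} {ko : K}

theorem Trace.append {c₁ c₂ c₃ : TM2.Cfg Γ Λ σ} {τ₁ τ₂}
    (h₁ : Trace m o ko c₁ τ₁ c₂) (h₂ : Trace m o ko c₂ τ₂ c₃) :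
    Trace m o ko c₁ (τ₁ ++ τ₂) c₃ := by
  induction h₁ with
  | nil => exact h₂
  | cons l v S τ c' _ ih => exact .cons l v S _ _ (ih h₂)

theorem Trace.of_silent {l : Λ} (hl : o l = false) {v S τ} {c' : TM2.Cfg Γ Λ σ}
    (h : Trace m o ko (TM2.stepAux (m l) v S) τ c') :
    Trace m o ko ⟨some l, v, S⟩ (none :: τ) c' := by
  simpa [hl] using Trace.cons (m := m) (o := o) (ko := ko) l v S τ c' (by simpa [hl] using h)

theorem Trace.of_output {l : Λ} (hl : o l = true) {v S τ} {c' : TM2.Cfg Γ Λ σ}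
    (h : Trace m o ko (TM2.stepAux (m l) v (Function.update S ko [])) τ c') :
    Trace m o ko ⟨some l, v, S⟩ (some (S ko) :: τ) c' := by
  simpa [hl] using Trace.cons (m := m) (o := o) (ko := ko) l v S τ c' (by simpa [hl] using h)

end Trace

/-! ### The gaps between outputs -/

section Paced

variable {β γ : Type}

/-- In the trace `τ`, started when `g` steps have elapsed since the last output (or since the
start), at most `d` steps elapse from the last output to the first one, between consecutive ones,
and from the last one to the end. -/
def Paced (d : ℕ) : ℕ → List (Option β) → Prop
  | g, [] => g ≤ d
  | g, none :: τ => Paced d (g + 1) τ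
  | g, some _ :: τ => g ≤ d ∧ Paced d 1 τ

theorem Paced.le {d : ℕ} {τ : List (Option β)} : ∀ {g}, Paced d g τ → g ≤ d := by
  induction τ with
  | nil => intro g h; exact h
  | cons e τ ih =>
    intro g h
    cases e with
    | none => exact (Nat.le_succ g).trans (ih h)
    | some w => exact h.1

theorem Paced.shift {d d' : ℕ} {τ : List (Option β)} :
    ∀ {g g'}, Paced d g τ → g' + d ≤ g + d' → d ≤ d' → Paced d' g' τ := by
  induction τ with
  | nil => intro g g' h h1 h2; simp only [Paced] at *; omega
  | cons e τ ih =>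
    intro g g' h h1 h2
    cases e with
    | none => exact ih (g := g + 1) h (by omega) h2
    | some w =>
      have := h.1
      exact ⟨by omega, ih h.2 (by omega) h2⟩

theorem Paced.mono {d d' g g' : ℕ} {τ : List (Option β)} (h : Paced d g τ) (hg : g' ≤ g)
    (hd : d ≤ d') : Paced d' g' τ := h.shift (by omega) hd

/-- The delays add up only at the joint, where the last gap of the first trace meets the first gap
of the second one. -/
theorem Paced.append {d₁ d₂ : ℕ} {τ₁ τ₂ : List (Option β)} (h₂ : Paced d₂ 0 τ₂) :
    ∀ {g}, Paced d₁ g τ₁ → Paced (d₁ + d₂) g (τ₁ ++ τ₂) := by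
  induction τ₁ with
  | nil => intro g h; simp only [Paced] at h; exact h₂.shift (by omega) (by omega)
  | cons e τ ih =>
    intro g h
    cases e with
    | none => exact ih (g := g + 1) h
    | some w => exact ⟨h.1.trans (by omega), ih h.2⟩

theorem Paced.replicate_none_append {d : ℕ} (τ : List (Option β)) (n : ℕ) : ∀ {g},
    Paced d g (List.replicate n none ++ τ) ↔ Paced d (g + n) τ := by
  induction n with
  | zero => intro g; simp
  | succ n ih => intro g; simp only [List.replicate_succ, List.cons_append, Paced, ih]; grind

theorem paced_replicate_none {n d : ℕ} (h : n ≤ d) :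
    Paced d 0 (List.replicate n (none : Option β)) := by
  have := (Paced.replicate_none_append (β := β) (d := d) [] n (g := 0)).2 (by simpa [Paced] using h)
  simpa using this

theorem Paced.map (φ : β → γ) {d : ℕ} {τ : List (Option β)} :
    ∀ {g}, Paced d g (τ.map (Option.map φ)) ↔ Paced d g τ := by
  induction τ with
  | nil => intro g; rfl
  | cons e τ ih => intro g; cases e <;> simp [Paced, ih]

/-- The trace of a simulation that spends three steps on a silent step of the simulated machine
and four steps on an output instruction. -/
def slowed (e : Option β) : List (Option β) :=
  match e with
  | none => [none, none, none]
  | some w => [none, none, some w, none]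

theorem Paced.slowed {d : ℕ} {τ : List (Option β)} :
    ∀ {g}, Paced d g τ → Paced (4 * d + 4) (4 * g) (τ.flatMap StackMachine.slowed) := by
  induction τ with
  | nil => intro g h; simp only [Paced, List.flatMap_nil] at *; omega
  | cons e τ ih =>
    intro g h
    cases e with
    | none =>
      simp only [StackMachine.slowed, List.flatMap_cons, List.cons_append, List.nil_append, Paced]
      exact (ih (g := g + 1) h).mono (by omega) le_rfl
    | some w =>
      simp only [StackMachine.slowed, List.flatMap_cons, List.cons_append, List.nil_append, Paced]
      exact ⟨by have := h.1; omega, (ih h.2).mono (by omega) le_rfl⟩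

theorem reduceOption_slowed (τ : List (Option β)) :
    (τ.flatMap StackMachine.slowed).reduceOption = τ.reduceOption := by
  induction τ with
  | nil => rfl
  | cons e τ ih =>
    cases e <;> simp [StackMachine.slowed, List.reduceOption_cons_of_none,
      List.reduceOption_cons_of_some, ih]

theorem reduceOption_replicate_none (n : ℕ) :
    (List.replicate n (none : Option β)).reduceOption = [] := by
  simp [List.reduceOption]

/-- The trace of a simulation until it stops. -/
theorem Paced.simulation (φ : β → γ) {d : ℕ} {τ : List (Option β)} (h : Paced d 0 τ) :
    Paced (4 * d + 5) 0 ((τ.flatMap StackMachine.slowed).map (Option.map φ) ++ [none]) :=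
  (paced_replicate_none (n := 1) le_rfl).append ((Paced.map φ).2 h.slowed)

theorem reduceOption_simulation (φ : β → γ) (τ : List (Option β)) :
    ((τ.flatMap StackMachine.slowed).map (Option.map φ) ++ [none]).reduceOption =
      τ.reduceOption.map φ := by
  rw [List.reduceOption_append, List.reduceOption_map, reduceOption_slowed]
  simp

end Paced

/-! ### Structured programs for stack machines -/

section Prog

variable {K : Type} (Γ : K → Type) (σ : Type)

/-- Structured programs acting on stacks `k : K` with alphabets `Γ k` and on a variable in `σ`.
The jump targets of the statements in `block` and `loop` are disregarded: a jump or a halt marks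
the end of the statement. -/
inductive Prog
  /-- one step: execute a statement -/
  | block (b : TM2.Stmt Γ Unit σ)
  /-- one step: output the content of the output stack and empty this stack -/
  | emit
  | seq (p q : Prog)
  /-- case distinction on the variable -/
  | switch (p : σ → Prog)
  /-- execute `b`; as long as `c` holds afterwards, execute the body and start again -/
  | loop (b : TM2.Stmt Γ Unit σ) (c : σ → Bool) (p : Prog)

variable {Γ σ}

namespace Prog

/-- The labels of the machine that executes a program. -/
def Labels : Prog Γ σ → Type
  | block _ => Unit
  | emit => Unit
  | seq p q => p.Labels ⊕ q.Labels
  | switch p => Option (Σ v, (p v).Labels)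
  | loop _ _ p => Option p.Labels

theorem finite_labels [Finite σ] : ∀ p : Prog Γ σ, Finite p.Labels
  | block _ => inferInstanceAs (Finite Unit)
  | emit => inferInstanceAs (Finite Unit)
  | seq p q =>
    have := finite_labels p
    have := finite_labels q
    inferInstanceAs (Finite (p.Labels ⊕ q.Labels))
  | switch p =>
    have := fun v => finite_labels (p v)
    inferInstanceAs (Finite (Option (Σ v, (p v).Labels)))
  | loop _ _ p =>
    have := finite_labels p
    inferInstanceAs (Finite (Option p.Labels))

end Prog

variable [DecidableEq K]

/-- The state that results from executing a statement up to its end. -/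
def exec (b : TM2.Stmt Γ Unit σ) (s : σ × ∀ k, List (Γ k)) : σ × ∀ k, List (Γ k) :=
  ((TM2.stepAux b s.1 s.2).var, (TM2.stepAux b s.1 s.2).stk)

/-- Big-step semantics of programs: `Run ko p s τ s'` says that `p` leads from `s` to `s'` with the
trace `τ` (see `Trace`), where `ko` is the output stack. -/
inductive Run (ko : K) : Prog Γ σ → (σ × ∀ k, List (Γ k)) → List (Option (List (Γ ko))) →
    (σ × ∀ k, List (Γ k)) → Prop
  | block (b s) : Run ko (.block b) s [none] (exec b s)
  | emit (s) : Run ko .emit s [some (s.2 ko)] (s.1, Function.update s.2 ko [])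
  | seq {p q s₁ s₂ s₃ τ₁ τ₂} (h₁ : Run ko p s₁ τ₁ s₂) (h₂ : Run ko q s₂ τ₂ s₃) :
      Run ko (.seq p q) s₁ (τ₁ ++ τ₂) s₃
  | switch {p s τ s'} (h : Run ko (p s.1) s τ s') : Run ko (.switch p) s (none :: τ) s'
  | loop_exit {b c p s} (hc : c (exec b s).1 = false) : Run ko (.loop b c p) s [none] (exec b s)
  | loop_step {b c p s s₁ s₂ τ₁ τ₂} (hc : c (exec b s).1 = true)
      (h₁ : Run ko p (exec b s) τ₁ s₁) (h₂ : Run ko (.loop b c p) s₁ τ₂ s₂) :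
      Run ko (.loop b c p) s (none :: (τ₁ ++ τ₂)) s₂

namespace Prog

/-- The label at which a program starts. -/
def entry : (p : Prog Γ σ) → p.Labels
  | block _ => ()
  | emit => ()
  | seq p _ => Sum.inl p.entry
  | switch _ => (none : Option _)
  | loop _ _ _ => (none : Option _)

/-- The output instructions of a program. -/
def isOutput : (p : Prog Γ σ) → p.Labels → Bool
  | block _, _ => false
  | emit, _ => true
  | seq p _, Sum.inl l => p.isOutput l
  | seq _ q, Sum.inr l => q.isOutput l
  | switch _, none => false
  | switch p, some l => (p l.1).isOutput l.2
  | loop _ _ _, none => false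
  | loop _ _ p, some l => p.isOutput l

/-- Continue at the label `l`, or halt. -/
def jump {Λ : Type} (l : Option Λ) : TM2.Stmt Γ Λ σ :=
  match l with
  | none => .halt
  | some l => .goto fun _ => l

/-- Replace the ends of a statement by `q`. -/
def andThen {Λ : Type} : TM2.Stmt Γ Unit σ → TM2.Stmt Γ Λ σ → TM2.Stmt Γ Λ σ
  | .push k f b, q => .push k f (andThen b q)
  | .peek k f b, q => .peek k f (andThen b q)
  | .pop k f b, q => .pop k f (andThen b q)
  | .load f b, q => .load f (andThen b q)
  | .branch f b₁ b₂, q => .branch f (andThen b₁ q) (andThen b₂ q)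
  | .goto _, q => q
  | .halt, q => q

theorem stepAux_andThen {Λ : Type} (b : TM2.Stmt Γ Unit σ) (q : TM2.Stmt Γ Λ σ) (v S) :
    TM2.stepAux (andThen b q) v S = TM2.stepAux q (exec b (v, S)).1 (exec b (v, S)).2 := by
  induction b generalizing v S with
  | push k f b ih => simpa [andThen, exec] using ih _ _
  | peek k f b ih => simpa [andThen, exec] using ih _ _
  | pop k f b ih => simpa [andThen, exec] using ih _ _
  | load f b ih => simpa [andThen, exec] using ih _ _
  | branch f b₁ b₂ ih₁ ih₂ =>
    cases h : f v
    · simpa [andThen, exec, h] using ih₂ _ _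
    · simpa [andThen, exec, h] using ih₁ _ _
  | goto f => simp [andThen, exec]
  | halt => simp [andThen, exec]

/-- The statements of the machine that executes a program and then continues at `exit`, with
labels embedded by `e` into those of a larger machine. -/
def code {Λ : Type} : (p : Prog Γ σ) → (exit : Option Λ) → (e : p.Labels → Λ) → p.Labels →
    TM2.Stmt Γ Λ σ
  | block b, exit, _, _ => andThen b (jump exit)
  | emit, exit, _, _ => jump exit
  | seq p q, _, e, Sum.inl l =>
    p.code (some (e (Sum.inr q.entry))) (fun l => e (Sum.inl l)) l
  | seq _ q, exit, e, Sum.inr l => q.code exit (fun l => e (Sum.inr l)) l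
  | switch p, _, e, none => .goto fun v => e (some ⟨v, (p v).entry⟩)
  | switch p, exit, e, some l => (p l.1).code exit (fun l' => e (some ⟨l.1, l'⟩)) l.2
  | loop b c p, exit, e, none =>
    andThen b (.branch c (.goto fun _ => e (some p.entry)) (jump exit))
  | loop _ _ p, _, e, some l => p.code (some (e none)) (fun l => e (some l)) l

theorem stepAux_jump {Λ : Type} (l : Option Λ) (v : σ) (S : ∀ k, List (Γ k)) :
    TM2.stepAux (jump l) v S = ⟨l, v, S⟩ := by
  cases l <;> simp [jump]

/-- Programs are translated correctly: the machine makes exactly the steps that the semantics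
records. -/
theorem trace_of_run {Λ : Type} {m : Λ → TM2.Stmt Γ Λ σ} {o : Λ → Bool} {ko : K} {p : Prog Γ σ}
    {s s' τ} (h : Run ko p s τ s') : ∀ (exit : Option Λ) (e : p.Labels → Λ),
    (∀ l, m (e l) = p.code exit e l) → (∀ l, o (e l) = p.isOutput l) →
    Trace m o ko ⟨some (e p.entry), s.1, s.2⟩ τ ⟨exit, s'.1, s'.2⟩ := by
  induction h with
  | block b s =>
    intro exit e hm ho
    refine .of_silent (by rw [ho]; rfl) ?_
    rw [hm, code, stepAux_andThen, stepAux_jump]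
    exact .nil _
  | emit s =>
    intro exit e hm ho
    refine .of_output (by rw [ho]; rfl) ?_
    rw [hm, code, stepAux_jump]
    exact .nil _
  | @seq p q s₁ s₂ s₃ τ₁ τ₂ h₁ h₂ ih₁ ih₂ =>
    intro exit e hm ho
    exact (ih₁ (some (e (Sum.inr q.entry))) (fun l => e (Sum.inl l)) (fun l => hm (Sum.inl l))
      (fun l => ho (Sum.inl l))).append
        (ih₂ exit (fun l => e (Sum.inr l)) (fun l => hm (Sum.inr l)) (fun l => ho (Sum.inr l)))
  | @switch p s τ s' h ih =>
    intro exit e hm ho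
    refine .of_silent (by rw [ho]; rfl) ?_
    rw [hm, entry, code]
    exact ih exit (fun l' => e (some ⟨s.1, l'⟩)) (fun l => hm (some ⟨s.1, l⟩))
      (fun l => ho (some ⟨s.1, l⟩))
  | @loop_exit b c p s hc =>
    intro exit e hm ho
    refine .of_silent (by rw [ho]; rfl) ?_
    rw [hm, entry, code, stepAux_andThen]
    simp only [TM2.stepAux, hc, cond_false, stepAux_jump]
    exact .nil _
  | @loop_step b c p s s₁ s₂ τ₁ τ₂ hc h₁ h₂ ih₁ ih₂ =>
    intro exit e hm ho
    refine .of_silent (by rw [ho]; rfl) ?_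
    rw [hm, entry, code, stepAux_andThen]
    simp only [TM2.stepAux, hc, cond_true]
    exact (ih₁ (some (e none)) (fun l => e (some l)) (fun l => hm (some l))
      (fun l => ho (some l))).append (ih₂ exit e hm ho)

end Prog

end Prog

end StackMachine

/-! ### Enumeration in terms of traces -/

namespace EnumMachine

open StackMachine

variable {I O : Type} (M : EnumMachine I O)

/-- The initial configuration on the input `u`. -/
def start (u : List I) : M.tm.Cfg := initList M.tm (u.map M.inputAlphabet.symm)

/-- `Trace` for enumeration machines. -/
def RunsTo (c : M.tm.Cfg) (τ : List (Option (List (M.tm.Γ M.tm.k₁)))) (c' : M.tm.Cfg) : Prop :=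
  Trace M.tm.m M.isOutput M.tm.k₁ c τ c'

theorem config_eq_iterate (u : List I) (n : ℕ) : M.config u n = M.next^[n] (M.start u) := by
  induction n with
  | zero => rfl
  | succ n ih => rw [Function.iterate_succ_apply', ← ih]; rfl

theorem next_mk (l : M.tm.Λ) (v : M.tm.σ) (S : ∀ k, List (M.tm.Γ k)) :
    M.next ⟨some l, v, S⟩ = TM2.stepAux (M.tm.m l) v
      (if M.isOutput l then Function.update S M.tm.k₁ [] else S) := by
  unfold next flush outputsAt
  cases h : M.isOutput l <;> simp [h, FinTM2.step, TM2.step] <;> rfl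

theorem emit_mk (l : M.tm.Λ) (v : M.tm.σ) (S : ∀ k, List (M.tm.Γ k)) :
    M.emit ⟨some l, v, S⟩ =
      (if M.isOutput l then some (S M.tm.k₁) else none).map (List.map M.outputAlphabet) := by
  unfold emit outputsAt
  cases h : M.isOutput l <;> simp [h]

variable {M}

theorem RunsTo.spec {c c' : M.tm.Cfg} {τ} (h : M.RunsTo c τ c') :
    M.next^[τ.length] c = c' ∧ (∀ i < τ.length, (M.next^[i] c).l ≠ none) ∧
      (List.range τ.length).map (fun i => M.emit (M.next^[i] c)) =
        τ.map (Option.map (List.map M.outputAlphabet)) := by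
  induction h with
  | nil c => exact ⟨rfl, fun i hi => absurd hi (Nat.not_lt_zero i), rfl⟩
  | cons l v S τ c' h ih =>
    rw [← M.next_mk] at ih
    obtain ⟨h1, h2, h3⟩ := ih
    refine ⟨h1, ?_, ?_⟩
    · rintro (_ | i) hi
      · exact Option.some_ne_none _
      · exact h2 i (Nat.lt_of_succ_lt_succ hi)
    · rw [List.length_cons, List.range_succ_eq_map, List.map_cons, List.map_cons, List.map_map,
        ← h3]
      congr 1
      exact M.emit_mk l v S

theorem exists_runsTo (c : M.tm.Cfg) (n : ℕ) (h : ∀ i < n, (M.next^[i] c).l ≠ none) :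
    ∃ τ, τ.length = n ∧ M.RunsTo c τ (M.next^[n] c) := by
  induction n generalizing c with
  | zero => exact ⟨[], rfl, .nil c⟩
  | succ n ih =>
    obtain ⟨l, v, S⟩ := c
    cases l with
    | none => exact absurd rfl (h 0 (Nat.succ_pos n))
    | some l =>
      obtain ⟨τ, h1, h2⟩ := ih (M.next ⟨some l, v, S⟩) fun i hi => h (i + 1) (Nat.succ_lt_succ hi)
      refine ⟨_, ?_, Trace.cons l v S τ _ (by rw [← M.next_mk]; exact h2)⟩
      rw [List.length_cons, h1]

theorem HaltsAt.exists_runsTo {u : List I} {T : ℕ} (h : M.HaltsAt u T) :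
    ∃ τ c', τ.length = T ∧ M.RunsTo (M.start u) τ c' ∧ c'.l = none ∧ c' = M.config u T := by
  obtain ⟨τ, h1, h2⟩ := EnumMachine.exists_runsTo (M := M) (M.start u) T fun i hi => by
    rw [← config_eq_iterate]; exact h.2 i hi
  rw [← config_eq_iterate] at h2
  exact ⟨τ, _, h1, h2, h.1, rfl⟩

theorem RunsTo.config_eq {u : List I} {c' τ} (h : M.RunsTo (M.start u) τ c') :
    M.config u τ.length = c' := by
  rw [config_eq_iterate]; exact h.spec.1

theorem RunsTo.haltsAt {u : List I} {c' τ} (h : M.RunsTo (M.start u) τ c') (hc : c'.l = none) :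
    M.HaltsAt u τ.length := by
  refine ⟨by rw [h.config_eq, hc], fun i hi => ?_⟩
  rw [config_eq_iterate]
  exact h.spec.2.1 i hi

theorem RunsTo.map_emit {u : List I} {c' τ} (h : M.RunsTo (M.start u) τ c') :
    (List.range τ.length).map (fun i => M.emit (M.config u i)) =
      τ.map (Option.map (List.map M.outputAlphabet)) := by
  simp only [config_eq_iterate]
  exact h.spec.2.2

theorem RunsTo.outputs_eq {u : List I} {c' τ} (h : M.RunsTo (M.start u) τ c') :
    M.outputs u τ.length = τ.reduceOption.map (List.map M.outputAlphabet) := by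
  have : M.outputs u τ.length =
      ((List.range τ.length).map fun i => M.emit (M.config u i)).reduceOption := by
    rw [outputs, List.reduceOption, List.filterMap_map]; rfl
  rw [this, h.map_emit, List.reduceOption_map]

/-- The times at which words are output in the trace `τ`, started at time `i`. -/
def traceTimes {β : Type} : ℕ → List (Option β) → List ℕ
  | _, [] => []
  | i, none :: τ => traceTimes (i + 1) τ
  | i, some _ :: τ => i :: traceTimes (i + 1) τ

theorem traceTimes_map_range' {β : Type} (f : ℕ → Option β) (n : ℕ) : ∀ i,
    traceTimes i ((List.range' i n).map f) = (List.range' i n).filter fun j => (f j).isSome := by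
  induction n with
  | zero => intro i; rfl
  | succ n ih =>
    intro i
    rw [List.range'_succ, List.map_cons]
    cases h : f i <;> simp [traceTimes, ih, h]

/-- The differences of consecutive output times, as in `EnumMachine.delays`, in terms of `Paced`;
here `a` is the time of the last output and `i` is the current time. -/
theorem forall_delays_le_iff {β : Type} {d : ℕ} (τ : List (Option β)) : ∀ a i, a ≤ i →
    ((∀ δ ∈ List.zipWith (fun a b => b - a) (a :: traceTimes i τ)
      (traceTimes i τ ++ [i + τ.length]), δ ≤ d) ↔ Paced d (i - a) τ) := by
  induction τ with
  | nil => intro a i h; simp [traceTimes, Paced]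
  | cons e τ ih =>
    intro a i h
    cases e with
    | none =>
      have := ih a (i + 1) (by omega)
      rw [show i + 1 - a = i - a + 1 by omega] at this
      rw [Paced, ← this, traceTimes, List.length_cons, show i + 1 + τ.length = i + (τ.length + 1) by
        omega]
    | some w =>
      have := ih i (i + 1) (by omega)
      rw [show i + 1 - i = 1 by omega] at this
      rw [Paced, ← this, traceTimes, List.length_cons, show i + 1 + τ.length = i + (τ.length + 1) by
        omega]
      simp

theorem outputTimes_eq (u : List I) (T : ℕ) : M.outputTimes u T =
    traceTimes 0 ((List.range T).map fun i => M.emit (M.config u i)) := by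
  rw [List.range_eq_range', traceTimes_map_range', outputTimes, List.range_eq_range']
  congr 1
  funext i
  unfold emit
  cases M.outputsAt (M.config u i) <;> simp

theorem RunsTo.delays_le_iff {u : List I} {c' τ} {d : ℕ} (h : M.RunsTo (M.start u) τ c') :
    (∀ δ ∈ M.delays u τ.length, δ ≤ d) ↔ Paced d 0 τ := by
  have := forall_delays_le_iff (d := d) (τ.map (Option.map (List.map M.outputAlphabet))) 0 0 le_rfl
  rw [Paced.map, List.length_map, Nat.zero_add] at this
  rw [← this, delays, outputTimes_eq, h.map_emit]

theorem RunsTo.enumerates {u : List I} {c' τ} {d : ℕ} {S : Set (List O)}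
    (h : M.RunsTo (M.start u) τ c') (hc : c'.l = none)
    (hn : (τ.reduceOption.map (List.map M.outputAlphabet)).Nodup)
    (hS : ∀ w, w ∈ τ.reduceOption.map (List.map M.outputAlphabet) ↔ w ∈ S) (hp : Paced d 0 τ) :
    M.EnumeratesWithDelay u S d :=
  ⟨τ.length, h.haltsAt hc, by rwa [h.outputs_eq], by rwa [h.outputs_eq], h.delays_le_iff.2 hp⟩

theorem EnumeratesWithDelay.exists_runsTo {u : List I} {d : ℕ} {S : Set (List O)}
    (h : M.EnumeratesWithDelay u S d) : ∃ τ c', M.RunsTo (M.start u) τ c' ∧ c'.l = none ∧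
      (τ.reduceOption.map (List.map M.outputAlphabet)).Nodup ∧
      (∀ w, w ∈ τ.reduceOption.map (List.map M.outputAlphabet) ↔ w ∈ S) ∧ Paced d 0 τ := by
  obtain ⟨T, hT, h1, h2, h3⟩ := h
  obtain ⟨τ, c', rfl, h4, h5, -⟩ := hT.exists_runsTo
  rw [h4.outputs_eq] at h1 h2
  exact ⟨τ, c', h4, h5, h1, h2, h4.delays_le_iff.1 h3⟩

end EnumMachine

namespace StackMachine

/-! ### Program fragments -/

section Fragments

variable {K : Type} [DecidableEq K] {Γ : K → Type} {σ : Type} {ko : K}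

/-- The program `p` leads from `s` to `s'` in at most `n` steps, without outputs. -/
def Does (ko : K) (p : Prog Γ σ) (s : σ × ∀ k, List (Γ k)) (n : ℕ) (s' : σ × ∀ k, List (Γ k)) :
    Prop :=
  ∃ i ≤ n, Run ko p s (List.replicate i none) s'

theorem Does.mono {p : Prog Γ σ} {s s' n n'} (h : Does ko p s n s') (hn : n ≤ n') :
    Does ko p s n' s' :=
  let ⟨i, hi, h⟩ := h
  ⟨i, hi.trans hn, h⟩

theorem Does.seq {p q : Prog Γ σ} {s₁ s₂ s₃ n₁ n₂} (h₁ : Does ko p s₁ n₁ s₂)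
    (h₂ : Does ko q s₂ n₂ s₃) : Does ko (.seq p q) s₁ (n₁ + n₂) s₃ := by
  obtain ⟨i, hi, h₁⟩ := h₁
  obtain ⟨j, hj, h₂⟩ := h₂
  exact ⟨i + j, by omega, by rw [List.replicate_add]; exact .seq h₁ h₂⟩

theorem does_block (b : TM2.Stmt Γ Unit σ) (s) : Does ko (.block b) s 1 (exec b s) :=
  ⟨1, le_rfl, .block b s⟩

theorem Does.switch {p : σ → Prog Γ σ} {s s' n} (h : Does ko (p s.1) s n s') :
    Does ko (.switch p) s (n + 1) s' := by
  obtain ⟨i, hi, h⟩ := h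
  exact ⟨i + 1, by omega, .switch h⟩

theorem does_loop_exit {b : TM2.Stmt Γ Unit σ} {c : σ → Bool} {p : Prog Γ σ} {s}
    (hc : c (exec b s).1 = false) : Does ko (.loop b c p) s 1 (exec b s) :=
  ⟨1, le_rfl, .loop_exit hc⟩

theorem Does.loop_step {b : TM2.Stmt Γ Unit σ} {c : σ → Bool} {p : Prog Γ σ} {s s₁ s₂ n₁ n₂}
    (hc : c (exec b s).1 = true) (h₁ : Does ko p (exec b s) n₁ s₁)
    (h₂ : Does ko (.loop b c p) s₁ n₂ s₂) : Does ko (.loop b c p) s (n₁ + n₂ + 1) s₂ := by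
  obtain ⟨i, hi, h₁⟩ := h₁
  obtain ⟨j, hj, h₂⟩ := h₂
  exact ⟨i + j + 1, by omega, by
    rw [List.replicate_succ, List.replicate_add]; exact .loop_step hc h₁ h₂⟩

/-- The stacks after pushing the symbols in the list `L` one by one. -/
def pushed (L : List (Σ k, Γ k)) (S : ∀ k, List (Γ k)) : ∀ k, List (Γ k) :=
  L.foldl (fun S p => Function.update S p.1 (p.2 :: S p.1)) S

/-- The statement that pushes the symbols in the list `L` one by one. -/
def pushList (L : List (Σ k, Γ k)) : TM2.Stmt Γ Unit σ :=
  L.foldr (fun p q => .push p.1 (fun _ => p.2) q) .halt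

theorem exec_pushList (L : List (Σ k, Γ k)) (v : σ) (S : ∀ k, List (Γ k)) :
    exec (pushList L) (v, S) = (v, pushed L S) := by
  induction L generalizing S with
  | nil => rfl
  | cons p L ih => exact ih (Function.update S p.1 (p.2 :: S p.1))

theorem pushed_append (L₁ L₂ : List (Σ k, Γ k)) (S : ∀ k, List (Γ k)) :
    pushed (L₁ ++ L₂) S = pushed L₂ (pushed L₁ S) := by
  simp [pushed]

theorem pushed_update {k : K} (L : List (Σ k, Γ k)) (h : ∀ p ∈ L, p.1 ≠ k) (S : ∀ k, List (Γ k))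
    (x : List (Γ k)) : pushed L (Function.update S k x) = Function.update (pushed L S) k x := by
  induction L generalizing S with
  | nil => rfl
  | cons p L ih =>
    have hp : p.1 ≠ k := h p (by simp)
    simp only [pushed, List.foldl_cons] at ih ⊢
    rw [Function.update_of_ne hp, Function.update_comm hp.symm]
    exact ih (fun q hq => h q (by simp [hq])) _

theorem pushed_apply_of_ne {k : K} (L : List (Σ k, Γ k)) (h : ∀ p ∈ L, p.1 ≠ k)
    (S : ∀ k, List (Γ k)) : pushed L S k = S k := by
  have := congrFun (pushed_update L h S (S k)) k
  rwa [Function.update_eq_self, Function.update_self] at this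

theorem pushed_map {β : Type} (j : K) (f : β → Γ j) (l : List β) (S : ∀ k, List (Γ k)) :
    pushed (l.map fun a => ⟨j, f a⟩) S = Function.update S j ((l.map f).reverse ++ S j) := by
  induction l generalizing S with
  | nil => simp [pushed]
  | cons a l ih =>
    simp only [pushed, List.map_cons, List.foldl_cons] at ih ⊢
    rw [ih]
    simp

theorem pushed_flatMap_pair {β : Type} {i j : K} (hij : i ≠ j) (f : β → Γ i) (g : β → Γ j)
    (l : List β) (S : ∀ k, List (Γ k)) :
    pushed (l.flatMap fun a => [⟨i, f a⟩, ⟨j, g a⟩]) S =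
      Function.update (Function.update S i ((l.map f).reverse ++ S i)) j
        ((l.map g).reverse ++ S j) := by
  induction l generalizing S with
  | nil => simp [pushed]
  | cons a l ih =>
    rw [List.flatMap_cons, pushed_append, ih]
    funext k
    by_cases h1 : k = j
    · subst h1; simp [pushed, hij.symm]
    · by_cases h2 : k = i
      · subst h2; simp [pushed, hij]
      · simp [pushed, h1, h2]

end Fragments

/-- The variable of a program with a register for each stack, and further data in `β`. -/
abbrev Var {K : Type} (Γ : K → Type) (β : Type) : Type := (∀ k, Option (Γ k)) × β

section Registers

variable {K : Type} [DecidableEq K] {Γ : K → Type} {β : Type} {ko : K}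

/-- Pop the top symbol of stack `k` into the register of this stack. -/
def popInto (k : K) : TM2.Stmt Γ Unit (Var Γ β) :=
  .pop k (fun v a => (Function.update v.1 k a, v.2)) .halt

/-- Read the top symbol of stack `k` into the register of this stack. -/
def peekInto (k : K) : TM2.Stmt Γ Unit (Var Γ β) :=
  .peek k (fun v a => (Function.update v.1 k a, v.2)) .halt

theorem exec_popInto (k : K) (v : Var Γ β) (S : ∀ k, List (Γ k)) :
    exec (popInto k) (v, S) =
      ((Function.update v.1 k (S k).head?, v.2), Function.update S k (S k).tail) := rfl

/-- Pop symbols `a` from stack `k` and push the symbols `g a`, as long as `P` holds of the popped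
symbol.  The first symbol without `P` is popped but nothing is pushed for it. -/
def transferWhile (k : K) (P : Γ k → Bool) (g : Γ k → List (Σ k, Γ k)) : Prog Γ (Var Γ β) :=
  .loop (popInto k) (fun v => (v.1 k).any P)
    (.switch fun v => .block (pushList ((v.1 k).elim [] g)))

theorem does_transferWhile {k : K} {P : Γ k → Bool} {g : Γ k → List (Σ k, Γ k)}
    (hg : ∀ a, ∀ p ∈ g a, p.1 ≠ k) (l r : List (Γ k)) (hl : ∀ a ∈ l, P a = true)
    (hr : ∀ a ∈ r.head?, P a = false) (v : Var Γ β) (S : ∀ k, List (Γ k)) (hS : S k = l ++ r) :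
    ∃ v' : Var Γ β, v'.2 = v.2 ∧ Does ko (transferWhile k P g) (v, S) (3 * l.length + 1)
      (v', Function.update (pushed (l.flatMap g) S) k r.tail) := by
  induction l generalizing v S with
  | nil =>
    refine ⟨(Function.update v.1 k r.head?, v.2), rfl, ?_⟩
    have := does_loop_exit (ko := ko) (b := popInto k) (c := fun v : Var Γ β => (v.1 k).any P)
      (p := .switch fun v => .block (pushList ((v.1 k).elim [] g))) (s := (v, S)) (by
        rw [exec_popInto, hS]
        simp only [List.nil_append, Function.update_self]
        cases h : r.head? with
        | none => rfl
        | some a => simpa using hr a h)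
    rw [exec_popInto, hS] at this
    simpa [pushed, transferWhile] using this
  | cons a l ih =>
    obtain ⟨v', h1, h2⟩ := ih (fun b hb => hl b (by simp [hb]))
      (Function.update v.1 k (some a), v.2) (pushed (g a) (Function.update S k (l ++ r))) (by
        rw [pushed_update _ (hg a), Function.update_self])
    refine ⟨v', h1, ?_⟩
    have h3 : exec (popInto k) (v, S) =
        ((Function.update v.1 k (some a), v.2), Function.update S k (l ++ r)) := by
      rw [exec_popInto, hS]; rfl
    refine (Does.loop_step (n₁ := 2) (n₂ := 3 * l.length + 1)
      (s₁ := ((Function.update v.1 k (some a), v.2), pushed (g a) (Function.update S k (l ++ r))))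
      ?_ ?_ ?_).mono (by simp; omega)
    · rw [h3]; simpa using hl a (by simp)
    · rw [h3]
      refine Does.switch (n := 1) ?_
      have := does_block (ko := ko) (σ := Var Γ β) (pushList (g a))
        ((Function.update v.1 k (some a), v.2), Function.update S k (l ++ r))
      rw [exec_pushList] at this
      simpa using this
    · have h4 : ∀ p ∈ l.flatMap g, p.1 ≠ k := fun p hp => by
        obtain ⟨b, -, hb⟩ := List.mem_flatMap.1 hp
        exact hg b p hb
      rw [pushed_update _ (hg a), pushed_update _ h4, Function.update_idem] at h2
      rw [List.flatMap_cons, pushed_append, pushed_update _ (hg a)]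
      exact h2

/-- Pop all symbols `a` from stack `k` and push the symbols `g a`. -/
def transfer (k : K) (g : Γ k → List (Σ k, Γ k)) : Prog Γ (Var Γ β) :=
  transferWhile k (fun _ => true) g

theorem does_transfer {k : K} {g : Γ k → List (Σ k, Γ k)}
    (hg : ∀ a, ∀ p ∈ g a, p.1 ≠ k) (v : Var Γ β) (S : ∀ k, List (Γ k)) :
    ∃ v' : Var Γ β, v'.2 = v.2 ∧ Does ko (transfer k g) (v, S) (3 * (S k).length + 1)
      (v', Function.update (pushed ((S k).flatMap g) S) k []) :=
  does_transferWhile hg (S k) [] (fun _ _ => rfl) (by simp) v S (by simp)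

/-- Empty stack `k`. -/
theorem does_drain (k : K) (s : Var Γ β × ∀ k, List (Γ k)) :
    ∃ s' : Var Γ β × ∀ k, List (Γ k), s'.1.2 = s.1.2 ∧
      Does ko (transfer k fun _ => []) s (3 * (s.2 k).length + 1) s' ∧ s'.2 k = [] ∧
      ∀ j, j ≠ k → s'.2 j = s.2 j := by
  obtain ⟨v', h1, h2⟩ := does_transfer (ko := ko) (g := fun _ : Γ k => []) (by simp) s.1 s.2
  rw [show (s.2 k).flatMap (fun _ : Γ k => ([] : List (Σ k, Γ k))) = [] by simp] at h2
  exact ⟨_, h1, h2, by simp, fun j hj => by simp [hj, pushed]⟩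

/-- Move stack `i` to stack `j`, which reverses it. -/
theorem does_transfer_single {i j : K} (hij : i ≠ j) (f : Γ i → Γ j)
    (s : Var Γ β × ∀ k, List (Γ k)) :
    ∃ s' : Var Γ β × ∀ k, List (Γ k), s'.1.2 = s.1.2 ∧
      Does ko (transfer i fun a => [⟨j, f a⟩]) s (3 * (s.2 i).length + 1) s' ∧ s'.2 i = [] ∧
      s'.2 j = ((s.2 i).map f).reverse ++ s.2 j ∧ ∀ k, k ≠ i → k ≠ j → s'.2 k = s.2 k := by
  obtain ⟨v', h1, h2⟩ := does_transfer (ko := ko) (g := fun a : Γ i => [⟨j, f a⟩])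
    (by simp [hij.symm]) s.1 s.2
  rw [← List.map_eq_flatMap, pushed_map] at h2
  exact ⟨_, h1, h2, by simp, by simp [hij.symm], fun k hi hj => by simp [hi, hj]⟩

/-- Move stack `i` to the stacks `j` and `k`, which reverses it. -/
theorem does_transfer_pair {i j k : K} (hij : i ≠ j) (hik : i ≠ k) (hjk : j ≠ k)
    (f : Γ i → Γ j) (g : Γ i → Γ k) (s : Var Γ β × ∀ k, List (Γ k)) :
    ∃ s' : Var Γ β × ∀ k, List (Γ k), s'.1.2 = s.1.2 ∧
      Does ko (transfer i fun a => [⟨j, f a⟩, ⟨k, g a⟩]) s (3 * (s.2 i).length + 1) s' ∧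
      s'.2 i = [] ∧ s'.2 j = ((s.2 i).map f).reverse ++ s.2 j ∧
      s'.2 k = ((s.2 i).map g).reverse ++ s.2 k ∧
      ∀ l, l ≠ i → l ≠ j → l ≠ k → s'.2 l = s.2 l := by
  obtain ⟨v', h1, h2⟩ := does_transfer (ko := ko) (g := fun a : Γ i => [⟨j, f a⟩, ⟨k, g a⟩])
    (by simp [hij.symm, hik.symm]) s.1 s.2
  rw [pushed_flatMap_pair hjk] at h2
  exact ⟨_, h1, h2, by simp, by simp [hij.symm, hjk], by simp [hik.symm],
    fun l hi hj hk => by simp [hi, hj, hk]⟩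

end Registers

/-! ### Simulation of a machine by a program -/

/-- The part of a stack above the first symbol without a meaning, decoded by `r`. -/
def view {C G : Type} (r : C → Option G) : List C → List G
  | [] => []
  | c :: l => (r c).elim [] fun a => a :: view r l

theorem view_head? {C G : Type} (r : C → Option G) (l : List C) :
    (view r l).head? = l.head?.bind r := by
  cases l with
  | nil => rfl
  | cons c l => cases h : r c <;> simp [view, h]

theorem view_tail {C G : Type} (r : C → Option G) {l : List C}
    (h : (l.head?.bind r).isSome = true) : view r l.tail = (view r l).tail := by
  cases l with
  | nil => rfl
  | cons c l => cases h : r c <;> simp_all [view]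

theorem view_cons {C G : Type} {r : C → Option G} {c : C} {a : G} (h : r c = some a) (l : List C) :
    view r (c :: l) = a :: view r l := by simp [view, h]

theorem view_map_append {C G : Type} {r : C → Option G} {w : G → C} (l : List G)
    (h : ∀ a ∈ l, r (w a) = some a) (l' : List C) :
    view r (l.map w ++ l') = l ++ view r l' := by
  induction l with
  | nil => rfl
  | cons a l ih =>
    simp only [List.map_cons, List.cons_append]
    rw [view_cons (h a (by simp)), ih fun b hb => h b (by simp [hb])]

theorem view_some {C : Type} (l : List C) : view some l = l := by
  induction l with
  | nil => rfl
  | cons c l ih => simp [view, ih]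

/-- The view of a stack ends at its bottom or at the first symbol without a meaning. -/
theorem eq_append_of_view {C G : Type} {r : C → Option G} (l : List C) :
    ∃ l₁ l₂, l = l₁ ++ l₂ ∧ l₁.map r = (view r l).map some ∧ ∀ c ∈ l₂.head?, r c = none := by
  induction l with
  | nil => exact ⟨[], [], rfl, rfl, by simp⟩
  | cons c l ih =>
    cases h : r c with
    | none => exact ⟨[], c :: l, rfl, by simp [view, h], by simp [h]⟩
    | some a =>
      obtain ⟨l₁, l₂, h1, h2, h3⟩ := ih
      exact ⟨c :: l₁, l₂, by simp [h1], by simp [view, h, h2], h3⟩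

theorem map_view {C G : Type} {r : C → Option G} {w : G → C} (h : ∀ c, (r c).map w = some c)
    (l : List C) : (view r l).map w = l := by
  induction l with
  | nil => rfl
  | cons c l ih =>
    have := h c
    cases h' : r c with
    | none => simp [h'] at this
    | some a =>
      simp only [h', Option.map_some, Option.some.injEq] at this
      simp [view, h', ih, this]

/-- How a program with stacks `Γ₂` and variable `Var Γ₂ β` represents the configurations of a
machine with stacks `Γ₁`, labels `Λ₁` and variable `σ₁`. -/
structure Layout {K₁ K₂ : Type} (Γ₁ : K₁ → Type) (Γ₂ : K₂ → Type) (Λ₁ σ₁ β : Type) where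
  /-- where the stacks are -/
  emb : K₁ → K₂
  emb_injective : Function.Injective emb
  /-- how symbols are coded -/
  wr : ∀ k, Γ₁ k → Γ₂ (emb k)
  /-- how symbols are decoded; a symbol decoded to `none` plays the role of the stack bottom -/
  rd : ∀ k, Γ₂ (emb k) → Option (Γ₁ k)
  /-- the label and the variable of the machine -/
  get : β → Option Λ₁ × σ₁
  /-- replace the label and the variable of the machine -/
  set : Option Λ₁ × σ₁ → β → β
  get_set : ∀ x b, get (set x b) = x

namespace Layout

variable {K₁ K₂ : Type} [DecidableEq K₁] [DecidableEq K₂] {Γ₁ : K₁ → Type} {Γ₂ : K₂ → Type}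
  {Λ₁ σ₁ β : Type} (L : Layout Γ₁ Γ₂ Λ₁ σ₁ β)

/-- Change the variable of the simulated machine. -/
def upd (f : σ₁ → σ₁) (v : Var Γ₂ β) : Var Γ₂ β :=
  (v.1, L.set ((L.get v.2).1, f (L.get v.2).2) v.2)

/-- Store the label of the next instruction of the simulated machine. -/
def putLabel (f : σ₁ → Option Λ₁) (v : Var Γ₂ β) : Var Γ₂ β :=
  (v.1, L.set (f (L.get v.2).2, (L.get v.2).2) v.2)

/-- The statement that simulates a statement. -/
def tr : TM2.Stmt Γ₁ Λ₁ σ₁ → TM2.Stmt Γ₂ Unit (Var Γ₂ β)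
  | .push k f q => .push (L.emb k) (fun v => L.wr k (f (L.get v.2).2)) (tr q)
  | .peek k f q => .peek (L.emb k) (fun v a => L.upd (fun x => f x (a.bind (L.rd k))) v) (tr q)
  | .pop k f q =>
    -- A symbol that represents the stack bottom has to stay where it is.
    .peek (L.emb k) (fun v a => (Function.update v.1 (L.emb k) a, v.2)) <|
      .branch (fun v => ((v.1 (L.emb k)).bind (L.rd k)).isSome)
        (.pop (L.emb k) (fun v a => L.upd (fun x => f x (a.bind (L.rd k))) v) (tr q))
        (.load (L.upd fun x => f x none) (tr q))
  | .load f q => .load (L.upd f) (tr q)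
  | .branch f q₁ q₂ => .branch (fun v => f (L.get v.2).2) (tr q₁) (tr q₂)
  | .goto f => .load (L.putLabel fun x => some (f x)) .halt
  | .halt => .load (L.putLabel fun _ => none) .halt

/-- All symbols pushed by a statement can be decoded. -/
def Readable : TM2.Stmt Γ₁ Λ₁ σ₁ → Prop
  | .push k f q => (∀ x, L.rd k (L.wr k (f x)) = some (f x)) ∧ Readable q
  | .peek _ _ q => Readable q
  | .pop _ _ q => Readable q
  | .load _ q => Readable q
  | .branch _ q₁ q₂ => Readable q₁ ∧ Readable q₂
  | .goto _ => True
  | .halt => True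

/-- The stacks `S` represent the stacks `T` of the simulated machine. -/
def Stacks (S : ∀ k, List (Γ₂ k)) (T : ∀ k, List (Γ₁ k)) : Prop :=
  ∀ k, view (L.rd k) (S (L.emb k)) = T k

/-- The state `s` represents the configuration `c`. -/
def Rel (s : Var Γ₂ β × ∀ k, List (Γ₂ k)) (c : TM2.Cfg Γ₁ Λ₁ σ₁) : Prop :=
  L.get s.1.2 = (c.l, c.var) ∧ L.Stacks s.2 c.stk

variable {L}

theorem Stacks.update {S : ∀ k, List (Γ₂ k)} {T : ∀ k, List (Γ₁ k)} (h : L.Stacks S T) (k : K₁)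
    {x y} (hxy : view (L.rd k) x = y) :
    L.Stacks (Function.update S (L.emb k) x) (Function.update T k y) := by
  intro j
  by_cases hj : j = k
  · subst hj; simpa using hxy
  · rw [Function.update_of_ne hj, Function.update_of_ne (L.emb_injective.ne hj)]; exact h j

theorem Stacks.congr {S S' : ∀ k, List (Γ₂ k)} {T : ∀ k, List (Γ₁ k)} (h : L.Stacks S T)
    (hS : ∀ k, S' (L.emb k) = S (L.emb k)) : L.Stacks S' T := fun k => by rw [hS]; exact h k

theorem Stacks.head?_eq {S : ∀ k, List (Γ₂ k)} {T : ∀ k, List (Γ₁ k)} (h : L.Stacks S T) (k : K₁) :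
    (S (L.emb k)).head?.bind (L.rd k) = (T k).head? := by
  rw [← view_head?, h k]

/-- Simulation of one statement. -/
theorem rel_exec_tr {q : TM2.Stmt Γ₁ Λ₁ σ₁} (hq : L.Readable q) (v : Var Γ₂ β)
    (S : ∀ k, List (Γ₂ k)) (x : σ₁) (T : ∀ k, List (Γ₁ k)) (hv : (L.get v.2).2 = x)
    (hS : L.Stacks S T) : L.Rel (exec (L.tr q) (v, S)) (TM2.stepAux q x T) := by
  induction q generalizing v S x T with
  | push k f q ih =>
    refine ih hq.2 v (Function.update S (L.emb k) (L.wr k (f (L.get v.2).2) :: S (L.emb k))) x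
      (Function.update T k (f x :: T k)) hv (hS.update k ?_)
    rw [hv, view_cons (hq.1 x), hS k]
  | peek k f q ih =>
    refine ih hq (L.upd (fun x => f x _) v) S _ T ?_ hS
    simp only [upd, L.get_set]
    rw [hv, hS.head?_eq]
  | pop k f q ih =>
    have e := hS.head?_eq k
    cases h : (T k).head? with
    | none =>
      have h' : T k = [] := by simpa using h
      have : exec (L.tr (.pop k f q)) (v, S) = exec (L.tr q)
          (L.upd (fun x => f x none)
            (Function.update v.1 (L.emb k) (S (L.emb k)).head?, v.2), S) := by
        simp [exec, tr, e, h]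
      rw [this, TM2.stepAux, h]
      refine ih hq _ _ _ _ ?_ ?_
      · simp only [upd, L.get_set]; rw [hv]
      · rw [h', List.tail_nil, ← h', Function.update_eq_self]; exact hS
    | some a =>
      have : exec (L.tr (.pop k f q)) (v, S) = exec (L.tr q)
          (L.upd (fun x => f x ((S (L.emb k)).head?.bind (L.rd k)))
            (Function.update v.1 (L.emb k) (S (L.emb k)).head?, v.2),
            Function.update S (L.emb k) (S (L.emb k)).tail) := by
        simp [exec, tr, e, h]
      rw [this, TM2.stepAux]
      refine ih hq _ _ _ _ ?_ ?_
      · simp only [upd, L.get_set]; rw [hv, e]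
      · refine hS.update k ?_
        rw [view_tail, hS k]
        rw [e, h]; rfl
  | load f q ih =>
    refine ih hq (L.upd f v) S _ T ?_ hS
    simp only [upd, L.get_set]
    rw [hv]
  | branch f q₁ q₂ ih₁ ih₂ =>
    have : exec (L.tr (.branch f q₁ q₂)) (v, S) =
        cond (f x) (exec (L.tr q₁) (v, S)) (exec (L.tr q₂) (v, S)) := by
      simp only [exec, tr, TM2.stepAux, hv]
      cases f x <;> rfl
    rw [this, TM2.stepAux]
    cases f x
    · exact ih₂ hq.2 v S x T hv hS
    · exact ih₁ hq.1 v S x T hv hS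
  | goto f => exact ⟨by simp [exec, tr, putLabel, L.get_set, hv], hS⟩
  | halt => exact ⟨by simp [exec, tr, putLabel, L.get_set, hv], hS⟩

/-- The simulation does not touch the stacks that do not belong to the simulated machine. -/
theorem exec_tr_frame (q : TM2.Stmt Γ₁ Λ₁ σ₁) {j : K₂} (hj : ∀ k, L.emb k ≠ j) (v : Var Γ₂ β)
    (S : ∀ k, List (Γ₂ k)) : (exec (L.tr q) (v, S)).2 j = S j := by
  induction q generalizing v S with
  | push k f q ih => exact (ih _ _).trans (Function.update_of_ne (hj k).symm _ _)
  | peek k f q ih => exact ih _ _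
  | pop k f q ih =>
    have : ∀ b : Bool, ∀ v₁ v₂ S₁ S₂, S₁ j = S j → S₂ j = S j →
        (cond b (TM2.stepAux (L.tr q) v₁ S₁) (TM2.stepAux (L.tr q) v₂ S₂)).stk j = S j := by
      intro b v₁ v₂ S₁ S₂ h₁ h₂
      cases b
      · exact (ih v₂ S₂).trans h₂
      · exact (ih v₁ S₁).trans h₁
    exact this _ _ _ _ _ (Function.update_of_ne (hj k).symm _ _) rfl
  | load f q ih => exact ih _ _
  | branch f q₁ q₂ ih₁ ih₂ =>
    simp only [exec, tr, TM2.stepAux]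
    cases f (L.get v.2).2
    · exact ih₂ _ _
    · exact ih₁ _ _
  | goto f => rfl
  | halt => rfl

variable (L)

/-- Simulate the step of the machine at its current label; the last argument says which labels are
treated as output instructions. -/
def simStep (m : Λ₁ → TM2.Stmt Γ₁ Λ₁ σ₁) (o : Λ₁ → Bool) : Prog Γ₂ (Var Γ₂ β) :=
  .switch fun v => (L.get v.2).1.elim (.block .halt) fun l =>
    if o l then .seq .emit (.block (L.tr (m l))) else .block (L.tr (m l))

/-- Simulate the machine until it halts. -/
def simulate (m : Λ₁ → TM2.Stmt Γ₁ Λ₁ σ₁) (o : Λ₁ → Bool) : Prog Γ₂ (Var Γ₂ β) :=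
  .loop .halt (fun v => (L.get v.2).1.isSome) (L.simStep m o)

variable {L} {m : Λ₁ → TM2.Stmt Γ₁ Λ₁ σ₁}

theorem does_simStep {ko : K₂} (hm : ∀ l, L.Readable (m l)) {s : Var Γ₂ β × ∀ k, List (Γ₂ k)}
    {l : Λ₁} {x : σ₁} {T : ∀ k, List (Γ₁ k)} (h : L.Rel s ⟨some l, x, T⟩) :
    ∃ s', L.Rel s' (TM2.stepAux (m l) x T) ∧ (∀ j, (∀ k, L.emb k ≠ j) → s'.2 j = s.2 j) ∧
      Run ko (L.simStep m fun _ => false) s [none, none] s' := by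
  refine ⟨exec (L.tr (m l)) s, rel_exec_tr (hm l) s.1 s.2 x T (by rw [h.1]) h.2,
    fun j hj => exec_tr_frame _ hj _ _, .switch ?_⟩
  simp only [h.1, Option.elim_some, Bool.false_eq_true, if_false]
  exact .block _ _

/-- A computation without outputs is simulated within three steps for each of its steps. -/
theorem does_simulate {ko : K₂} (hm : ∀ l, L.Readable (m l)) {c c' : TM2.Cfg Γ₁ Λ₁ σ₁} {ko₁ : K₁}
    {τ} (h : Trace m (fun _ => false) ko₁ c τ c') (hc' : c'.l = none) :
    ∀ s : Var Γ₂ β × ∀ k, List (Γ₂ k), L.Rel s c →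
    ∃ s', L.Rel s' c' ∧ (∀ j, (∀ k, L.emb k ≠ j) → s'.2 j = s.2 j) ∧
      Does ko (L.simulate m fun _ => false) s (3 * τ.length + 1) s' := by
  induction h with
  | nil c =>
    intro s hs
    exact ⟨s, hs, fun _ _ => rfl, does_loop_exit (b := .halt) (s := s) (by
      change (L.get s.1.2).1.isSome = false
      rw [hs.1, hc']; rfl)⟩
  | cons l x T τ c' h ih =>
    intro s hs
    obtain ⟨s₁, h1, h2, h3⟩ := does_simStep (ko := ko) hm hs
    obtain ⟨s₂, h4, h5, h6⟩ := ih hc' s₁ h1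
    refine ⟨s₂, h4, fun j hj => (h5 j hj).trans (h2 j hj), ?_⟩
    refine (Does.loop_step (b := .halt) (s := s) (n₁ := 2) ?_ ⟨2, le_rfl, h3⟩ h6).mono
      (by simp; omega)
    change (L.get s.1.2).1.isSome = true
    rw [hs.1]; rfl

/-- A computation with outputs is simulated with the same outputs, provided that the symbols on the
output stack are in bijection. -/
theorem run_simulate {o : Λ₁ → Bool} {ko : K₁} (hm : ∀ l, L.Readable (m l))
    (hko : ∀ a, (L.rd ko a).map (L.wr ko) = some a) {c c' : TM2.Cfg Γ₁ Λ₁ σ₁} {τ}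
    (h : Trace m o ko c τ c') (hc' : c'.l = none) :
    ∀ s : Var Γ₂ β × ∀ k, List (Γ₂ k), L.Rel s c →
    ∃ s', L.Rel s' c' ∧ (∀ j, (∀ k, L.emb k ≠ j) → s'.2 j = s.2 j) ∧
      Run (L.emb ko) (L.simulate m o) s
        ((τ.flatMap slowed).map (Option.map (List.map (L.wr ko))) ++ [none]) s' := by
  induction h with
  | nil c =>
    intro s hs
    exact ⟨s, hs, fun _ _ => rfl, .loop_exit (b := .halt) (s := s) (by
      change (L.get s.1.2).1.isSome = false
      rw [hs.1, hc']; rfl)⟩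
  | cons l x T τ c' h ih =>
    intro s hs
    have hc : (L.get s.1.2).1.isSome = true := by rw [hs.1]; rfl
    cases hl : o l with
    | false =>
      simp only [hl, Bool.false_eq_true, if_false] at ih h ⊢
      obtain ⟨s₂, h4, h5, h6⟩ := ih hc' (exec (L.tr (m l)) s)
        (rel_exec_tr (hm l) s.1 s.2 x T (by rw [hs.1]) hs.2)
      refine ⟨s₂, h4, fun j hj => (h5 j hj).trans (exec_tr_frame _ hj _ _), ?_⟩
      refine Run.loop_step (b := .halt) (s := s) (τ₁ := [none, none]) hc ?_ h6
      refine .switch ?_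
      change Run _ ((L.get s.1.2).1.elim _ _) s _ _
      simp only [hs.1, Option.elim_some, hl, Bool.false_eq_true, if_false]
      exact .block _ _
    | true =>
      simp only [hl, if_true] at ih h ⊢
      obtain ⟨s₂, h4, h5, h6⟩ := ih hc'
        (exec (L.tr (m l)) (s.1, Function.update s.2 (L.emb ko) []))
        (rel_exec_tr (hm l) _ _ x _ (by rw [hs.1]) (hs.2.update ko rfl))
      refine ⟨s₂, h4, fun j hj => (h5 j hj).trans ((exec_tr_frame _ hj _ _).trans
        (Function.update_of_ne (hj ko).symm _ _)), ?_⟩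
      refine Run.loop_step (b := .halt) (s := s)
        (τ₁ := [none, some ((T ko).map (L.wr ko)), none]) hc ?_ h6
      refine .switch ?_
      change Run _ ((L.get s.1.2).1.elim _ _) s _ _
      simp only [hs.1, Option.elim_some, hl, if_true]
      have h7 : (T ko).map (L.wr ko) = s.2 (L.emb ko) := by
        rw [← map_view hko (s.2 (L.emb ko)), hs.2 ko]
      rw [h7]
      exact .seq (.emit s) (.block _ _)

end Layout

/-! ### The machine of a program -/

section Machine

variable {K : Type} [DecidableEq K] [Finite K] {Γ : K → Type} [∀ k, Finite (Γ k)] {σ : Type}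
  [Finite σ] {I O : Type}

/-- The machine that executes the program `p`. -/
noncomputable def Prog.tm (p : Prog Γ σ) (ki ko : K) (v : σ) : FinTM2 :=
  letI := Fintype.ofFinite K
  letI := p.finite_labels
  letI := Fintype.ofFinite p.Labels
  letI := Fintype.ofFinite σ
  letI := Fintype.ofFinite (Γ ki)
  { K := K
    k₀ := ki
    k₁ := ko
    Γ := Γ
    Λ := p.Labels
    main := p.entry
    σ := σ
    initialState := v
    m := p.code none id }

/-- The enumeration machine that executes the program `p`. -/
noncomputable def Prog.machine (p : Prog Γ σ) (ki ko : K) (v : σ) (ei : Γ ki ≃ I)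
    (eo : Γ ko ≃ O) : EnumMachine I O where
  tm := p.tm ki ko v
  inputAlphabet := ei
  outputAlphabet := eo
  finite_alphabet := ‹∀ k, Finite (Γ k)›
  isOutput := p.isOutput

/-- The stacks at the start of a computation on the input `u`. -/
def inputStacks (ki : K) (u : List (Γ ki)) : ∀ k, List (Γ k) :=
  Function.update (fun _ => []) ki u

theorem stk_initList (N : FinTM2) (w : List (N.Γ N.k₀)) :
    (initList N w).stk = inputStacks N.k₀ w := by
  funext k
  by_cases h : k = N.k₀
  · subst h; simp [initList, inputStacks]
  · simp [initList, inputStacks, h]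

theorem Prog.start_eq (p : Prog Γ σ) (ki ko : K) (v : σ) (u : List (Γ ki)) :
    initList (p.tm ki ko v) u =
      (⟨some p.entry, v, inputStacks ki u⟩ : TM2.Cfg Γ p.Labels σ) := by
  have : (fun k => dite (k = ki) (fun h => by rw [h]; exact u) fun _ => []) =
      inputStacks ki u := by
    funext k
    by_cases h : k = ki
    · subst h; simp [inputStacks]
    · simp [inputStacks, h]
  rw [← this]
  rfl

theorem Prog.runsTo {p : Prog Γ σ} {ki ko : K} {v : σ} {ei : Γ ki ≃ I} {eo : Γ ko ≃ O}
    {u : List I} {τ s'} (h : Run ko p (v, inputStacks ki (u.map ei.symm)) τ s') :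
    (p.machine ki ko v ei eo).RunsTo ((p.machine ki ko v ei eo).start u) τ
      (⟨none, s'.1, s'.2⟩ : TM2.Cfg Γ p.Labels σ) := by
  have h1 := Prog.trace_of_run (m := p.code none id) (o := p.isOutput) h none id
    (fun _ => rfl) (fun _ => rfl)
  have h2 : (p.machine ki ko v ei eo).start u = _ := p.start_eq ki ko v (u.map ei.symm)
  rw [h2]
  exact h1

end Machine

/-! ### Machines for computable functions -/

section Restrict

variable {K : Type} [DecidableEq K] {Γ : K → Type} {Λ σ : Type} [DecidableEq Λ]

/-- Restrict the labels in a statement to a finite set. -/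
def restrictStmt (A : Finset Λ) (d : A) : TM2.Stmt Γ Λ σ → TM2.Stmt Γ A σ
  | .push k f q => .push k f (restrictStmt A d q)
  | .peek k f q => .peek k f (restrictStmt A d q)
  | .pop k f q => .pop k f (restrictStmt A d q)
  | .load f q => .load f (restrictStmt A d q)
  | .branch f q₁ q₂ => .branch f (restrictStmt A d q₁) (restrictStmt A d q₂)
  | .goto f => .goto fun v => if h : f v ∈ A then ⟨f v, h⟩ else d
  | .halt => .halt

/-- Restrict the label of a configuration to a finite set. -/
def restrictCfg (A : Finset Λ) (d : A) (c : TM2.Cfg Γ Λ σ) : TM2.Cfg Γ A σ :=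
  ⟨c.l.map fun l => if h : l ∈ A then ⟨l, h⟩ else d, c.var, c.stk⟩

theorem stepAux_restrictStmt (A : Finset Λ) (d : A) (q : TM2.Stmt Γ Λ σ) (v : σ)
    (S : ∀ k, List (Γ k)) :
    TM2.stepAux (restrictStmt A d q) v S = restrictCfg A d (TM2.stepAux q v S) := by
  induction q generalizing v S with
  | push k f q ih => exact ih _ _
  | peek k f q ih => exact ih _ _
  | pop k f q ih => exact ih _ _
  | load f q ih => exact ih _ _
  | branch f q₁ q₂ ih₁ ih₂ =>
    simp only [restrictStmt, TM2.stepAux, ih₁, ih₂]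
    cases f v <;> rfl
  | goto f => rfl
  | halt => rfl

/-- Mathlib's machines for partial recursive functions have infinitely many labels, but only a
finite set of them is reachable. -/
theorem exists_trace_of_reaches [Inhabited Λ] {m : Λ → TM2.Stmt Γ Λ σ} {A : Finset Λ} {d : A}
    (hA : TM2.Supports m A) {k : K} {c c' : TM2.Cfg Γ Λ σ}
    (h : StateTransition.Reaches (TM2.step m) c c') (hc : c.l ∈ Finset.insertNone A) :
    ∃ τ, Trace (fun l : A => restrictStmt A d (m l)) (fun _ => false) k (restrictCfg A d c) τ
      (restrictCfg A d c') := by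
  induction h using Relation.ReflTransGen.head_induction_on with
  | refl => exact ⟨[], .nil _⟩
  | @head a b hab hbc ih =>
    obtain ⟨τ, hτ⟩ := ih (TM2.step_supports m hA hab hc)
    obtain ⟨l, v, S⟩ := a
    cases l with
    | none => cases hab
    | some l =>
      have hl : l ∈ A := Finset.some_mem_insertNone.1 hc
      simp only [TM2.step, Option.mem_def, Option.some.injEq] at hab
      refine ⟨none :: τ, ?_⟩
      have : restrictCfg A d (⟨some l, v, S⟩ : TM2.Cfg Γ Λ σ) = ⟨some ⟨l, hl⟩, v, S⟩ := by
        simp [restrictCfg, hl]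
      rw [this]
      refine .of_silent rfl ?_
      rwa [stepAux_restrictStmt, hab]

end Restrict

/-! #### Words as numbers

A word is written in binary with the unary code `1...10` of each symbol, so that the number can be
translated back symbol by symbol, and a leading digit `1`, so that no zeros get lost. -/

section Codes

open PartrecToTM2 (Γ' trNat trPosNum trNum)

/-- The positive number with the binary digits `l`, least significant first, and one further
leading digit. -/
def bitsNum : List Bool → PosNum
  | [] => .one
  | false :: l => .bit0 (bitsNum l)
  | true :: l => .bit1 (bitsNum l)

/-- A binary digit as a symbol of the machine for partial recursive functions. -/
def bitSymbol (b : Bool) : Γ' := if b then .bit1 else .bit0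

theorem trNat_bitsNum (l : List Bool) :
    trNat (bitsNum l : ℕ) = l.map bitSymbol ++ [Γ'.bit1] := by
  have h : ((bitsNum l : ℕ) : Num) = Num.pos (bitsNum l) := PosNum.of_to_nat _
  rw [trNat, h, trNum]
  induction l with
  | nil => rfl
  | cons b l ih => cases b <;> simp_all [bitsNum, trPosNum, bitSymbol]

variable {B : Type} (ι : B → ℕ)

/-- The unary code of a symbol with the number `i`. -/
def unaryBits (i : ℕ) : List Bool := List.replicate i true ++ [false]

/-- The number that represents a word. -/
def wordNum (w : List B) : ℕ := (bitsNum (w.flatMap fun b => unaryBits (ι b)) : ℕ)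

theorem bitsNum_pos (l : List Bool) : 0 < (bitsNum l : ℕ) := PosNum.cast_pos _

theorem wordNum_nil : wordNum ι [] = 1 := rfl

theorem bitsNum_unaryBits (i : ℕ) (l : List Bool) :
    (bitsNum (unaryBits i ++ l) : ℕ) + 1 = (2 * (bitsNum l : ℕ) + 1) * 2 ^ i := by
  induction i with
  | zero => simp [unaryBits, bitsNum, two_mul]
  | succ i ih =>
    have : unaryBits (i + 1) ++ l = true :: (unaryBits i ++ l) := by
      simp [unaryBits, List.replicate_succ]
    rw [this, bitsNum, PosNum.cast_bit1, pow_succ, ← mul_assoc, ← ih]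
    ring

theorem wordNum_cons (b : B) (w : List B) :
    wordNum ι (b :: w) = (2 * wordNum ι w + 1) * 2 ^ ι b - 1 := by
  have := bitsNum_unaryBits (ι b) (w.flatMap fun b => unaryBits (ι b))
  rw [wordNum, List.flatMap_cons]
  unfold wordNum
  omega

theorem primrec_wordNum [Primcodable B] [Finite B] : Primrec (wordNum ι) := by
  have h : Primrec fun w : List B =>
      w.foldr (fun b n => (2 * n + 1) * 2 ^ ι b - 1) 1 := by
    refine Primrec.list_foldr (h := fun _ p => (2 * p.2 + 1) * 2 ^ ι p.1 - 1) Primrec.id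
      (Primrec.const 1) (Primrec.comp₂ (f := fun p : B × ℕ => (2 * p.2 + 1) * 2 ^ ι p.1 - 1) ?_
        Primrec₂.right)
    have h1 : Primrec fun b : B => 2 ^ ι b := Primrec.dom_finite _
    exact Primrec.nat_sub.comp (Primrec.nat_mul.comp (Primrec.succ.comp
      (Primrec.nat_mul.comp (Primrec.const 2) Primrec.snd)) (h1.comp Primrec.fst))
      (Primrec.const 1)
  refine h.of_eq fun w => ?_
  induction w with
  | nil => rfl
  | cons b w ih => rw [List.foldr_cons, ih, wordNum_cons]

/-- One step in reading the unary codes off a binary number. -/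
def decodeStep (s : ℕ × ℕ × List ℕ) : ℕ × ℕ × List ℕ :=
  if s.1 ≤ 1 then s
  else if s.1 % 2 = 0 then (s.1 / 2, 0, s.2.1 :: s.2.2) else (s.1 / 2, s.2.1 + 1, s.2.2)

/-- The symbol numbers in the word represented by a number, last one first. -/
def decodeNum (n : ℕ) : List ℕ := (decodeStep^[n] (n, 0, [])).2.2

theorem primrec_decodeStep : Primrec decodeStep := by
  have h1 : Primrec fun s : ℕ × ℕ × List ℕ => s.2.1 := Primrec.fst.comp Primrec.snd
  have h2 : Primrec fun s : ℕ × ℕ × List ℕ => s.2.2 := Primrec.snd.comp Primrec.snd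
  have h3 : Primrec fun s : ℕ × ℕ × List ℕ => s.1 / 2 :=
    Primrec.nat_div.comp Primrec.fst (Primrec.const 2)
  refine Primrec.ite (Primrec.nat_le.comp Primrec.fst (Primrec.const 1)) Primrec.id ?_
  refine Primrec.ite (Primrec.eq.comp (Primrec.nat_mod.comp Primrec.fst (Primrec.const 2))
    (Primrec.const 0)) ?_ ?_
  · exact Primrec.pair h3 (Primrec.pair (Primrec.const 0) (Primrec.list_cons.comp h1 h2))
  · exact Primrec.pair h3 (Primrec.pair (Primrec.succ.comp h1) h2)

theorem primrec_decodeNum : Primrec decodeNum := by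
  refine (Primrec.snd.comp (Primrec.snd.comp (Primrec.nat_iterate Primrec.id
    (Primrec.pair Primrec.id (Primrec.const (0, ([] : List ℕ)))) ?_))).of_eq fun n => rfl
  exact primrec_decodeStep.comp Primrec.snd

theorem decodeStep_one (s : ℕ × List ℕ) : decodeStep (1, s) = (1, s) := rfl

theorem decodeStep_unaryBits (i c : ℕ) (l : List Bool) (acc : List ℕ) :
    decodeStep^[i + 1] ((bitsNum (unaryBits i ++ l) : ℕ), c, acc) =
      ((bitsNum l : ℕ), 0, (c + i) :: acc) := by
  induction i generalizing c with
  | zero =>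
    have := bitsNum_pos l
    rw [Nat.zero_add, Function.iterate_one]
    simp only [unaryBits, List.replicate_zero, List.nil_append, List.singleton_append, bitsNum,
      PosNum.cast_bit0, decodeStep]
    rw [if_neg (by omega), if_pos (by omega)]
    simp; omega
  | succ i ih =>
    have e : unaryBits (i + 1) ++ l = true :: (unaryBits i ++ l) := by
      simp [unaryBits, List.replicate_succ]
    have := bitsNum_pos (unaryBits i ++ l)
    rw [Function.iterate_succ_apply, e, bitsNum, PosNum.cast_bit1, decodeStep,
      if_neg (by simp only; omega), if_neg (by simp only; omega)]
    simp only
    rw [show ((bitsNum (unaryBits i ++ l) : ℕ) + (bitsNum (unaryBits i ++ l) : ℕ) + 1) / 2 =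
      (bitsNum (unaryBits i ++ l) : ℕ) by omega, ih]
    grind

/-- The decoding is finished after fewer than `wordNum ι w` steps. -/
theorem exists_decodeStep_wordNum (w : List B) (acc : List ℕ) :
    ∃ n < wordNum ι w, decodeStep^[n] (wordNum ι w, 0, acc) = (1, 0, (w.map ι).reverse ++ acc) := by
  induction w generalizing acc with
  | nil => exact ⟨0, by simp [wordNum_nil], rfl⟩
  | cons b w ih =>
    obtain ⟨n, h1, h2⟩ := ih (ι b :: acc)
    refine ⟨n + (ι b + 1), ?_, ?_⟩
    · rw [wordNum_cons]
      have h3 : ι b < 2 ^ ι b := Nat.lt_two_pow_self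
      have h4 : 1 ≤ 2 ^ ι b := Nat.one_le_two_pow
      have h5 : (2 * wordNum ι w + 1) * 1 + 2 ^ ι b ≤ (2 * wordNum ι w + 1) * 2 ^ ι b + 1 := by
        nlinarith
      omega
    · rw [Function.iterate_add_apply, wordNum, List.flatMap_cons, decodeStep_unaryBits,
        Nat.zero_add]
      have : (bitsNum (w.flatMap fun b => unaryBits (ι b)) : ℕ) = wordNum ι w := rfl
      rw [this, h2]
      simp

theorem decodeNum_wordNum (w : List B) : decodeNum (wordNum ι w) = (w.map ι).reverse := by
  obtain ⟨n, h1, h2⟩ := exists_decodeStep_wordNum ι w []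
  obtain ⟨k, hk⟩ := Nat.exists_eq_add_of_lt h1
  rw [decodeNum]
  have h3 : ∀ k, decodeStep^[k] (1, 0, (w.map ι).reverse ++ []) =
      (1, 0, (w.map ι).reverse ++ []) := fun k => Function.iterate_fixed (decodeStep_one _) k
  have h4 : decodeStep^[wordNum ι w] (wordNum ι w, 0, []) =
      decodeStep^[k + 1] (decodeStep^[n] (wordNum ι w, 0, [])) := by
    rw [← Function.iterate_add_apply]
    congr 2
    omega
  rw [h4, h2, h3]
  simp

end Codes

/-! #### Evaluation on words -/

section Computable

open PartrecToTM2 (Γ' K' trNat trList tr codeSupp trNormal)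

/-- All symbols, in a fixed order. -/
noncomputable def symbolList (B : Type) [Finite B] : List B :=
  letI := Fintype.ofFinite B
  Finset.univ.toList

/-- The number of a symbol: its position in `symbolList`. -/
noncomputable def symbolNum {B : Type} [Finite B] (b : B) : ℕ :=
  letI := Classical.decEq B
  (symbolList B).idxOf b

theorem mem_symbolList {B : Type} [Finite B] (b : B) : b ∈ symbolList B := by
  let _ := Fintype.ofFinite B
  simp [symbolList]

theorem getElem?_symbolNum {B : Type} [Finite B] (b : B) :
    (symbolList B)[symbolNum b]? = some b := by
  let _ := Classical.decEq B
  have h' := List.idxOf_lt_length_of_mem (mem_symbolList b)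
  rw [symbolNum, List.getElem?_eq_getElem h', List.getElem_idxOf h']

/-- The word represented by a number. -/
noncomputable def numWord (B : Type) [Finite B] (n : ℕ) : List B :=
  (decodeNum n).filterMap fun i => (symbolList B)[i]?

theorem numWord_wordNum {B : Type} [Finite B] (w : List B) :
    numWord B (wordNum symbolNum w.reverse) = w := by
  rw [numWord, decodeNum_wordNum, ← List.map_reverse, List.reverse_reverse, List.filterMap_map]
  simp [getElem?_symbolNum]

theorem primrec_numWord {B : Type} [Finite B] [Primcodable B] : Primrec (numWord B) :=
  Primrec.listFilterMap primrec_decodeNum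
    (Primrec.list_getElem?.comp₂ (Primrec₂.const _) Primrec₂.right)

instance : Finite K' :=
  Finite.of_injective (fun k : K' => match k with
    | .main => (0 : Fin 4) | .rev => 1 | .aux => 2 | .stack => 3)
    (by rintro (_ | _) (_ | _) h <;> first | rfl | cases h)

/-- The stacks of a machine that evaluates a partial recursive function on a word over `B`, with a
word over `C` as result: an input stack, an output stack and the stacks of the machine that works
on numbers. -/
abbrev CompStack : Type := Bool ⊕ K'

/-- The stack alphabets; `Sum.inl true` is the input stack. -/
abbrev CompAlphabet (B C : Type) : CompStack → Type
  | .inl true => B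
  | .inl false => C
  | .inr _ => Γ'

instance {B C : Type} [Finite B] [Finite C] : ∀ k, Finite (CompAlphabet B C k)
  | .inl true => ‹Finite B›
  | .inl false => ‹Finite C›
  | .inr _ => inferInstanceAs (Finite Γ')

variable {B C : Type} [Finite B] [Finite C] {Λ : Type}

/-- The number of possible values of the counter that is used to decode unary numbers. -/
noncomputable abbrev counterMax (C : Type) [Finite C] : ℕ := (symbolList C).length

/-- The state of the machine for numbers, and a counter. -/
abbrev CompState (C Λ : Type) [Finite C] : Type :=
  (Option Λ × Option Γ') × Fin (counterMax C + 1)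

/-- The machine for numbers works on its own stacks, with its symbols unchanged. -/
def compLayout : Layout (fun _ : K' => Γ') (CompAlphabet B C) Λ (Option Γ') (CompState C Λ) where
  emb := Sum.inr
  emb_injective := Sum.inr_injective
  wr _ := id
  rd _ := some
  get := fun s => s.1
  set := fun x s => (x, s.2)
  get_set _ _ := rfl

theorem readable_compLayout (q : TM2.Stmt (fun _ : K' => Γ') Λ (Option Γ')) :
    (compLayout (B := B) (C := C)).Readable q := by
  induction q with
  | push k f q ih => exact ⟨fun _ => rfl, ih⟩
  | peek k f q ih => exact ih
  | pop k f q ih => exact ih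
  | load f q ih => exact ih
  | branch f q₁ q₂ ih₁ ih₂ => exact ⟨ih₁, ih₂⟩
  | goto f => trivial
  | halt => trivial

/-- Process a digit: count the digits `1`, and at a digit `0` output the symbol with the number
counted. -/
noncomputable def digitStmt (v : Var (CompAlphabet B C) (CompState C Λ)) :
    TM2.Stmt (CompAlphabet B C) Unit (Var (CompAlphabet B C) (CompState C Λ)) :=
  match (v.1 (.inr .main) : Option Γ') with
  | some .bit1 => .load (fun v => (v.1, v.2.1, v.2.2 + 1)) .halt
  | some .bit0 =>
    match (symbolList C)[(v.2.2 : ℕ)]? with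
    | some c => .push (.inl false) (fun _ => c) (.load (fun v => (v.1, v.2.1, 0)) .halt)
    | none => .halt
  | _ => .halt

/-- Decode the number on the main stack to a word on the output stack. -/
noncomputable def decodeProg : Prog (CompAlphabet B C) (Var (CompAlphabet B C) (CompState C Λ)) :=
  .loop (popInto (.inr .main))
    (fun v => decide ((v.1 (.inr .main) : Option Γ') = some Γ'.bit1 ∨
      (v.1 (.inr .main) : Option Γ') = some Γ'.bit0))
    (.switch fun v => .block (digitStmt v))

/-- The main loop of `decodeProg` on a digit `1`. -/
theorem does_decodeProg_one {ko : CompStack} (l : List Γ')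
    (v : Var (CompAlphabet B C) (CompState C Λ)) (S : ∀ k, List (CompAlphabet B C k))
    (hS : S (.inr .main) = Γ'.bit1 :: l) {n s'}
    (h : Does ko decodeProg ((Function.update v.1 (.inr .main) (some Γ'.bit1), v.2.1, v.2.2 + 1),
      Function.update S (.inr .main) l) n s') : Does ko decodeProg (v, S) (n + 3) s' := by
  have e : exec (popInto (.inr .main)) (v, S) =
      ((Function.update v.1 (.inr .main) (some Γ'.bit1), v.2),
        Function.update S (.inr .main) l) := by
    rw [exec_popInto, hS]; rfl
  refine (Does.loop_step (n₁ := 2) (n₂ := n) (by rw [e]; simp) ?_ h).mono (by omega)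
  rw [e]
  refine Does.switch (n := 1) ?_
  have := does_block (ko := ko) (digitStmt (B := B) (C := C) (Λ := Λ)
    (Function.update v.1 (.inr .main) (some Γ'.bit1), v.2))
    ((Function.update v.1 (.inr .main) (some Γ'.bit1), v.2), Function.update S (.inr .main) l)
  have h2 : digitStmt (B := B) (C := C) (Λ := Λ)
      (Function.update v.1 (.inr .main) (some Γ'.bit1), v.2) =
      .load (fun v => (v.1, v.2.1, v.2.2 + 1)) .halt := by
    simp [digitStmt]
  rw [h2] at this ⊢
  exact this

/-- The main loop of `decodeProg` on a digit `0`, which ends the code of the symbol `c`. -/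
theorem does_decodeProg_zero {ko : CompStack} (l : List Γ') (c : C)
    (v : Var (CompAlphabet B C) (CompState C Λ)) (S : ∀ k, List (CompAlphabet B C k))
    (hS : S (.inr .main) = Γ'.bit0 :: l) (hc : (v.2.2 : ℕ) = symbolNum c) {n s'}
    (h : Does ko decodeProg ((Function.update v.1 (.inr .main) (some Γ'.bit0), v.2.1, 0),
      Function.update (Function.update S (.inr .main) l) (.inl false) (c :: S (.inl false))) n s') :
    Does ko decodeProg (v, S) (n + 3) s' := by
  have e : exec (popInto (.inr .main)) (v, S) =
      ((Function.update v.1 (.inr .main) (some Γ'.bit0), v.2),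
        Function.update S (.inr .main) l) := by
    rw [exec_popInto, hS]; rfl
  refine (Does.loop_step (n₁ := 2) (n₂ := n) (by rw [e]; simp) ?_ h).mono (by omega)
  rw [e]
  refine Does.switch (n := 1) ?_
  have := does_block (ko := ko) (digitStmt (B := B) (C := C) (Λ := Λ)
    (Function.update v.1 (.inr .main) (some Γ'.bit0), v.2))
    ((Function.update v.1 (.inr .main) (some Γ'.bit0), v.2), Function.update S (.inr .main) l)
  have h2 : digitStmt (B := B) (C := C) (Λ := Λ)
      (Function.update v.1 (.inr .main) (some Γ'.bit0), v.2) =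
      .push (.inl false) (fun _ => c) (.load (fun v => (v.1, v.2.1, 0)) .halt) := by
    simp [digitStmt, hc, getElem?_symbolNum]
  rw [h2] at this ⊢
  exact this

theorem does_decodeProg_ones {ko : CompStack} (i : ℕ) (l : List Γ')
    (v : Var (CompAlphabet B C) (CompState C Λ)) (S : ∀ k, List (CompAlphabet B C k))
    (hS : S (.inr .main) = List.replicate i Γ'.bit1 ++ l) (hi : (v.2.2 : ℕ) + i ≤ counterMax C) :
    ∃ v' : Var (CompAlphabet B C) (CompState C Λ), (v'.2.2 : ℕ) = v.2.2 + i ∧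
      ∀ s', (∃ n, Does ko decodeProg (v', Function.update S (.inr .main) l) n s') →
        ∃ n, Does ko decodeProg (v, S) n s' := by
  induction i generalizing v S with
  | zero =>
    rw [List.replicate_zero, List.nil_append] at hS
    refine ⟨v, rfl, fun s' h => ?_⟩
    rwa [← hS, Function.update_eq_self] at h
  | succ i ih =>
    have hv : ((v.2.2 + 1 : Fin (counterMax C + 1)) : ℕ) = v.2.2 + 1 :=
      Fin.val_add_one_of_lt (by rw [Fin.lt_def, Fin.val_last]; omega)
    obtain ⟨v', h1, h2⟩ := ih (Function.update v.1 (.inr .main) (some Γ'.bit1), v.2.1, v.2.2 + 1)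
      (Function.update S (.inr .main) (List.replicate i Γ'.bit1 ++ l))
      (Function.update_self _ _ _) (by simp only; omega)
    refine ⟨v', by simp only at h1; omega, fun s' h => ?_⟩
    rw [Function.update_idem] at h2
    obtain ⟨n, hn⟩ := h2 s' h
    exact ⟨_, does_decodeProg_one _ v S hS hn⟩

theorem symbolNum_lt (c : C) : symbolNum c < counterMax C :=
  (List.getElem?_eq_some_iff.1 (getElem?_symbolNum c)).1

theorem exists_does_decodeProg {ko : CompStack} (w : List C)
    (v : Var (CompAlphabet B C) (CompState C Λ)) (S : ∀ k, List (CompAlphabet B C k)) (o : List C)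
    (hS : S (.inr .main) = (w.flatMap fun b => unaryBits (symbolNum b)).map bitSymbol ++
      [Γ'.bit1, Γ'.cons]) (ho : S (.inl false) = o) (hv : v.2.2 = 0) :
    ∃ s', (∃ n, Does ko decodeProg (v, S) n s') ∧ s'.2 (.inl false) = w.reverse ++ o := by
  induction w generalizing v S o with
  | nil =>
    -- The leading digit `1` is counted without effect; the separator `cons` ends the loop.
    have h := does_loop_exit (ko := ko) (b := popInto (.inr .main))
      (c := fun v : Var (CompAlphabet B C) (CompState C Λ) =>
        decide ((v.1 (.inr .main) : Option Γ') = some Γ'.bit1 ∨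
          (v.1 (.inr .main) : Option Γ') = some Γ'.bit0))
      (p := .switch fun v => .block (digitStmt v))
      (s := ((Function.update v.1 (.inr .main) (some Γ'.bit1), v.2.1, v.2.2 + 1),
        Function.update S (.inr .main) [Γ'.cons])) (by rw [exec_popInto]; simp)
    exact ⟨_, ⟨_, does_decodeProg_one [Γ'.cons] v S hS h⟩, by simp [exec_popInto, ho]⟩
  | cons b w ih =>
    have e : S (.inr .main) = List.replicate (symbolNum b) Γ'.bit1 ++ (Γ'.bit0 ::
        ((w.flatMap fun b => unaryBits (symbolNum b)).map bitSymbol ++ [Γ'.bit1, Γ'.cons])) := by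
      rw [hS]; simp [unaryBits, bitSymbol]
    obtain ⟨v', h1, h2⟩ := does_decodeProg_ones (ko := ko) _ _ v S e (by
      have := symbolNum_lt b
      simp only [hv, Fin.val_zero]; omega)
    obtain ⟨s', ⟨n, hn⟩, h3⟩ := ih (Function.update v'.1 (.inr .main) (some Γ'.bit0), v'.2.1, 0)
      (Function.update (Function.update S (.inr .main)
        ((w.flatMap fun b => unaryBits (symbolNum b)).map bitSymbol ++ [Γ'.bit1, Γ'.cons]))
        (.inl false) (b :: o)) (b :: o) (by simp) (by simp) rfl
    refine ⟨s', h2 s' ⟨_, does_decodeProg_zero _ b v' _ (Function.update_self _ _ _) ?_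
      (n := n) ?_⟩, by simp [h3]⟩
    · rw [h1, hv]; simp
    · rw [Function.update_idem]
      simpa [ho] using hn

/-- Write the number that represents the reversed input word on the main stack. -/
noncomputable def encodeProg : Prog (CompAlphabet B C) (Var (CompAlphabet B C) (CompState C Λ)) :=
  .seq (.block (pushList [⟨.inr .main, Γ'.cons⟩, ⟨.inr .main, Γ'.bit1⟩]))
    (transfer (.inl true) fun b =>
      (unaryBits (symbolNum (B := B) b)).reverse.map fun d => ⟨.inr .main, bitSymbol d⟩)

theorem exists_does_encodeProg {ko : CompStack} (u : List B)
    (v : Var (CompAlphabet B C) (CompState C Λ)) :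
    ∃ v' S' n, Does ko (encodeProg (B := B) (C := C)) (v, inputStacks (.inl true) u) n (v', S') ∧
      v'.2 = v.2 ∧ S' (.inl false) = ([] : List C) ∧
      ∀ k, S' (.inr k) = K'.elim (trList [wordNum symbolNum u.reverse]) [] [] [] k := by
  obtain ⟨v', h1, h2⟩ := does_transfer (ko := ko) (k := Sum.inl true) (β := CompState C Λ)
    (Γ := CompAlphabet B C) (g := fun b =>
      (unaryBits (symbolNum (B := B) b)).reverse.map fun d => ⟨.inr .main, bitSymbol d⟩)
    (fun a p hp => by
      obtain ⟨d, -, rfl⟩ := List.mem_map.1 hp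
      simp) v (Function.update (inputStacks (.inl true) u) (.inr .main) [Γ'.bit1, Γ'.cons])
  refine ⟨v', _, _, Does.seq (n₁ := 1) ?_ h2, h1, ?_, ?_⟩
  · have := does_block (ko := ko) (pushList (Γ := CompAlphabet B C)
      [⟨.inr .main, Γ'.cons⟩, ⟨.inr .main, Γ'.bit1⟩])
      (v, inputStacks (.inl true) u)
    rw [exec_pushList] at this
    convert this using 2
    simp [pushed, inputStacks]
  · rw [Function.update_of_ne (by simp), pushed_apply_of_ne]
    · simp [inputStacks]
    · intro p hp
      obtain ⟨b, -, hb⟩ := List.mem_flatMap.1 hp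
      obtain ⟨d, -, rfl⟩ := List.mem_map.1 hb
      simp
  · intro k
    have e : (Function.update (inputStacks (Γ := CompAlphabet B C) (.inl true) u) (.inr .main)
        [Γ'.bit1, Γ'.cons]) (.inl true) = u := by
      rw [Function.update_of_ne (by simp)]; simp [inputStacks]
    rw [e, Function.update_of_ne (by simp), ← List.map_flatMap, pushed_map]
    have e2 : trList [wordNum symbolNum u.reverse] =
        ((u.reverse.flatMap fun b => unaryBits (symbolNum b)).map bitSymbol) ++
          [Γ'.bit1, Γ'.cons] := by
      simp [trList, wordNum, trNat_bitsNum]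
    rw [e2]
    have e3 : ((u.flatMap fun b => (unaryBits (symbolNum b)).reverse).map bitSymbol).reverse =
        (u.reverse.flatMap fun b => unaryBits (symbolNum b)).map bitSymbol := by
      rw [← List.map_reverse, List.reverse_flatMap]
      simp [Function.comp_def]
    cases k
    · rw [Function.update_self, Function.update_self, e3]
      rfl
    all_goals simp [inputStacks, K'.elim]

/-- Every computable function on words is computed by a stack machine. -/
theorem exists_machine_of_computable [Primcodable B] [Primcodable C] {F : List B → List C}
    (hF : Computable F) : ∃ N : EnumMachine B C, ∀ u, ∃ n c',
      N.RunsTo (N.start u) (List.replicate n none) c' ∧ c'.l = none ∧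
        (c'.stk N.tm.k₁).map N.outputAlphabet = F u := by
  -- the function on numbers that corresponds to `F`; words are reversed by being read from a stack
  let g : ℕ → ℕ := fun n => wordNum symbolNum (F (numWord B n)).reverse
  have hg : Computable g := (primrec_wordNum symbolNum).to_comp.comp
    (Primrec.list_reverse.to_comp.comp (hF.comp primrec_numWord.to_comp))
  obtain ⟨c, hc⟩ := ToPartrec.Code.exists_code (Nat.Partrec'.part_iff₁.2 (show Partrec ↑g from hg))
  have hc' : ∀ n, c.eval [n] = Part.some [g n] := fun n => by
    have := hc ⟨[n], rfl⟩
    simp only [PFun.coe_val, Part.map_eq_map, Part.map_some] at this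
    exact this
  let A := codeSupp c .halt
  have hA := PartrecToTM2.tr_supports c .halt
  let d : A := ⟨trNormal c .halt, hA.1⟩
  let m : A → TM2.Stmt (fun _ : K' => Γ') A (Option Γ') := fun l => restrictStmt A d (tr l)
  let L : Layout (fun _ : K' => Γ') (CompAlphabet B C) A (Option Γ') (CompState C A) := compLayout
  let p : Prog (CompAlphabet B C) (Var (CompAlphabet B C) (CompState C A)) :=
    .seq encodeProg (.seq (L.simulate m fun _ => false)
      (.seq (.block (.load (fun v => (v.1, v.2.1, 0)) .halt)) decodeProg))
  let v₀ : Var (CompAlphabet B C) (CompState C A) := (fun _ => none, (some d, none), 0)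
  refine ⟨p.machine (.inl true) (.inl false) v₀ (.refl _) (.refl _), fun u => ?_⟩
  obtain ⟨v₁, S₁, n₁, h1, h2, h3, h4⟩ := exists_does_encodeProg (ko := .inl false) (C := C) u v₀
  -- the run of the machine for numbers
  obtain ⟨τ, hτ⟩ : ∃ τ, Trace m (fun _ => false) K'.main
      ⟨some d, none, K'.elim (trList [wordNum symbolNum u.reverse]) [] [] []⟩ τ
      ⟨none, none, K'.elim (trList [g (wordNum symbolNum u.reverse)]) [] [] []⟩ := by
    have h := PartrecToTM2.tr_eval c [wordNum symbolNum u.reverse]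
    rw [hc'] at h
    have h' : PartrecToTM2.halt [g (wordNum symbolNum u.reverse)] ∈
        StateTransition.eval (TM2.step tr) (PartrecToTM2.init c [wordNum symbolNum u.reverse]) := by
      rw [h, Part.map_eq_map, Part.map_some]; exact Part.mem_some _
    let _ : Inhabited PartrecToTM2.Λ' := ⟨trNormal c .halt⟩
    have := (exists_trace_of_reaches (d := d) hA (k := K'.main)
      (StateTransition.mem_eval.1 h').1 (Finset.some_mem_insertNone.2 hA.1))
    have e : restrictCfg A d (PartrecToTM2.init c [wordNum symbolNum u.reverse]) =
        ⟨some d, none, K'.elim (trList [wordNum symbolNum u.reverse]) [] [] []⟩ := by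
      simp [restrictCfg, PartrecToTM2.init, d]
    rw [e] at this
    exact this
  obtain ⟨s₂, h5, h6, h7⟩ := Layout.does_simulate (L := L) (ko := Sum.inl false)
    (fun l => readable_compLayout _) hτ rfl (v₁, S₁) ⟨by
      change v₁.2.1 = _
      rw [h2], fun k => by
      change view some (S₁ (.inr k)) = _
      rw [h4, view_some]⟩
  have h8 : s₂.2 (.inl false) = [] := (h6 _ (by simp [L, compLayout])).trans h3
  have h9 : s₂.2 (.inr .main) = ((F u).reverse.flatMap fun b => unaryBits (symbolNum b)).map
      bitSymbol ++ [Γ'.bit1, Γ'.cons] := by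
    have := h5.2 .main
    change view some (s₂.2 (.inr .main)) = _ at this
    rw [view_some] at this
    rw [this]
    have hgu : g (wordNum symbolNum u.reverse) = wordNum symbolNum (F u).reverse := by
      simp only [g, numWord_wordNum]
    rw [hgu]
    simp [trList, wordNum, trNat_bitsNum]
  obtain ⟨s₃, ⟨n, h10⟩, h11⟩ := exists_does_decodeProg (ko := .inl false) (F u).reverse
    (s₂.1.1, s₂.1.2.1, 0) s₂.2 [] h9 h8 rfl
  obtain ⟨i, -, h12⟩ := h1.seq (h7.seq ((does_block (.load (fun v => (v.1, v.2.1, 0)) .halt)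
    s₂).seq h10))
  refine ⟨i, _, Prog.runsTo (v := v₀) (ei := .refl _) (eo := .refl _) (s' := s₃) ?_, rfl, ?_⟩
  · have : u.map (Equiv.refl (CompAlphabet B C (.inl true))).symm = u := List.map_id _
    rw [this]
    exact h12
  · have : s₃.2 (.inl false) = F u := by rw [h11]; simp
    exact (List.map_id _).trans this

end Computable

/-! ### Computability of the runs of a machine -/

section Primrec

/-- A finite type is primitively recursively coded by an enumeration. -/
@[reducible]
noncomputable def finitePrimcodable (α : Type) [Finite α] : Primcodable α :=
  Primcodable.ofEquiv (Fin (Nat.card α)) (Finite.equivFin α)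

/-- A family of lists with finite index type is coded as a vector of lists. -/
@[reducible]
noncomputable def stacksPrimcodable (K : Type) [Finite K] : Primcodable (K → List ℕ) :=
  Primcodable.ofEquiv (Fin (Nat.card K) → List ℕ)
    (Equiv.arrowCongr (Finite.equivFin K) (Equiv.refl (List ℕ)))

attribute [local instance] stacksPrimcodable

variable {K : Type} [DecidableEq K] [Finite K] {α β γ : Type} [Primcodable β] [Primcodable γ]

theorem primrec_apply_stack (k : K) : Primrec fun S : K → List ℕ => S k := by
  have h : Primrec (Equiv.arrowCongr (Finite.equivFin K) (Equiv.refl (List ℕ))) :=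
    Primrec.of_equiv
  refine (Primrec.fin_app.comp h (Primrec.const (Finite.equivFin K k))).of_eq fun S => ?_
  simp [Equiv.arrowCongr]

theorem primrec_update_stack (k : K) :
    Primrec₂ fun (S : K → List ℕ) (l : List ℕ) => Function.update S k l := by
  refine (Primrec.of_equiv_iff
    (Equiv.arrowCongr (Finite.equivFin K) (Equiv.refl (List ℕ)))).1 ?_
  refine Primrec.fin_curry.2 (Primrec₂.swap (Primrec.fin_curry₁.2 fun i => ?_))
  by_cases h : (Finite.equivFin K).symm i = k
  · exact Primrec.snd.of_eq fun p => by simp [Equiv.arrowCongr, h]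
  · exact ((primrec_apply_stack ((Finite.equivFin K).symm i)).comp Primrec.fst).of_eq fun p => by
      simp [Equiv.arrowCongr, h]

/-- Primitive recursion by cases on a finite argument. -/
theorem primrec₂_of_finite [Finite α] {f : α → β → γ} (hf : ∀ a, Primrec (f a)) :
    letI := finitePrimcodable α
    Primrec₂ f := by
  let _ := finitePrimcodable α
  have h : Primrec (Finite.equivFin α) := Primrec.of_equiv
  have h' : Primrec₂ fun (i : Fin (Nat.card α)) b => f ((Finite.equivFin α).symm i) b :=
    Primrec.fin_curry₁.2 fun i => hf _
  exact (h'.comp (h.comp Primrec.fst) Primrec.snd).of_eq fun p => by simp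

end Primrec

section Coded

attribute [local instance] stacksPrimcodable finitePrimcodable

variable {K : Type} [DecidableEq K] [Finite K] {Γ : K → Type} [∀ k, Finite (Γ k)]
  {Λ σ : Type} [Finite Λ] [Finite σ]

/-- Stacks with the symbols replaced by numbers. -/
noncomputable def codeStacks (S : ∀ k, List (Γ k)) : K → List ℕ := fun k => (S k).map symbolNum

theorem codeStacks_update (S : ∀ k, List (Γ k)) (k : K) (l : List (Γ k)) :
    codeStacks (Function.update S k l) = Function.update (codeStacks S) k (l.map symbolNum) := by
  funext j
  by_cases h : j = k
  · subst h; simp [codeStacks]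
  · simp [codeStacks, h]

/-- A configuration with the symbols replaced by numbers. -/
noncomputable def codeCfg (c : TM2.Cfg Γ Λ σ) : Option Λ × σ × (K → List ℕ) :=
  (c.l, c.var, codeStacks c.stk)

/-- The symbol with a given number. -/
noncomputable def symbolOf (B : Type) [Finite B] (i : Option ℕ) : Option B :=
  i.bind fun i => (symbolList B)[i]?

theorem symbolOf_map {B : Type} [Finite B] (b : Option B) : symbolOf B (b.map symbolNum) = b := by
  cases b <;> simp [symbolOf, getElem?_symbolNum]

theorem primrec_symbolOf (B : Type) [Finite B] [Primcodable B] : Primrec (symbolOf B) :=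
  Primrec.option_bind Primrec.id
    (Primrec.list_getElem?.comp₂ (Primrec₂.const _) Primrec₂.right)

/-- Execution of a statement on coded stacks. -/
noncomputable def codedStepAux :
    TM2.Stmt Γ Λ σ → σ × (K → List ℕ) → Option Λ × σ × (K → List ℕ)
  | .push k f q, p => codedStepAux q (p.1, Function.update p.2 k (symbolNum (f p.1) :: p.2 k))
  | .peek k f q, p => codedStepAux q (f p.1 (symbolOf (Γ k) (p.2 k).head?), p.2)
  | .pop k f q, p => codedStepAux q
      (f p.1 (symbolOf (Γ k) (p.2 k).head?), Function.update p.2 k (p.2 k).tail)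
  | .load f q, p => codedStepAux q (f p.1, p.2)
  | .branch f q₁ q₂, p => cond (f p.1) (codedStepAux q₁ p) (codedStepAux q₂ p)
  | .goto f, p => (some (f p.1), p)
  | .halt, p => (none, p)

theorem codedStepAux_eq (q : TM2.Stmt Γ Λ σ) (v : σ) (S : ∀ k, List (Γ k)) :
    codedStepAux q (v, codeStacks S) = codeCfg (TM2.stepAux q v S) := by
  induction q generalizing v S with
  | push k f q ih =>
    rw [codedStepAux, TM2.stepAux, ← ih, codeStacks_update]
    rfl
  | peek k f q ih =>
    rw [codedStepAux, TM2.stepAux, ← ih]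
    simp only [codeStacks]
    rw [List.head?_map, symbolOf_map]
  | pop k f q ih =>
    rw [codedStepAux, TM2.stepAux, ← ih, codeStacks_update]
    simp only [codeStacks]
    rw [List.head?_map, symbolOf_map, List.map_tail]
  | load f q ih => exact ih _ _
  | branch f q₁ q₂ ih₁ ih₂ =>
    rw [codedStepAux, TM2.stepAux, ih₁, ih₂]
    simp only
    cases f v <;> rfl
  | goto f => rfl
  | halt => rfl

theorem primrec_codedStepAux (q : TM2.Stmt Γ Λ σ) : Primrec (codedStepAux q) := by
  have top : ∀ k, Primrec fun p : σ × (K → List ℕ) => symbolOf (Γ k) (p.2 k).head? := fun k =>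
    (primrec_symbolOf (Γ k)).comp (Primrec.list_head?.comp
      ((primrec_apply_stack k).comp Primrec.snd))
  have app : ∀ k (f : σ → Option (Γ k) → σ),
      Primrec fun p : σ × (K → List ℕ) => f p.1 (symbolOf (Γ k) (p.2 k).head?) := fun k f =>
    (Primrec.dom_finite fun x : σ × Option (Γ k) => f x.1 x.2).comp
      (Primrec.pair Primrec.fst (top k))
  induction q with
  | push k f q ih =>
    exact ih.comp (Primrec.pair Primrec.fst ((primrec_update_stack k).comp Primrec.snd
      (Primrec.list_cons.comp ((Primrec.dom_finite fun v => symbolNum (f v)).comp Primrec.fst)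
        ((primrec_apply_stack k).comp Primrec.snd))))
  | peek k f q ih => exact ih.comp (Primrec.pair (app k f) Primrec.snd)
  | pop k f q ih =>
    exact ih.comp (Primrec.pair (app k f) ((primrec_update_stack k).comp Primrec.snd
      (Primrec.list_tail.comp ((primrec_apply_stack k).comp Primrec.snd))))
  | load f q ih =>
    exact ih.comp (Primrec.pair ((Primrec.dom_finite f).comp Primrec.fst) Primrec.snd)
  | branch f q₁ q₂ ih₁ ih₂ =>
    exact Primrec.cond ((Primrec.dom_finite f).comp Primrec.fst) ih₁ ih₂
  | goto f =>
    exact Primrec.pair (Primrec.option_some.comp ((Primrec.dom_finite f).comp Primrec.fst))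
      Primrec.id
  | halt => exact Primrec.pair (Primrec.const none) Primrec.id

/-- One step of a machine on coded configurations. -/
noncomputable def codedNext (m : Λ → TM2.Stmt Γ Λ σ) (o : Λ → Bool) (ko : K)
    (c : Option Λ × σ × (K → List ℕ)) : Option Λ × σ × (K → List ℕ) :=
  match c.1 with
  | none => c
  | some l => codedStepAux (m l) (c.2.1, if o l then Function.update c.2.2 ko [] else c.2.2)

theorem primrec_codedNext (m : Λ → TM2.Stmt Γ Λ σ) (o : Λ → Bool) (ko : K) :
    Primrec (codedNext m o ko) := by
  have h : Primrec₂ fun (l : Λ) (c : Option Λ × σ × (K → List ℕ)) =>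
      codedStepAux (m l) (c.2.1, if o l then Function.update c.2.2 ko [] else c.2.2) := by
    refine primrec₂_of_finite fun l => (primrec_codedStepAux (m l)).comp (Primrec.pair
      (Primrec.fst.comp Primrec.snd) ?_)
    cases o l
    · exact Primrec.snd.comp Primrec.snd
    · exact (primrec_update_stack ko).comp (Primrec.snd.comp Primrec.snd) (Primrec.const [])
  refine (Primrec.option_casesOn Primrec.fst Primrec.id
    (h.comp₂ Primrec₂.right Primrec₂.left)).of_eq fun c => ?_
  obtain ⟨_ | l, v, S⟩ := c <;> rfl

end Coded

/-- Unbounded search that always succeeds. -/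
theorem computable_find {α : Type} [Primcodable α] {p : α → ℕ → Bool} (hp : Computable₂ p)
    (h : ∀ a, ∃ n, p a n = true) : Computable fun a => Nat.find (h a) := by
  refine (Partrec.rfind hp.partrec₂).of_eq fun a => Part.eq_some_iff.2 (Nat.mem_rfind.2 ⟨?_, ?_⟩)
  · simpa using Nat.find_spec (h a)
  · intro n hn
    have := Nat.find_min (h a) hn
    simpa using this

end StackMachine

namespace EnumMachine

open StackMachine

attribute [local instance] stacksPrimcodable finitePrimcodable

variable {I O : Type} [Primcodable I] [Primcodable O] (M : EnumMachine I O)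

theorem finite_K : Finite M.tm.K := @Finite.of_fintype _ M.tm.kFin

theorem finite_Λ : Finite M.tm.Λ := @Finite.of_fintype _ M.tm.ΛFin

theorem finite_σ : Finite M.tm.σ := @Finite.of_fintype _ M.tm.σFin

attribute [local instance] EnumMachine.finite_alphabet finite_K finite_Λ finite_σ

/-- The code of the configuration after `n` steps. -/
noncomputable def codedConfig (u : List I) (n : ℕ) :
    Option M.tm.Λ × M.tm.σ × (M.tm.K → List ℕ) :=
  codeCfg (M.config u n)

theorem codeCfg_next (c : M.tm.Cfg) :
    codeCfg (M.next c) = codedNext M.tm.m M.isOutput M.tm.k₁ (codeCfg c) := by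
  obtain ⟨l, v, S⟩ := c
  cases l with
  | none => rfl
  | some l =>
    rw [M.next_mk]
    simp only [codedNext, codeCfg]
    cases M.isOutput l
    · exact (codedStepAux_eq _ _ _).symm
    · simp only [if_true]
      have := codeStacks_update S M.tm.k₁ []
      rw [List.map_nil] at this
      rw [← this]
      exact (codedStepAux_eq _ _ _).symm

theorem primrec_codedConfig : Primrec₂ M.codedConfig := by
  have hI : Finite I := Finite.of_equiv _ M.inputAlphabet
  have h0 : Primrec fun u : List I => codeCfg (M.config u 0) := by
    have h1 : Primrec fun u : List I => u.map fun a => symbolNum (M.inputAlphabet.symm a) :=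
      Primrec.list_map Primrec.id
        ((Primrec.dom_finite fun a => symbolNum (M.inputAlphabet.symm a)).comp₂ Primrec₂.right)
    refine (Primrec.pair (Primrec.const (some M.tm.main)) (Primrec.pair
      (Primrec.const M.tm.initialState) ((primrec_update_stack M.tm.k₀).comp
        (Primrec.const fun _ => []) h1))).of_eq fun u => ?_
    refine Prod.ext rfl (Prod.ext rfl ?_)
    funext k
    by_cases hk : k = M.tm.k₀
    · subst hk; simp [config, initList, codeCfg, codeStacks]
    · simp [config, initList, codeCfg, codeStacks, hk]
  have h2 := Primrec.nat_iterate (Primrec.snd (α := List I) (β := ℕ))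
    (h0.comp Primrec.fst)
    ((primrec_codedNext M.tm.m M.isOutput M.tm.k₁).comp₂ Primrec₂.right)
  refine h2.of_eq fun p => ?_
  obtain ⟨u, n⟩ := p
  simp only [codedConfig]
  induction n with
  | zero => rfl
  | succ n ih => rw [Function.iterate_succ_apply', ih, config, codeCfg_next]

/-- The word that a coded stack represents. -/
noncomputable def decodeOutput (l : List ℕ) : List O :=
  l.filterMap fun i => ((symbolList (M.tm.Γ M.tm.k₁)).map M.outputAlphabet)[i]?

theorem primrec_decodeOutput : Primrec M.decodeOutput :=
  Primrec.listFilterMap Primrec.id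
    (Primrec.list_getElem?.comp₂ (Primrec₂.const _) Primrec₂.right)

theorem decodeOutput_map (l : List (M.tm.Γ M.tm.k₁)) :
    M.decodeOutput (l.map symbolNum) = l.map M.outputAlphabet := by
  rw [decodeOutput, List.filterMap_map]
  simp [getElem?_symbolNum]

theorem primrec_result :
    Primrec₂ fun u n => ((M.config u n).stk M.tm.k₁).map M.outputAlphabet := by
  refine (M.primrec_decodeOutput.comp ((primrec_apply_stack M.tm.k₁).comp
    (Primrec.snd.comp (Primrec.snd.comp M.primrec_codedConfig)))).of_eq fun p => ?_
  exact M.decodeOutput_map _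

theorem primrec_emit : Primrec₂ fun u n => M.emit (M.config u n) := by
  have h1 : Primrec fun p : List I × ℕ => (M.codedConfig p.1 p.2).1.elim false M.isOutput :=
    (Primrec.dom_finite fun l : Option M.tm.Λ => l.elim false M.isOutput).comp
      (Primrec.fst.comp M.primrec_codedConfig)
  refine (Primrec.cond h1 (Primrec.option_some.comp M.primrec_result)
    (Primrec.const none)).of_eq fun p => ?_
  simp only [codedConfig]
  generalize M.config p.1 p.2 = c
  obtain ⟨_ | l, v, S⟩ := c
  · rfl
  · rw [M.emit_mk]
    cases h : M.isOutput l <;> simp [codeCfg, h]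

theorem primrec_outputs : Primrec₂ M.outputs :=
  Primrec.listFilterMap (Primrec.list_range.comp Primrec.snd)
    (M.primrec_emit.comp₂ (Primrec.fst.comp₂ Primrec₂.left) Primrec₂.right)

/-- The halting time of a machine that halts on every input is computable. -/
theorem exists_computable_haltsAt (h : ∀ u, ∃ T, M.HaltsAt u T) :
    ∃ T : List I → ℕ, Computable T ∧ ∀ u, M.HaltsAt u (T u) := by
  have h1 : Primrec₂ fun (u : List I) n => (M.config u n).l.isNone :=
    (Primrec.dom_finite fun l : Option M.tm.Λ => l.isNone).comp
      (Primrec.fst.comp M.primrec_codedConfig)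
  have h2 : ∀ u, ∃ n, (M.config u n).l.isNone = true := fun u => by
    obtain ⟨T, hT, -⟩ := h u
    exact ⟨T, by simp [hT]⟩
  refine ⟨fun u => Nat.find (h2 u), computable_find h1.to_comp h2, fun u => ⟨?_, fun i hi => ?_⟩⟩
  · simpa using Nat.find_spec (h2 u)
  · simpa using Nat.find_min (h2 u) hi

theorem HaltsAt.unique {I O : Type} {M : EnumMachine I O} {u : List I} {T T' : ℕ}
    (h : M.HaltsAt u T) (h' : M.HaltsAt u T') : T = T' := by
  rcases lt_trichotomy T T' with h1 | h1 | h1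
  · exact absurd h.1 (h'.2 T h1)
  · exact h1
  · exact absurd h'.1 (h.2 T' h1)

end EnumMachine

namespace StackMachine

/-! ### Growth of the stacks -/

section Growth

variable {K : Type} [DecidableEq K] {Γ : K → Type} {Λ σ : Type}

/-- An upper bound for the number of symbols that a statement pushes. -/
def pushCount : TM2.Stmt Γ Λ σ → ℕ
  | .push _ _ q => pushCount q + 1
  | .peek _ _ q => pushCount q
  | .pop _ _ q => pushCount q
  | .load _ q => pushCount q
  | .branch _ q₁ q₂ => pushCount q₁ + pushCount q₂
  | .goto _ => 0
  | .halt => 0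

theorem length_stepAux_le (q : TM2.Stmt Γ Λ σ) (v : σ) (S : ∀ k, List (Γ k)) (k : K) :
    ((TM2.stepAux q v S).stk k).length ≤ (S k).length + pushCount q := by
  induction q generalizing v S with
  | push j f q ih =>
    refine (ih _ _).trans ?_
    by_cases h : k = j
    · subst h; simp [pushCount]; omega
    · simp [h, pushCount]
  | peek j f q ih => exact ih _ _
  | pop j f q ih =>
    refine (ih _ _).trans ?_
    by_cases h : k = j
    · subst h; simp [pushCount]
    · simp [h, pushCount]
  | load f q ih => exact ih _ _
  | branch f q₁ q₂ ih₁ ih₂ =>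
    simp only [TM2.stepAux, pushCount]
    cases f v
    · exact (ih₂ _ _).trans (by omega)
    · exact (ih₁ _ _).trans (by omega)
  | goto f => simp [pushCount]
  | halt => simp [pushCount]

theorem exists_pushCount_le [Finite Λ] (m : Λ → TM2.Stmt Γ Λ σ) :
    ∃ b, ∀ l, pushCount (m l) ≤ b := by
  obtain ⟨b, hb⟩ := (Set.finite_range fun l => pushCount (m l)).bddAbove
  exact ⟨b, fun l => hb ⟨l, rfl⟩⟩

variable {m : Λ → TM2.Stmt Γ Λ σ} {o : Λ → Bool} {ko : K} {b : ℕ}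

/-- As every output empties the output stack, its height at the end is bounded by the delays. -/
theorem Trace.length_output_le (hb : ∀ l, pushCount (m l) ≤ b) {c c' : TM2.Cfg Γ Λ σ} {τ}
    (h : Trace m o ko c τ c') {d L : ℕ} : ∀ {g}, Paced d g τ → (c.stk ko).length ≤ L + b * g →
    (c'.stk ko).length ≤ L + b * d := by
  induction h with
  | nil c => exact fun hg hc => hc.trans (by gcongr; exact hg)
  | cons l v S τ c' h ih =>
    intro g hp hc
    cases hl : o l with
    | false =>
      simp only [hl, Bool.false_eq_true, if_false] at ih hp
      refine ih (g := g + 1) hp ((length_stepAux_le _ _ _ _).trans ?_)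
      have := hb l
      have : (S ko).length ≤ L + b * g := hc
      rw [mul_add]; omega
    | true =>
      simp only [hl, if_true] at ih hp
      refine ih (g := 1) hp.2 ((length_stepAux_le _ _ _ _).trans ?_)
      have := hb l
      simp; omega

theorem Trace.length_le (hb : ∀ l, pushCount (m l) ≤ b) {c c' : TM2.Cfg Γ Λ σ} {τ}
    (h : Trace m (fun _ => false) ko c τ c') (k : K) :
    (c'.stk k).length ≤ (c.stk k).length + b * τ.length := by
  induction h with
  | nil c => simp
  | cons l v S τ c' h ih =>
    refine ih.trans ((Nat.add_le_add_right (length_stepAux_le _ _ _ _) _).trans ?_)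
    have := hb l
    simp only [Bool.false_eq_true, if_false, List.length_cons, mul_add]
    omega

/-- A run without outputs does not depend on which labels are output instructions. -/
theorem Trace.silent {c c' : TM2.Cfg Γ Λ σ} {n : ℕ}
    (h : Trace m o ko c (List.replicate n none) c') :
    Trace m (fun _ => false) ko c (List.replicate n none) c' := by
  induction n generalizing c with
  | zero => cases h; exact .nil _
  | succ n ih =>
    rw [List.replicate_succ] at h ⊢
    generalize hτ : (none :: List.replicate n none : List (Option (List (Γ ko)))) = τ at h
    cases h with
    | nil => cases hτ
    | cons l v S τ c' h =>
      cases hl : o l with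
      | false =>
        simp only [hl, Bool.false_eq_true, if_false, List.cons.injEq, true_and] at hτ h ⊢
        subst hτ
        exact .of_silent rfl (ih h)
      | true => simp [hl] at hτ

/-- Iterations of the step function as traces; `iterate_of_trace` is the converse. -/
theorem exists_trace_of_iterate {c c' : TM2.Cfg Γ Λ σ} {n : ℕ}
    (h : (fun a : Option (TM2.Cfg Γ Λ σ) => a.bind (TM2.step m))^[n] (some c) = some c') :
    Trace m (fun _ => false) ko c (List.replicate n none) c' := by
  induction n generalizing c with
  | zero => cases h; exact .nil _
  | succ n ih =>
    rw [Function.iterate_succ_apply] at h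
    obtain ⟨_ | l, v, S⟩ := c
    · have : ∀ n, (fun a : Option (TM2.Cfg Γ Λ σ) => a.bind (TM2.step m))^[n] none = none :=
        fun n => Function.iterate_fixed rfl n
      simp [TM2.step, this] at h
    · rw [List.replicate_succ]
      exact .of_silent rfl (ih h)

theorem iterate_of_trace {c c' : TM2.Cfg Γ Λ σ} {n : ℕ}
    (h : Trace m (fun _ => false) ko c (List.replicate n none) c') :
    (fun a : Option (TM2.Cfg Γ Λ σ) => a.bind (TM2.step m))^[n] (some c) = some c' := by
  induction n generalizing c with
  | zero => cases h; rfl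
  | succ n ih =>
    rw [List.replicate_succ] at h
    generalize hτ : (none :: List.replicate n none : List (Option (List (Γ ko)))) = τ at h
    cases h with
    | nil => cases hτ
    | cons l v S τ c' h =>
      simp only [Bool.false_eq_true, if_false, List.cons.injEq, true_and] at hτ h
      subst hτ
      rw [Function.iterate_succ_apply]
      exact ih h

end Growth

/-! ### Codings of stack alphabets -/

/-- A coding of the symbols in `G` by a finite alphabet, which may have an additional symbol to
mark the bottom of a stack. -/
structure Coding (G : Type) where
  /-- the finite alphabet -/
  C : Type
  finite : Finite C
  /-- how symbols are coded -/
  wr : G → C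
  /-- how symbols are decoded -/
  rd : C → Option G
  rd_wr : ∀ a, rd (wr a) = some a
  /-- the bottom marker, if any -/
  mark : Option C
  rd_mark : ∀ c ∈ mark, rd c = none

/-- The coding of the symbols by themselves, without a marker. -/
def Coding.exact (G : Type) [h : Finite G] : Coding G :=
  ⟨G, h, id, some, fun _ => rfl, none, by simp⟩

/-- The coding with a marker `none`. -/
def Coding.marked (G : Type) [Finite G] : Coding G :=
  ⟨Option G, inferInstance, some, id, fun _ => rfl, some none, by simp⟩

section Symbols

variable {K : Type} {Γ : K → Type} {Λ σ : Type}

/-- The symbols pushed by a statement. -/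
def pushSymbols : TM2.Stmt Γ Λ σ → Set (Σ k, Γ k)
  | .push k f q => Set.range (fun v => ⟨k, f v⟩) ∪ pushSymbols q
  | .peek _ _ q => pushSymbols q
  | .pop _ _ q => pushSymbols q
  | .load _ q => pushSymbols q
  | .branch _ q₁ q₂ => pushSymbols q₁ ∪ pushSymbols q₂
  | .goto _ => ∅
  | .halt => ∅

theorem finite_pushSymbols [Finite σ] (q : TM2.Stmt Γ Λ σ) : (pushSymbols q).Finite := by
  induction q with
  | push k f q ih => exact (Set.finite_range _).union ih
  | peek k f q ih => exact ih
  | pop k f q ih => exact ih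
  | load f q ih => exact ih
  | branch f q₁ q₂ ih₁ ih₂ => exact ih₁.union ih₂
  | goto f => exact Set.finite_empty
  | halt => exact Set.finite_empty

/-- The alphabet of stack `k`, restricted to the symbols in `X`, together with a junk symbol. -/
abbrev RestrictedAlphabet (X : Set (Σ k, Γ k)) (k : K) : Type := Option {a : Γ k // ⟨k, a⟩ ∈ X}

open Classical in
/-- A symbol as a symbol of the restricted alphabet. -/
noncomputable def restrictSymbol (X : Set (Σ k, Γ k)) (k : K) (a : Γ k) : RestrictedAlphabet X k :=
  if h : ⟨k, a⟩ ∈ X then some ⟨a, h⟩ else none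

theorem map_restrictSymbol {X : Set (Σ k, Γ k)} {k : K} {a : Γ k} (h : ⟨k, a⟩ ∈ X) :
    (restrictSymbol X k a).map Subtype.val = some a := by
  simp [restrictSymbol, h]

theorem finite_restrictedAlphabet {X : Set (Σ k, Γ k)} (hX : X.Finite) (k : K) :
    Finite (RestrictedAlphabet X k) := by
  have : Finite {a : Γ k // ⟨k, a⟩ ∈ X} :=
    hX.preimage (f := Sigma.mk k) (sigma_mk_injective.injOn)
  infer_instance

/-- All symbols that can occur on the stacks of a machine: those in its input and those that it
pushes. -/
def machineSymbols (N : FinTM2) : Set (Σ k, N.Γ k) :=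
  Set.range (Sigma.mk N.k₀) ∪ ⋃ l, pushSymbols (N.m l)

theorem finite_machineSymbols (N : FinTM2) : (machineSymbols N).Finite := by
  have := @Finite.of_fintype _ N.Γk₀Fin
  have := @Finite.of_fintype _ N.ΛFin
  have := @Finite.of_fintype _ N.σFin
  exact (Set.finite_range _).union (Set.finite_iUnion fun l => finite_pushSymbols (N.m l))

theorem Layout.readable_of_forall {K₂ : Type} {Γ₂ : K₂ → Type} {β : Type}
    (L : Layout Γ Γ₂ Λ σ β) (q : TM2.Stmt Γ Λ σ)
    (h : ∀ p ∈ pushSymbols q, L.rd p.1 (L.wr p.1 p.2) = some p.2) : L.Readable q := by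
  induction q with
  | push k f q ih => exact ⟨fun v => h _ (.inl ⟨v, rfl⟩), ih fun p hp => h p (.inr hp)⟩
  | peek k f q ih => exact ih h
  | pop k f q ih => exact ih h
  | load f q ih => exact ih h
  | branch f q₁ q₂ ih₁ ih₂ =>
    exact ⟨ih₁ fun p hp => h p (.inl hp), ih₂ fun p hp => h p (.inr hp)⟩
  | goto f => trivial
  | halt => trivial

end Symbols

section Fragments

variable {K : Type} [DecidableEq K] {Γ : K → Type} {β : Type} {ko : K}

theorem isSome_of_map_eq {B C : Type} {r : C → Option B} {l : List C} {y : List B}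
    (h : l.map r = y.map some) : ∀ a ∈ l, (r a).isSome = true := fun a ha => by
  have : r a ∈ y.map some := h ▸ List.mem_map_of_mem ha
  obtain ⟨b, -, hb⟩ := List.mem_map.1 this
  rw [← hb]; rfl

/-- Move the symbols of stack `i` that `r` decodes, up to the first one without a meaning, to
stack `j`. -/
theorem does_transferWhile_decode {i j : K} (hij : i ≠ j) {B : Type} (r : Γ i → Option B)
    (f : B → Γ j) (y : List B) (l₁ l₂ : List (Γ i)) (h₁ : l₁.map r = y.map some)
    (h₂ : ∀ c ∈ l₂.head?, r c = none) (s : Var Γ β × ∀ k, List (Γ k)) (hS : s.2 i = l₁ ++ l₂) :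
    ∃ s' : Var Γ β × ∀ k, List (Γ k), s'.1.2 = s.1.2 ∧
      Does ko (transferWhile i (fun a => (r a).isSome) fun a => (r a).elim [] fun b => [⟨j, f b⟩])
        s (3 * y.length + 1) s' ∧ s'.2 i = l₂.tail ∧ s'.2 j = (y.map f).reverse ++ s.2 j ∧
      ∀ k, k ≠ i → k ≠ j → s'.2 k = s.2 k := by
  obtain ⟨v', h3, h4⟩ := does_transferWhile (ko := ko) (k := i) (P := fun a => (r a).isSome)
    (g := fun a => (r a).elim [] fun b => [⟨j, f b⟩]) (fun a p hp => by
      cases h : r a with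
      | none => simp [h] at hp
      | some b =>
        simp only [h, Option.elim_some, List.mem_singleton] at hp
        subst hp
        exact hij.symm)
    l₁ l₂ (isSome_of_map_eq h₁) (fun c hc => by rw [h₂ c hc]; rfl) s.1 s.2 hS
  have h5 : l₁.flatMap (fun a => (r a).elim [] fun b => [(⟨j, f b⟩ : Σ k, Γ k)]) =
      y.map fun b => ⟨j, f b⟩ := by
    have : l₁.flatMap (fun a => (r a).elim [] fun b => [(⟨j, f b⟩ : Σ k, Γ k)]) =
        (l₁.map r).flatMap fun o => o.elim [] fun b => [⟨j, f b⟩] := by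
      rw [List.flatMap_map]
    rw [this, h₁, List.flatMap_map, List.map_eq_flatMap]
    rfl
  have h6 : l₁.length = y.length := by simpa using congrArg List.length h₁
  rw [h5, pushed_map, h6] at h4
  exact ⟨_, h3, h4, by simp, by simp [hij.symm], fun k hi hj => by simp [hi, hj]⟩

/-- Remove the symbols of stack `i` that `r` decodes, and the first one without a meaning. -/
theorem does_dropWhile {i : K} {B : Type} (r : Γ i → Option B) (y : List B) (l₁ l₂ : List (Γ i))
    (h₁ : l₁.map r = y.map some) (h₂ : ∀ c ∈ l₂.head?, r c = none)
    (s : Var Γ β × ∀ k, List (Γ k)) (hS : s.2 i = l₁ ++ l₂) :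
    ∃ s' : Var Γ β × ∀ k, List (Γ k), s'.1.2 = s.1.2 ∧
      Does ko (transferWhile i (fun a => (r a).isSome) fun _ => []) s (3 * y.length + 1) s' ∧
      s'.2 i = l₂.tail ∧ ∀ k, k ≠ i → s'.2 k = s.2 k := by
  obtain ⟨v', h3, h4⟩ := does_transferWhile (ko := ko) (k := i) (P := fun a => (r a).isSome)
    (g := fun _ => []) (by simp) l₁ l₂ (isSome_of_map_eq h₁) (fun c hc => by rw [h₂ c hc]; rfl)
    s.1 s.2 hS
  have h6 : l₁.length = y.length := by simpa using congrArg List.length h₁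
  rw [show l₁.flatMap (fun _ : Γ i => ([] : List (Σ k, Γ k))) = [] by simp, h6] at h4
  exact ⟨_, h3, h4, by simp, fun k hi => by simp [hi, pushed]⟩

theorem does_push {j : K} (a : Γ j) (s : Var Γ β × ∀ k, List (Γ k)) :
    ∃ s' : Var Γ β × ∀ k, List (Γ k), s'.1.2 = s.1.2 ∧
      Does ko (.block (pushList [⟨j, a⟩])) s 1 s' ∧ s'.2 j = a :: s.2 j ∧
      ∀ k, k ≠ j → s'.2 k = s.2 k :=
  ⟨exec (pushList [⟨j, a⟩]) s, rfl, does_block _ s, by simp [exec, pushList],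
    fun k hk => by simp [exec, pushList, hk]⟩

theorem does_load (f : β → β) (s : Var Γ β × ∀ k, List (Γ k)) :
    Does ko (.block (.load (fun v => (v.1, f v.2)) .halt)) s 1 ((s.1.1, f s.1.2), s.2) :=
  does_block _ s

end Fragments

/-! ### Running an enumeration machine on a computed list of inputs -/

/-- The stacks of the driver: the input, auxiliary stacks, and those of three machines. -/
inductive DriverStack (KN KL KM : Type)
  /-- the input of the driver -/
  | inp
  /-- a buffer for reversed words -/
  | rev
  /-- a copy of `x` that is kept -/
  | word
  /-- the part of the input behind the separator -/
  | rest
  | n (k : KN)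
  | l (k : KL)
  | m (k : KM)
  deriving DecidableEq

instance {KN KL KM : Type} [Finite KN] [Finite KL] [Finite KM] :
    Finite (DriverStack KN KL KM) := by
  refine Finite.of_surjective (fun x : Fin 4 ⊕ KN ⊕ KL ⊕ KM => match x with
    | .inl 0 => DriverStack.inp
    | .inl 1 => .rev
    | .inl 2 => .word
    | .inl 3 => .rest
    | .inr (.inl k) => .n k
    | .inr (.inr (.inl k)) => .l k
    | .inr (.inr (.inr k)) => .m k) ?_
  rintro (_ | _ | _ | _ | k | k | k)
  exacts [⟨.inl 0, rfl⟩, ⟨.inl 1, rfl⟩, ⟨.inl 2, rfl⟩, ⟨.inl 3, rfl⟩, ⟨.inr (.inl k), rfl⟩,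
    ⟨.inr (.inr (.inl k)), rfl⟩, ⟨.inr (.inr (.inr k)), rfl⟩]

/-- The data of the driver.  An input `u` over `I` stands for a word `x` over `A`, possibly
followed by a separator and further symbols (via `ι`).  The machine `N` is applied to `x`, the
machine `L` to the result and the further symbols, and the machine `M` is applied successively to
`x` and each of the words over `A` in the list that `L` produces (or to `x` alone each time, if
`jv` is `none`). -/
structure Driver (A I J : Type) where
  /-- the machine that is applied to `x` -/
  N : FinTM2
  inN : N.Γ N.k₀ ≃ A
  outN : N.Γ N.k₁ ≃ A
  /-- the machine that computes a list of words, in the form `encodeItems` -/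
  L : EnumMachine (Option A) (Option A)
  /-- the enumeration machine -/
  M : EnumMachine J A
  /-- what the input symbols stand for; `none` is the separator -/
  ι : I → Option A
  /-- the symbols of `x` as input symbols of `M` -/
  jx : A → J
  /-- the symbols of a separator and a word of the list as input symbols of `M`, if `M` gets them -/
  jv : Option (Option A → J)

namespace Driver

variable {A I J : Type} [Finite A] [Finite I] (D : Driver A I J)

instance : Finite D.N.K := @Finite.of_fintype _ D.N.kFin
instance : Finite D.N.Λ := @Finite.of_fintype _ D.N.ΛFin
instance : Finite D.N.σ := @Finite.of_fintype _ D.N.σFin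
instance : Finite D.L.tm.K := @Finite.of_fintype _ D.L.tm.kFin
instance : Finite D.L.tm.Λ := @Finite.of_fintype _ D.L.tm.ΛFin
instance : Finite D.L.tm.σ := @Finite.of_fintype _ D.L.tm.σFin
instance : Finite D.M.tm.K := @Finite.of_fintype _ D.M.tm.kFin
instance : Finite D.M.tm.Λ := @Finite.of_fintype _ D.M.tm.ΛFin
instance : Finite D.M.tm.σ := @Finite.of_fintype _ D.M.tm.σFin

/-- The stacks of `M` get bottom markers, except for the output stack. -/
noncomputable def coding (k : D.M.tm.K) : Coding (D.M.tm.Γ k) :=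
  have := D.M.finite_alphabet k
  if k = D.M.tm.k₁ then .exact _ else .marked _

theorem coding_output : D.coding D.M.tm.k₁ =
    @Coding.exact _ (D.M.finite_alphabet D.M.tm.k₁) := by
  simp [coding]

theorem mark_coding {k : D.M.tm.K} (h : k ≠ D.M.tm.k₁) : (D.coding k).mark ≠ none := by
  rw [coding, if_neg h]
  exact Option.some_ne_none _

theorem map_wr_coding_output (c : (D.coding D.M.tm.k₁).C) :
    ((D.coding D.M.tm.k₁).rd c).map (D.coding D.M.tm.k₁).wr = some c := by
  have : ∀ X : Coding (D.M.tm.Γ D.M.tm.k₁),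
      X = @Coding.exact _ (D.M.finite_alphabet D.M.tm.k₁) →
      ∀ c, (X.rd c).map X.wr = some c := by
    rintro _ rfl c; rfl
  exact this _ D.coding_output c

theorem bijective_wr_coding_output : Function.Bijective (D.coding D.M.tm.k₁).wr := by
  rw [coding_output]; exact Function.bijective_id

/-- The alphabets of the stacks of the driver. -/
abbrev Alphabet : DriverStack D.N.K D.L.tm.K D.M.tm.K → Type
  | .inp => I
  | .rev => A
  | .word => A
  | .rest => Option A
  | .n k => RestrictedAlphabet (machineSymbols D.N) k
  | .l k => D.L.tm.Γ k
  | .m k => (D.coding k).C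

instance : ∀ k, Finite (D.Alphabet k)
  | .inp => ‹Finite I›
  | .rev => ‹Finite A›
  | .word => ‹Finite A›
  | .rest => inferInstanceAs (Finite (Option A))
  | .n k => finite_restrictedAlphabet (finite_machineSymbols D.N) k
  | .l k => D.L.finite_alphabet k
  | .m k => (D.coding k).finite

/-- The labels and variables of the three machines. -/
abbrev State : Type :=
  (Option D.N.Λ × D.N.σ) × (Option D.L.tm.Λ × D.L.tm.σ) × (Option D.M.tm.Λ × D.M.tm.σ)

/-- The representation of the machine `N` in the driver. -/
noncomputable def layoutN : Layout D.N.Γ D.Alphabet D.N.Λ D.N.σ D.State where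
  emb := .n
  emb_injective _ _ h := by cases h; rfl
  wr k := restrictSymbol (machineSymbols D.N) k
  rd _ := Option.map Subtype.val
  get s := s.1
  set x s := (x, s.2)
  get_set _ _ := rfl

/-- The representation of the machine `L` in the driver. -/
def layoutL : Layout D.L.tm.Γ D.Alphabet D.L.tm.Λ D.L.tm.σ D.State where
  emb := .l
  emb_injective _ _ h := by cases h; rfl
  wr _ := id
  rd _ := some
  get s := s.2.1
  set x s := (s.1, x, s.2.2)
  get_set _ _ := rfl

/-- The representation of the machine `M` in the driver. -/
noncomputable def layoutM : Layout D.M.tm.Γ D.Alphabet D.M.tm.Λ D.M.tm.σ D.State where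
  emb := .m
  emb_injective _ _ h := by cases h; rfl
  wr k := (D.coding k).wr
  rd k := (D.coding k).rd
  get s := s.2.2
  set x s := (s.1, s.2.1, x)
  get_set _ _ := rfl

theorem readable_layoutN (l : D.N.Λ) : D.layoutN.Readable (D.N.m l) :=
  Layout.readable_of_forall _ _ fun p hp =>
    map_restrictSymbol (X := machineSymbols D.N) (k := p.1) (.inr (Set.mem_iUnion.2 ⟨l, hp⟩))

theorem readable_layoutL (l : D.L.tm.Λ) : D.layoutL.Readable (D.L.tm.m l) :=
  Layout.readable_of_forall _ _ fun _ _ => rfl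

theorem readable_layoutM (l : D.M.tm.Λ) : D.layoutM.Readable (D.M.tm.m l) :=
  Layout.readable_of_forall _ _ fun p _ => (D.coding p.1).rd_wr p.2

/-- The programs of the driver. -/
abbrev DProg : Type := Prog D.Alphabet (Var D.Alphabet D.State)

/-- The output stack. -/
abbrev out : DriverStack D.N.K D.L.tm.K D.M.tm.K := .m D.M.tm.k₁

/-- The configurations of stacks. -/
abbrev Stk : Type := ∀ k, List (D.Alphabet k)

/-- Split the input. -/
noncomputable def parseProg : D.DProg :=
  .seq (transferWhile .inp (fun a => (D.ι a).isSome)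
    fun a => (D.ι a).elim [] fun b => [⟨.rev, b⟩])
    (transfer .inp fun a => [⟨.rest, D.ι a⟩])

/-- A symbol on the input stack of `N`. -/
noncomputable def symN (b : A) : D.Alphabet (.n D.N.k₀) :=
  restrictSymbol (machineSymbols D.N) D.N.k₀ (D.inN.symm b)

/-- Read a symbol on the output stack of `N`. -/
noncomputable def readN (c : D.Alphabet (.n D.N.k₁)) : Option A :=
  (Option.map Subtype.val c).map D.outN

/-- A symbol on the input stack of `L`. -/
def symL (b : Option A) : D.Alphabet (.l D.L.tm.k₀) := D.L.inputAlphabet.symm b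

/-- A symbol on the input stack of `M`. -/
noncomputable def symM (b : J) : D.Alphabet (.m D.M.tm.k₀) :=
  (D.coding D.M.tm.k₀).wr (D.M.inputAlphabet.symm b)

/-- Distribute the word to be kept and the input of `N`. -/
noncomputable def loadN : D.DProg :=
  transfer .rev fun b => [⟨.word, b⟩, ⟨.n D.N.k₀, D.symN b⟩]

/-- Write the input of `L`. -/
noncomputable def loadL : D.DProg :=
  .seq (transfer .rest fun b => [⟨.l D.L.tm.k₀, D.symL b⟩])
    (.seq (.block (pushList [⟨.l D.L.tm.k₀, D.symL none⟩]))
      (.seq (transferWhile (.n D.N.k₁) (fun c => (D.readN c).isSome)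
        fun c => (D.readN c).elim [] fun b => [⟨.l D.L.tm.k₀, D.symL (some b)⟩])
        (.block (.load (fun v => (v.1, v.2.1, (some D.L.tm.main, D.L.tm.initialState), v.2.2.2))
          .halt))))

/-- A state of the driver. -/
abbrev Full : Type := Var D.Alphabet D.State × D.Stk

/-- Split the input `x` or `x#...` at the separator; both parts are left reversed. -/
theorem does_parseProg {u : List I} {x : List A} {t : List (Option A)}
    (hu : u.map D.ι = x.map some ++ t) (ht : ∀ b ∈ t.head?, b = none) (s : D.Full)
    (hs : s.2 = inputStacks .inp u) :
    ∃ s' : D.Full, s'.1.2 = s.1.2 ∧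
      Does D.out D.parseProg s (3 * x.length + 3 * t.length + 2) s' ∧
      s'.2 .rev = x.reverse ∧ s'.2 .rest = t.tail.reverse ∧
      ∀ k, k ≠ .rev → k ≠ .rest → s'.2 k = [] := by
  obtain ⟨u₁, u₂, rfl, h1, h2⟩ := List.map_eq_append_iff.1 hu
  have h0 : ∀ k, k ≠ .inp → s.2 k = [] := fun k hk => by simp [hs, inputStacks, hk]
  obtain ⟨s₁, e1, h3, a1, a2, a3⟩ := does_transferWhile_decode (ko := D.out) (i := .inp)
    (j := .rev) (by simp) D.ι (fun b => b) x u₁ u₂ h1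
    (fun c hc => ht _ (by rw [← h2, List.head?_map, hc]; rfl)) s (by simp [hs, inputStacks])
  obtain ⟨s₂, e2, h4, b1, b2, b3⟩ := does_transfer_single (ko := D.out) (i := .inp) (j := .rest)
    (by simp) D.ι s₁
  have hl : u₂.length = t.length := by simpa using congrArg List.length h2
  refine ⟨s₂, e2.trans e1, (h3.seq h4).mono (by rw [a1]; simp; omega), ?_, ?_, ?_⟩
  · rw [b3 _ (by simp) (by simp), a2, h0 _ (by simp)]; simp
  · rw [b2, a1, a3 _ (by simp) (by simp), h0 _ (by simp), ← h2]; simp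
  · intro k h5 h6
    by_cases h7 : k = .inp
    · rw [h7, b1]
    · rw [b3 k h7 h6, a3 k h7 h5, h0 k h7]

theorem does_loadN {x : List A} {s : D.Full} (hr : s.2 .rev = x.reverse) (hw : s.2 .word = [])
    (hn : ∀ k, s.2 (.n k) = []) :
    ∃ s' : D.Full, s'.1.2 = s.1.2 ∧
      Does D.out D.loadN s (3 * x.length + 1) s' ∧ s'.2 .rev = [] ∧ s'.2 .word = x ∧
      D.layoutN.Stacks s'.2 (inputStacks D.N.k₀ (x.map D.inN.symm)) ∧ s'.2 .rest = s.2 .rest ∧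
      (∀ k, s'.2 (.l k) = s.2 (.l k)) ∧ ∀ k, s'.2 (.m k) = s.2 (.m k) := by
  obtain ⟨s', e, h, a1, a2, a3, a4⟩ := does_transfer_pair (ko := D.out) (i := .rev) (j := .word)
    (k := .n D.N.k₀) (by simp) (by simp) (by simp) (fun b => b) D.symN s
  rw [hr, List.length_reverse] at h
  refine ⟨s', e, h, a1, by simp [a2, hw, hr], fun k => ?_, a4 _ (by simp) (by simp) (by simp),
    fun k => a4 _ (by simp) (by simp) (by simp), fun k => a4 _ (by simp) (by simp) (by simp)⟩
  by_cases hk : k = D.N.k₀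
  · subst hk
    have h1 := view_map_append (r := Option.map Subtype.val)
      (w := restrictSymbol (machineSymbols D.N) D.N.k₀) (x.map D.inN.symm)
      (fun a _ => map_restrictSymbol (.inl ⟨a, rfl⟩)) []
    simp only [List.map_map, List.append_nil, view] at h1
    rw [inputStacks, Function.update_self, ← h1]
    change view (Option.map Subtype.val) (s'.2 (.n D.N.k₀)) = _
    rw [a3, hr, hn, List.map_reverse, List.reverse_reverse, List.append_nil]
    rfl
  · rw [inputStacks, Function.update_of_ne hk]
    change view (Option.map Subtype.val) (s'.2 (.n k)) = _
    rw [a4 _ (by simp) (by simp) (by simpa using hk), hn]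
    rfl

theorem stacks_layoutL (S : D.Stk) (T : ∀ k, List (D.L.tm.Γ k)) :
    D.layoutL.Stacks S T ↔ ∀ k, S (.l k) = T k := by
  refine forall_congr' fun k => ?_
  change view some (S (.l k)) = _ ↔ _
  rw [view_some]

/-- The input of `L` is the reversed result `y` of `N`, a separator, and the rest `r` of the input
of the driver. -/
theorem does_loadL {y : List A} {r : List (Option A)} {s : D.Full} (hr : s.2 .rest = r.reverse)
    (hn : view (Option.map Subtype.val) (s.2 (.n D.N.k₁)) = y.map D.outN.symm)
    (hl : ∀ k, s.2 (.l k) = []) :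
    ∃ s' : D.Full, Does D.out D.loadL s (3 * r.length + 3 * y.length + 4) s' ∧
      s'.1.2.2.1 = (some D.L.tm.main, D.L.tm.initialState) ∧
      D.layoutL.Stacks s'.2 (inputStacks D.L.tm.k₀
        ((y.reverse.map some ++ none :: r).map D.L.inputAlphabet.symm)) ∧
      s'.2 .word = s.2 .word ∧ s'.2 .rev = s.2 .rev ∧ ∀ k, s'.2 (.m k) = s.2 (.m k) := by
  obtain ⟨s₁, -, h1, a1, a2, a3⟩ := does_transfer_single (ko := D.out) (i := .rest)
    (j := .l D.L.tm.k₀) (by simp) D.symL s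
  obtain ⟨s₂, -, h2, b1, b2⟩ := does_push (ko := D.out) (j := .l D.L.tm.k₀) (D.symL none) s₁
  obtain ⟨l₁, l₂, h3, h4, h5⟩ := eq_append_of_view (r := Option.map Subtype.val) (s.2 (.n D.N.k₁))
  obtain ⟨s₃, -, h6, c1, c2, c3⟩ := does_transferWhile_decode (ko := D.out) (i := .n D.N.k₁)
    (j := .l D.L.tm.k₀) (by simp) D.readN (fun b => D.symL (some b)) y l₁ l₂ (by
      have : l₁.map D.readN = (l₁.map (Option.map Subtype.val)).map (Option.map D.outN) := by
        rw [List.map_map]; rfl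
      rw [this, h4, hn]
      simp [Function.comp_def]) (fun c hc => by
      have := h5 c hc
      simp only [readN, this, Option.map_none]) s₂
    (by rw [b2 _ (by simp), a3 _ (by simp) (by simp), h3])
  have h7 := does_load (ko := D.out) (fun v : D.State =>
    (v.1, (some D.L.tm.main, D.L.tm.initialState), v.2.2)) s₃
  refine ⟨_, (h1.seq (h2.seq (h6.seq h7))).mono ?_, rfl, ?_, ?_, ?_, ?_⟩
  · rw [hr, List.length_reverse]; omega
  · rw [stacks_layoutL]
    intro k
    by_cases hk : k = D.L.tm.k₀
    · subst hk
      rw [inputStacks, Function.update_self]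
      change s₃.2 (.l D.L.tm.k₀) = _
      rw [c2, b1, a2, hl, hr]
      simp [symL, Function.comp_def]
    · rw [inputStacks, Function.update_of_ne hk]
      change s₃.2 (.l k) = _
      rw [c3 _ (by simp) (by simpa using hk), b2 _ (by simpa using hk),
        a3 _ (by simp) (by simpa using hk), hl]
  · change s₃.2 _ = _
    rw [c3 _ (by simp) (by simp), b2 _ (by simp), a3 _ (by simp) (by simp)]
  · change s₃.2 _ = _
    rw [c3 _ (by simp) (by simp), b2 _ (by simp), a3 _ (by simp) (by simp)]
  · intro k
    change s₃.2 _ = _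
    rw [c3 _ (by simp) (by simp), b2 _ (by simp), a3 _ (by simp) (by simp)]

/-! #### The main loop -/

/-- The bottom markers of the stacks of `M`. -/
noncomputable def markersOf (ks : List D.M.tm.K) : List (Σ k, D.Alphabet k) :=
  ks.flatMap fun k => (D.coding k).mark.elim [] fun c => [⟨.m k, c⟩]

/-- A stack looks empty to the simulated machine if it did so before, or if a marker is pushed. -/
theorem view_pushed_markersOf (k : D.M.tm.K) (ks : List D.M.tm.K) (S : D.Stk)
    (h : view (D.coding k).rd (S (.m k)) = [] ∨ (k ∈ ks ∧ (D.coding k).mark ≠ none)) :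
    view (D.coding k).rd (pushed (D.markersOf ks) S (.m k)) = [] := by
  induction ks generalizing S with
  | nil =>
    rcases h with h | h
    · exact h
    · simp at h
  | cons j ks ih =>
    rw [markersOf, List.flatMap_cons, pushed_append]
    refine ih _ ?_
    by_cases hj : j = k
    · subst hj
      cases hm : (D.coding j).mark with
      | none =>
        rcases h with h | h
        · exact .inl h
        · exact absurd hm h.2
      | some c =>
        refine .inl ?_
        simp [pushed, view, (D.coding j).rd_mark c hm]
    · have h1 : pushed ((D.coding j).mark.elim [] fun c => [⟨.m j, c⟩]) S (.m k) = S (.m k) := by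
        refine pushed_apply_of_ne _ (fun p hp => ?_) _
        cases hm : (D.coding j).mark with
        | none => simp [hm] at hp
        | some c =>
          simp only [hm, Option.elim_some, List.mem_singleton] at hp
          subst hp
          simpa using hj
      rw [h1]
      exact h.imp_right fun h => ⟨by simpa [Ne.symm hj] using h.1, h.2⟩

theorem pushed_markersOf_of_ne (ks : List D.M.tm.K) (S : D.Stk) {k}
    (h : ∀ j, (D.coding j).mark ≠ none → k ≠ .m j) : pushed (D.markersOf ks) S k = S k := by
  refine pushed_apply_of_ne _ (fun p hp => ?_) _
  obtain ⟨j, -, hj⟩ := List.mem_flatMap.1 hp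
  cases hm : (D.coding j).mark with
  | none => simp [hm] at hj
  | some c =>
    simp only [hm, Option.elim_some, List.mem_singleton] at hj
    subst hj
    exact (h j (by simp [hm])).symm

/-- Put `M` into its initial state, with empty stacks. -/
noncomputable def resetM : D.DProg :=
  .seq (transfer D.out fun _ => [])
    (.seq (.block (pushList (D.markersOf (symbolList D.M.tm.K))))
      (.block (.load (fun v => (v.1, v.2.1, v.2.2.1, (some D.M.tm.main, D.M.tm.initialState)))
        .halt)))

/-- The time depends on the height of the output stack only: the other stacks are covered by
markers, not emptied. -/
theorem does_resetM (s : D.Full) :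
    ∃ s' : D.Full, Does D.out D.resetM s (3 * (s.2 D.out).length + 3) s' ∧
      s'.1.2.2.2 = (some D.M.tm.main, D.M.tm.initialState) ∧
      (∀ k, view (D.coding k).rd (s'.2 (.m k)) = []) ∧
      ∀ k, (∀ j, k ≠ .m j) → s'.2 k = s.2 k := by
  obtain ⟨s₁, -, h1, a1, a2⟩ := does_drain (ko := D.out) D.out s
  have h2 := does_block (ko := D.out)
    (pushList (D.markersOf (symbolList D.M.tm.K))) s₁
  rw [show s₁ = (s₁.1, s₁.2) from rfl, exec_pushList] at h2
  have h3 := does_load (ko := D.out) (fun v : D.State =>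
    (v.1, v.2.1, (some D.M.tm.main, D.M.tm.initialState)))
    (s₁.1, pushed (D.markersOf (symbolList D.M.tm.K)) s₁.2)
  refine ⟨_, (h1.seq (h2.seq h3)).mono (by omega), rfl, fun k => ?_, fun k hk => ?_⟩
  · refine D.view_pushed_markersOf k _ _ ?_
    by_cases h : k = D.M.tm.k₁
    · subst h; exact .inl (by rw [a1]; rfl)
    · exact .inr ⟨mem_symbolList k, D.mark_coding h⟩
  · exact (D.pushed_markersOf_of_ne _ _ fun j _ => hk j).trans (a2 k (hk _))

/-- Read a symbol on the output stack of `L`. -/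
def readL (c : D.Alphabet (.l D.L.tm.k₁)) : Option A := D.L.outputAlphabet c

/-- Write the second part of the input of `M`. -/
noncomputable def loadItem : D.DProg :=
  match D.jv with
  | none => transferWhile (.l D.L.tm.k₁) (fun c => (D.readL c).isSome) fun _ => []
  | some j =>
    .seq (transferWhile (.l D.L.tm.k₁) (fun c => (D.readL c).isSome)
        fun c => (D.readL c).elim [] fun b => [⟨.m D.M.tm.k₀, D.symM (j (some b))⟩])
      (.block (pushList [⟨.m D.M.tm.k₀, D.symM (j none)⟩]))

/-- Write the word that is kept in front of the input of `M`. -/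
noncomputable def loadWord : D.DProg :=
  .seq (transfer .word fun b => [⟨.rev, b⟩])
    (transfer .rev fun b => [⟨.word, b⟩, ⟨.m D.M.tm.k₀, D.symM (D.jx b)⟩])

/-- The second part of the input of `M`. -/
def itemInput (v : List A) : List J := D.jv.elim [] fun j => (none :: v.map some).map j

theorem does_loadItem {v : List A} {r : List (Option A)} (s : D.Full)
    (hs : (s.2 (.l D.L.tm.k₁)).map D.L.outputAlphabet = v.reverse.map some ++ none :: r) :
    ∃ s' : D.Full, s'.1.2 = s.1.2 ∧ Does D.out D.loadItem s (3 * v.length + 2) s' ∧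
      (s'.2 (.l D.L.tm.k₁)).map D.L.outputAlphabet = r ∧
      s'.2 (.m D.M.tm.k₀) = (D.itemInput v).map D.symM ++ s.2 (.m D.M.tm.k₀) ∧
      ∀ k, k ≠ .l D.L.tm.k₁ → k ≠ .m D.M.tm.k₀ → s'.2 k = s.2 k := by
  obtain ⟨l₁, l₂, h1, h2, h3⟩ := List.map_eq_append_iff.1 hs
  have h4 : ∀ c ∈ l₂.head?, D.L.outputAlphabet c = none := by
    intro c hc
    have := congrArg List.head? h3
    rw [List.head?_map, hc] at this
    simpa using this
  have h5 : l₂.tail.map D.L.outputAlphabet = r := by rw [List.map_tail, h3]; rfl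
  unfold loadItem itemInput
  cases D.jv with
  | none =>
    obtain ⟨s', e, a1, a2, a3⟩ := does_dropWhile (ko := D.out) (i := .l D.L.tm.k₁)
      D.readL v.reverse l₁ l₂ h2 h4 s h1
    exact ⟨s', e, a1.mono (by simp), by rw [a2]; exact h5, by simp [a3],
      fun k hk _ => a3 k hk⟩
  | some j =>
    obtain ⟨s₁, e, a1, a2, a3, a4⟩ := does_transferWhile_decode (ko := D.out)
      (i := .l D.L.tm.k₁) (j := .m D.M.tm.k₀) (by simp) D.readL
      (fun b => D.symM (j (some b))) v.reverse l₁ l₂ h2 h4 s h1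
    obtain ⟨s₂, e', b1, b2, b3⟩ := does_push (ko := D.out) (j := .m D.M.tm.k₀) (D.symM (j none)) s₁
    refine ⟨s₂, e'.trans e, (a1.seq b1).mono (by simp), ?_, ?_, ?_⟩
    · rw [b3 _ (by simp), a2, h5]
    · rw [b2, a3]; simp [Function.comp_def]
    · intro k hk hk'
      rw [b3 k hk', a4 k hk hk']

theorem does_loadWord {x : List A} (s : D.Full) (hw : s.2 .word = x) (hr : s.2 .rev = []) :
    ∃ s' : D.Full, s'.1.2 = s.1.2 ∧ Does D.out D.loadWord s (6 * x.length + 2) s' ∧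
      s'.2 (.m D.M.tm.k₀) = (x.map D.jx).map D.symM ++ s.2 (.m D.M.tm.k₀) ∧
      ∀ k, k ≠ .m D.M.tm.k₀ → s'.2 k = s.2 k := by
  obtain ⟨s₁, e, h1, a1, a2, a3⟩ := does_transfer_single (ko := D.out) (i := .word) (j := .rev)
    (by simp) (fun b => b) s
  obtain ⟨s₂, e', h2, b1, b2, b3, b4⟩ := does_transfer_pair (ko := D.out) (i := .rev) (j := .word)
    (k := .m D.M.tm.k₀) (by simp) (by simp) (by simp) (fun b => b) (fun b => D.symM (D.jx b)) s₁
  rw [hr, hw] at a2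
  rw [hw] at h1
  rw [a2] at h2 b2 b3
  refine ⟨s₂, e'.trans e, (h1.seq h2).mono (by simp; omega), ?_, fun k hk => ?_⟩
  · rw [b3, a3 _ (by simp) (by simp)]; simp
  · by_cases h : k = .word
    · subst h; rw [b2, a1, hw]; simp
    by_cases h' : k = .rev
    · subst h'; rw [b1, hr]
    rw [b4 k h' h hk, a3 k h h']

/-- Prepare a computation of `M`. -/
noncomputable def prepareM : D.DProg := .seq D.resetM (.seq D.loadItem D.loadWord)

theorem does_prepareM {x v : List A} {r : List (Option A)} (s : D.Full) (hw : s.2 .word = x)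
    (hr : s.2 .rev = [])
    (hs : (s.2 (.l D.L.tm.k₁)).map D.L.outputAlphabet = v.reverse.map some ++ none :: r) :
    ∃ s' : D.Full,
      Does D.out D.prepareM s (3 * (s.2 D.out).length + 3 * v.length + 6 * x.length + 7) s' ∧
      D.layoutM.Rel s' (D.M.start (x.map D.jx ++ D.itemInput v)) ∧
      s'.2 .word = x ∧ s'.2 .rev = [] ∧ (s'.2 (.l D.L.tm.k₁)).map D.L.outputAlphabet = r := by
  obtain ⟨s₁, h1, a1, a2, a3⟩ := D.does_resetM s
  obtain ⟨s₂, e2, h2, b1, b2, b3⟩ := D.does_loadItem (v := v) (r := r) s₁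
    (by rw [a3 _ (by simp), hs])
  obtain ⟨s₃, e3, h3, c1, c2⟩ := D.does_loadWord (x := x) s₂
    (by rw [b3 _ (by simp) (by simp), a3 _ (by simp), hw])
    (by rw [b3 _ (by simp) (by simp), a3 _ (by simp), hr])
  refine ⟨s₃, (h1.seq (h2.seq h3)).mono (by omega), ⟨?_, ?_⟩, ?_, ?_, ?_⟩
  · change s₃.1.2.2.2 = _
    rw [e3, e2, a1]
    rfl
  · rw [EnumMachine.start, stk_initList]
    intro k
    change view (D.coding k).rd (s₃.2 (.m k)) = _
    by_cases hk : k = D.M.tm.k₀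
    · subst hk
      rw [inputStacks, Function.update_self, c1, b2, ← List.append_assoc, ← List.map_append]
      have : ∀ l : List J, l.map D.symM =
          (l.map D.M.inputAlphabet.symm).map (D.coding D.M.tm.k₀).wr := fun l => by
        rw [List.map_map]; rfl
      rw [this, view_map_append _ (fun a _ => (D.coding D.M.tm.k₀).rd_wr a), a2, List.append_nil]
    · rw [inputStacks, Function.update_of_ne hk, c2 _ (by simpa using hk),
        b3 _ (by simp) (by simpa using hk), a2]
  · rw [c2 _ (by simp), b3 _ (by simp) (by simp), a3 _ (by simp), hw]
  · rw [c2 _ (by simp), b3 _ (by simp) (by simp), a3 _ (by simp), hr]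
  · rw [c2 _ (by simp), b1]

/-- Apply `M` successively. -/
noncomputable def mainLoop : D.DProg :=
  .loop (peekInto (.l D.L.tm.k₁)) (fun v => (v.1 (.l D.L.tm.k₁)).isSome)
    (.seq D.prepareM (D.layoutM.simulate D.M.tm.m D.M.isOutput))

/-- The output alphabet of the driver. -/
noncomputable def outEquiv : D.Alphabet D.out ≃ A :=
  (Equiv.ofBijective _ D.bijective_wr_coding_output).symm.trans D.M.outputAlphabet

theorem map_outEquiv_wr (l : List (D.M.tm.Γ D.M.tm.k₁)) :
    (l.map (D.coding D.M.tm.k₁).wr).map D.outEquiv = l.map D.M.outputAlphabet := by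
  rw [List.map_map]
  refine List.map_congr_left fun a _ => ?_
  have : (Equiv.ofBijective _ D.bijective_wr_coding_output).symm ((D.coding D.M.tm.k₁).wr a) = a :=
    (Equiv.ofBijective _ D.bijective_wr_coding_output).symm_apply_apply a
  exact congrArg D.M.outputAlphabet this

/-- The run of `M` inside the driver: the same outputs, with a delay that is larger by a constant
factor. -/
theorem exists_run_simulateM {d : ℕ} {c c' : D.M.tm.Cfg} {τ} (h : D.M.RunsTo c τ c')
    (hc : c'.l = none) (hp : Paced d 0 τ) (s : D.Full) (hs : D.layoutM.Rel s c) :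
    ∃ (ρ : List (Option (List (D.Alphabet D.out)))) (s' : D.Full), D.layoutM.Rel s' c' ∧
      (∀ j, (∀ k, j ≠ .m k) → s'.2 j = s.2 j) ∧
      Run D.out (D.layoutM.simulate D.M.tm.m D.M.isOutput) s ρ s' ∧
      ρ.reduceOption.map (List.map D.outEquiv) =
        τ.reduceOption.map (List.map D.M.outputAlphabet) ∧ Paced (4 * d + 5) 0 ρ := by
  obtain ⟨s', h1, h2, h3⟩ := Layout.run_simulate (L := D.layoutM) (o := D.M.isOutput)
    D.readable_layoutM D.map_wr_coding_output h hc s hs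
  refine ⟨_, s', h1, fun j hj => h2 j fun k => (hj k).symm, h3, ?_, hp.simulation _⟩
  refine (congrArg _ (reduceOption_simulation (List.map (D.coding D.M.tm.k₁).wr) τ)).trans ?_
  rw [List.map_map]
  exact List.map_congr_left fun l _ => D.map_outEquiv_wr l

/-- A list of words as a word: every word is reversed and followed by a separator. -/
def encodeItems (vs : List (List A)) : List (Option A) :=
  vs.flatMap fun v => v.reverse.map some ++ [none]

/-- If `M` outputs `W v` with delay at most `d` for every item `v`, then the main loop outputs all
of the `W v`, one after the other.  The delay is multiplied by the number of items at most, as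
some of the `W v` may be empty. -/
theorem exists_run_mainLoop {b d V : ℕ} (hb : ∀ l, pushCount (D.M.tm.m l) ≤ b) {x : List A}
    (W : List A → List (List A)) (hV : ∀ v, (D.itemInput v).length ≤ v.length + 1)
    (vs : List (List A)) (hvs : ∀ v ∈ vs, v.length ≤ V ∧ ∃ τ c',
      D.M.RunsTo (D.M.start (x.map D.jx ++ D.itemInput v)) τ c' ∧ c'.l = none ∧
      τ.reduceOption.map (List.map D.M.outputAlphabet) = W v ∧ Paced d 0 τ) :
    ∀ s : D.Full, s.2 .word = x → s.2 .rev = [] →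
      (s.2 (.l D.L.tm.k₁)).map D.L.outputAlphabet = encodeItems vs →
      (s.2 D.out).length ≤ x.length + V + 1 + b * d →
    ∃ τ s', Run D.out D.mainLoop s τ s' ∧
      τ.reduceOption.map (List.map D.outEquiv) = vs.flatMap W ∧
      Paced (vs.length * (3 * b * d + 4 * d + 9 * x.length + 6 * V + 20) + 1) 0 τ := by
  induction vs with
  | nil =>
    intro s h1 h2 h3 h4
    have h3' : s.2 (.l D.L.tm.k₁) = [] := by simpa [encodeItems] using h3
    refine ⟨[none], _, .loop_exit ?_, rfl, by simp [Paced]⟩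
    change (Function.update s.1.1 (.l D.L.tm.k₁) (s.2 (.l D.L.tm.k₁)).head?
      (.l D.L.tm.k₁)).isSome = false
    rw [Function.update_self, h3']; rfl
  | cons v vs ih =>
    intro s h1 h2 h3 h4
    obtain ⟨hv, τ, c', hr, hc, hW, hp⟩ := hvs v (by simp)
    rw [encodeItems, List.flatMap_cons, List.append_assoc, List.singleton_append] at h3
    obtain ⟨s₁, ⟨i, hi, p1⟩, p2, p3, p4, p5⟩ := D.does_prepareM (exec (peekInto (.l D.L.tm.k₁)) s)
      (v := v) (r := encodeItems vs) h1 h2 h3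
    obtain ⟨ρ, s₂, q1, q2, q3, q5, q6⟩ := D.exists_run_simulateM hr hc hp s₁ p2
    have q4 : (s₂.2 D.out).length ≤ x.length + V + 1 + b * d := by
      have h5 : (s₂.2 D.out).length = (c'.stk D.M.tm.k₁).length := by
        have := congrArg List.length (map_view D.map_wr_coding_output (s₂.2 D.out))
        rw [List.length_map] at this
        rw [← q1.2 D.M.tm.k₁]
        exact this.symm
      rw [h5]
      refine Trace.length_output_le hb hr hp ?_
      rw [EnumMachine.start, stk_initList]
      have := hV v
      by_cases hk : D.M.tm.k₁ = D.M.tm.k₀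
      · rw [hk]; simp [inputStacks]; omega
      · simp [inputStacks, hk]
    obtain ⟨τ', s', r1, r2, r3⟩ := ih (fun w hw => hvs w (by simp [hw])) s₂
      ((q2 _ (by simp)).trans p3) ((q2 _ (by simp)).trans p4)
      (by rw [q2 _ (by simp), p5]) q4
    have hne : (Function.update s.1.1 (.l D.L.tm.k₁) (s.2 (.l D.L.tm.k₁)).head?
        (.l D.L.tm.k₁)).isSome = true := by
      rw [Function.update_self]
      cases h : s.2 (.l D.L.tm.k₁) with
      | nil => rw [h] at h3; cases v.reverse <;> simp at h3
      | cons c l => rfl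
    have hstep := Run.loop_step (ko := D.out) (b := peekInto (.l D.L.tm.k₁)) (s := s)
      (c := fun v : Var D.Alphabet D.State => (v.1 (.l D.L.tm.k₁)).isSome) hne (p1.seq q3) r1
    refine ⟨_, s', hstep, ?_, ?_⟩
    · rw [List.reduceOption_cons_of_none, List.reduceOption_append, List.reduceOption_append,
        reduceOption_replicate_none, List.nil_append, List.map_append, r2, q5, hW,
        List.flatMap_cons]
    · have e2 : none :: (List.replicate i none ++ ρ ++ τ') =
          List.replicate (i + 1) none ++ (ρ ++ τ') := by
        rw [List.replicate_succ, List.append_assoc]; rfl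
      rw [e2, List.length_cons]
      have h6 : Paced (i + 1) 0
          (List.replicate (i + 1) (none : Option (List (D.Alphabet D.out)))) :=
        paced_replicate_none le_rfl
      refine (Paced.append (Paced.append r3 q6) h6).mono le_rfl ?_
      have h9 : (s.2 D.out).length = ((exec (peekInto (.l D.L.tm.k₁)) s).2 D.out).length := rfl
      rw [← h9] at hi
      have h10 : 3 * (b * d) = 3 * b * d := by ring
      have : i + 1 + (4 * d + 5) ≤ 3 * b * d + 4 * d + 9 * x.length + 6 * V + 20 := by omega
      rw [add_mul]
      omega

/-! #### The driver as an enumeration machine -/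

/-- The program of the driver. -/
noncomputable def prog : D.DProg :=
  .seq D.parseProg (.seq D.loadN (.seq (D.layoutN.simulate D.N.m fun _ => false)
    (.seq D.loadL (.seq (D.layoutL.simulate D.L.tm.m fun _ => false) D.mainLoop))))

/-- The initial value of the variable of the driver. -/
def init : Var D.Alphabet D.State :=
  (fun _ => none, (some D.N.main, D.N.initialState), (none, D.L.tm.initialState),
    (none, D.M.tm.initialState))

/-- The machine that executes the program of the driver. -/
noncomputable def machine : EnumMachine I A :=
  D.prog.machine .inp D.out D.init (Equiv.refl I) D.outEquiv

/-- All steps before the main loop, without outputs. -/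
theorem does_prelude {u : List I} {x y : List A} {t : List (Option A)} {nL : ℕ}
    {items : List (Option A)}
    (hu : u.map D.ι = x.map some ++ t) (ht : ∀ b ∈ t.head?, b = none) {τN cN}
    (hN : Trace D.N.m (fun _ => false) D.N.k₁ (initList D.N (x.map D.inN.symm)) τN cN)
    (hN' : cN.l = none) (hy : cN.stk D.N.k₁ = y.map D.outN.symm) {cL}
    (hL : D.L.RunsTo (D.L.start (y.reverse.map some ++ none :: t.tail))
      (List.replicate nL none) cL) (hL' : cL.l = none)
    (hi : (cL.stk D.L.tm.k₁).map D.L.outputAlphabet = items) (s : D.Full)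
    (hs : s = (D.init, inputStacks .inp u)) :
    ∃ (i : ℕ) (s' : D.Full),
      i ≤ 6 * x.length + 6 * t.length + 3 * τN.length + 3 * y.length + 3 * nL + 9 ∧
      (∀ τ s'', Run D.out D.mainLoop s' τ s'' →
        Run D.out D.prog s (List.replicate i none ++ τ) s'') ∧
      s'.2 .word = x ∧ s'.2 .rev = [] ∧
      (s'.2 (.l D.L.tm.k₁)).map D.L.outputAlphabet = items ∧ s'.2 D.out = [] := by
  obtain ⟨s₁, e1, ⟨i₁, hi₁, h1⟩, a1, a2, a3⟩ := D.does_parseProg hu ht s (by rw [hs])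
  obtain ⟨s₂, e2, ⟨i₂, hi₂, h2⟩, b1, b2, b3, b4, b5, b6⟩ := D.does_loadN a1
    (a3 _ (by simp) (by simp)) fun k => a3 _ (by simp) (by simp)
  obtain ⟨s₃, c1, c2, ⟨i₃, hi₃, h3⟩⟩ := Layout.does_simulate (L := D.layoutN) (ko := D.out)
    D.readable_layoutN hN hN' s₂ ⟨by
      change s₂.1.2.1 = _
      rw [e2, e1, hs]; rfl, by rw [stk_initList]; exact b3⟩
  obtain ⟨s₄, ⟨i₄, hi₄, h4⟩, e4, d1, d2, d3, d4⟩ := D.does_loadL (y := y) (r := t.tail) (s := s₃)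
    (by rw [c2 _ (by simp [layoutN]), b4, a2])
    (by
      have := c1.2 D.N.k₁
      rw [hy] at this
      exact this)
    fun k => by rw [c2 _ (by simp [layoutN]), b5, a3 _ (by simp) (by simp)]
  obtain ⟨s₅, f1, f2, ⟨i₅, hi₅, h5⟩⟩ := Layout.does_simulate (L := D.layoutL) (ko := D.out)
    D.readable_layoutL (Trace.silent hL) hL' s₄ ⟨e4, by
      rw [EnumMachine.start, stk_initList]; exact d1⟩
  refine ⟨i₁ + (i₂ + (i₃ + (i₄ + i₅))), s₅, ?_, fun τ s'' h => ?_, ?_, ?_, ?_, ?_⟩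
  · have : t.tail.length ≤ t.length := by simp
    rw [List.length_replicate] at hi₅
    omega
  · have := h1.seq (h2.seq (h3.seq (h4.seq (h5.seq h))))
    simpa only [prog, List.replicate_add, List.append_assoc] using this
  · rw [f2 _ (by simp [layoutL]), d2, c2 _ (by simp [layoutN]), b2]
  · rw [f2 _ (by simp [layoutL]), d3, c2 _ (by simp [layoutN]), b1]
  · rw [← hi, ← (D.stacks_layoutL _ _).1 f1.2]
  · rw [f2 _ (by simp [layoutL]), d4, c2 _ (by simp [layoutN]), b6, a3 _ (by simp) (by simp)]

theorem length_le_encodeItems (vs : List (List A)) : vs.length ≤ (encodeItems vs).length := by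
  induction vs with
  | nil => simp
  | cons v vs ih =>
    have : encodeItems (v :: vs) = v.reverse.map some ++ [none] ++ encodeItems vs := rfl
    rw [this]
    simp
    omega

theorem length_le_encodeItems_of_mem {vs : List (List A)} {v : List A} (h : v ∈ vs) :
    v.length ≤ (encodeItems vs).length := by
  induction vs with
  | nil => simp at h
  | cons w vs ih =>
    have e : encodeItems (w :: vs) = w.reverse.map some ++ [none] ++ encodeItems vs := rfl
    rw [e]
    rcases List.mem_cons.1 h with rfl | h
    · simp
    · have := ih h
      simp; omega

theorem length_itemInput_le (v : List A) : (D.itemInput v).length ≤ v.length + 1 := by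
  unfold itemInput
  cases D.jv <;> simp

/-- The time before the first output and the pace of the main loop fit into the product of a
polynomial in `n` and a function of `H` and `t`, where `n` is the length of the input, `q` and `p`
are values of polynomials, and `H` and `t` depend on the parameter. -/
theorem delay_bound_le {b d n q p t H i k V : ℕ} (hi : i ≤ 6 * n + 3 * q + 12 * H + 9)
    (hd : d ≤ p * t) (hk : k ≤ H) (hV : V ≤ H) :
    k * (3 * b * d + 4 * d + 9 * n + 6 * V + 20) + 1 + i ≤
      (32 + 15 * n + 3 * q + (3 * b + 4) * p) * ((H + 1) ^ 2 * (t + 1)) := by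
  set W := (H + 1) ^ 2 * (t + 1) with hW
  have h0 : (H + 1) ^ 2 ≤ W := Nat.le_mul_of_pos_right _ (by omega)
  have h1 : 10 + 32 * H + 6 * (H * H) ≤ 32 * W := by nlinarith
  have hH : H + 1 ≤ W := le_trans (by nlinarith) h0
  have h2 : (6 + 9 * H) * n ≤ 15 * W * n := Nat.mul_le_mul_right _ (by omega)
  have h3 : q * 1 ≤ q * W := Nat.mul_le_mul_left _ (by omega)
  have h4 : H * t ≤ W := by
    have : (H + 1) * (t + 1) ≤ W := Nat.mul_le_mul_right _ (by nlinarith)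
    nlinarith
  have h5 : (3 * b + 4) * p * (H * t) ≤ (3 * b + 4) * p * W := Nat.mul_le_mul_left _ h4
  have h6 : k * (3 * b * d + 4 * d + 9 * n + 6 * V + 20) ≤
      H * (3 * b * (p * t) + 4 * (p * t) + 9 * n + 6 * H + 20) := by gcongr
  nlinarith

/-- The delay of the driver.  The input stands for `x`, possibly followed by a separator and the
word `t.tail`; `τN` is the run of `N` from `x` to `y`, and `nL` is the running time of `L`, whose
result is the list `vs` of items.  If `M` enumerates the disjoint sets `Sol v` for the items `v`,
then the driver enumerates their union. -/
theorem exists_enumeratesWithDelay : ∃ b, ∀ {u : List I} {x y : List A} {t : List (Option A)}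
    {nL : ℕ} {vs : List (List A)} {τN cN cL} {q p r d H : ℕ} {Sol : List A → Set (List A)}
    {S : Set (List A)},
    u.map D.ι = x.map some ++ t → (∀ b ∈ t.head?, b = none) →
    Trace D.N.m (fun _ => false) D.N.k₁ (initList D.N (x.map D.inN.symm)) τN cN →
    cN.l = none → cN.stk D.N.k₁ = y.map D.outN.symm →
    D.L.RunsTo (D.L.start (y.reverse.map some ++ none :: t.tail)) (List.replicate nL none) cL →
    cL.l = none → (cL.stk D.L.tm.k₁).map D.L.outputAlphabet = encodeItems vs →
    (∀ v ∈ vs, D.M.EnumeratesWithDelay (x.map D.jx ++ D.itemInput v) (Sol v) d) →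
    vs.Nodup → (∀ v ∈ vs, ∀ w ∈ vs, v ≠ w → Disjoint (Sol v) (Sol w)) →
    (∀ w, w ∈ S ↔ ∃ v ∈ vs, w ∈ Sol v) →
    τN.length ≤ q → d ≤ p * r → nL + y.length + 2 * t.length + (encodeItems vs).length ≤ H →
    D.machine.EnumeratesWithDelay u S
      ((32 + 15 * x.length + 3 * q + b * p) * ((H + 1) ^ 2 * (r + 1))) := by
  have := @Finite.of_fintype _ D.M.tm.ΛFin
  obtain ⟨b, hb⟩ := exists_pushCount_le D.M.tm.m
  refine ⟨3 * b + 4, ?_⟩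
  intro u x y t nL vs τN cN cL q p r d H Sol S hu ht hN hN' hy hL hL' hi hM hnd hdis hS hq hd hH
  have hM' : ∀ v, ∃ τ, v ∈ vs → ∃ c',
      D.M.RunsTo (D.M.start (x.map D.jx ++ D.itemInput v)) τ c' ∧ c'.l = none ∧
      (τ.reduceOption.map (List.map D.M.outputAlphabet)).Nodup ∧
      (∀ w, w ∈ τ.reduceOption.map (List.map D.M.outputAlphabet) ↔ w ∈ Sol v) ∧ Paced d 0 τ := by
    intro v
    by_cases hv : v ∈ vs
    · obtain ⟨τ, h⟩ := (hM v hv).exists_runsTo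
      exact ⟨τ, fun _ => h⟩
    · exact ⟨[], fun h => absurd h hv⟩
  choose T hT using hM'
  obtain ⟨i, s', h1, h2, h3, h4, h5, h6⟩ := D.does_prelude hu ht hN hN' hy hL hL' hi _ rfl
  obtain ⟨τ, s'', g1, g2, g3⟩ := D.exists_run_mainLoop (b := b) (d := d)
    (V := (encodeItems vs).length) hb (x := x)
    (fun v => (T v).reduceOption.map (List.map D.M.outputAlphabet)) D.length_itemInput_le vs
    (fun v hv => by
      obtain ⟨c', k1, k2, -, -, k3⟩ := hT v hv
      exact ⟨length_le_encodeItems_of_mem hv, T v, c', k1, k2, rfl, k3⟩) s' h3 h4 h5 (by simp [h6])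
  have hrun := Prog.runsTo (ei := Equiv.refl I) (eo := D.outEquiv) (u := u) (ki := .inp)
    (by simpa using h2 τ s'' g1)
  have e : ((List.replicate i none ++ τ).reduceOption.map (List.map D.outEquiv)) =
      vs.flatMap fun v => (T v).reduceOption.map (List.map D.M.outputAlphabet) := by
    rw [List.reduceOption_append, reduceOption_replicate_none, List.nil_append, g2]
  refine hrun.enumerates rfl ?_ ?_ ?_
  · refine Eq.mpr (congrArg _ e) ?_
    rw [List.nodup_flatMap]
    refine ⟨fun v hv => (hT v hv).choose_spec.2.2.1, ?_⟩
    refine List.Pairwise.imp_of_mem (R := (· ≠ ·)) (fun {v w} hv hw hvw => ?_) hnd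
    intro a ha ha'
    obtain ⟨_, -, -, -, k1, -⟩ := hT v hv
    obtain ⟨_, -, -, -, k2, -⟩ := hT w hw
    exact Set.disjoint_left.1 (hdis v hv w hw hvw) ((k1 a).1 ha) ((k2 a).1 ha')
  · intro w
    refine Eq.mpr (congrArg (fun l => (w ∈ l ↔ w ∈ S)) e) ?_
    rw [hS, List.mem_flatMap]
    refine exists_congr fun v => and_congr_right fun hv => ?_
    obtain ⟨_, -, -, -, k1, -⟩ := hT v hv
    exact k1 w
  · refine (Paced.append g3 (paced_replicate_none (n := i) le_rfl)).mono le_rfl ?_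
    have := delay_bound_le (b := b) (d := d) (n := x.length) (q := q) (p := p) (t := r) (H := H)
      (i := i) (k := vs.length) (V := (encodeItems vs).length) (by omega) hd
      ((length_le_encodeItems vs).trans (by omega)) (by omega)
    omega

end Driver

/-! ### Programs that compute functions in polynomial time -/

section PolyTime

variable {K : Type} [DecidableEq K] [Finite K] {Γ : K → Type} [∀ k, Finite (Γ k)] {β : Type}
  [Finite β]

/-- In each step, a stack grows by at most a constant that depends on the program. -/
theorem Prog.exists_length_le (p : Prog Γ (Var Γ β)) : ∃ b, ∀ {ko s n s'}, Does ko p s n s' →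
    ∀ k, (s'.2 k).length ≤ (s.2 k).length + b * n := by
  have := p.finite_labels
  obtain ⟨b, hb⟩ := exists_pushCount_le (p.code none id)
  refine ⟨b, fun {ko s n s'} ⟨i, hi, h⟩ k => ?_⟩
  have h1 := Prog.trace_of_run (m := p.code none id) (o := p.isOutput) h none id
    (fun _ => rfl) (fun _ => rfl)
  refine (Trace.length_le hb h1.silent k).trans ?_
  rw [List.length_replicate]
  gcongr

/-- Empty the stacks in a list. -/
def drainAll (ks : List K) : Prog Γ (Var Γ β) :=
  ks.foldr (fun k p => .seq (transfer k fun _ => []) p) (.block .halt)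

theorem does_drainAll {ko : K} {B : ℕ} (ks : List K) (s : Var Γ β × ∀ k, List (Γ k))
    (hs : ∀ k, (s.2 k).length ≤ B) : ∃ s' : Var Γ β × ∀ k, List (Γ k),
      Does ko (drainAll ks) s (ks.length * (3 * B + 1) + 1) s' ∧ (∀ k ∈ ks, s'.2 k = []) ∧
      ∀ k, k ∉ ks → s'.2 k = s.2 k := by
  induction ks generalizing s with
  | nil => exact ⟨s, (does_block .halt s).mono (by omega), by simp, fun _ _ => rfl⟩
  | cons j ks ih =>
    obtain ⟨s₁, -, h1, h2, h3⟩ := does_drain (ko := ko) j s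
    obtain ⟨s₂, h4, h5, h6⟩ := ih s₁ fun k => by
      by_cases hk : k = j
      · subst hk; simp [h2]
      · rw [h3 k hk]; exact hs k
    refine ⟨s₂, (h1.seq h4).mono ?_, fun k hk => ?_, fun k hk => ?_⟩
    · have := hs j
      rw [List.length_cons, add_mul]
      omega
    · by_cases hk' : k ∈ ks
      · exact h5 k hk'
      · have : k = j := by simpa [hk'] using hk
        rw [h6 k hk', this, h2]
    · rw [h6 k fun h => hk (List.mem_cons_of_mem _ h), h3 k fun h => hk (h ▸ List.mem_cons_self)]

/-- At the end of a computation, empty all stacks but the output stack, and reset the variable. -/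
noncomputable def cleanup (ko : K) (v : Var Γ β) : Prog Γ (Var Γ β) :=
  .seq (drainAll ((symbolList K).filter (· ≠ ko))) (.block (.load (fun _ => v) .halt))

theorem does_cleanup {ko : K} {B : ℕ} (v : Var Γ β) (s : Var Γ β × ∀ k, List (Γ k))
    (hs : ∀ k, (s.2 k).length ≤ B) : Does ko (cleanup ko v) s
      ((symbolList K).length * (3 * B + 1) + 2) (v, inputStacks ko (s.2 ko)) := by
  obtain ⟨s', h1, h2, h3⟩ := does_drainAll (ko := ko) ((symbolList K).filter (· ≠ ko)) s hs
  have h4 := does_block (ko := ko) (.load (fun _ => v) .halt) s'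
  have h5 : exec (.load (fun _ => v) .halt) s' = (v, inputStacks ko (s.2 ko)) := by
    refine Prod.ext rfl (funext fun k => ?_)
    change s'.2 k = inputStacks ko (s.2 ko) k
    by_cases hk : k = ko
    · subst hk; rw [h3 k (by simp), inputStacks, Function.update_self]
    · rw [h2 k (by simp [hk, mem_symbolList]), inputStacks, Function.update_of_ne hk]
  rw [h5] at h4
  refine (h1.seq h4).mono ?_
  have : ((symbolList K).filter (· ≠ ko)).length * (3 * B + 1) ≤
    (symbolList K).length * (3 * B + 1) := Nat.mul_le_mul_right _ (List.length_filter_le _ _)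
  omega

theorem Prog.haltList_eq (p : Prog Γ (Var Γ β)) (ki ko : K) (v : Var Γ β) (u : List (Γ ko)) :
    haltList (p.tm ki ko v) u =
      (⟨none, v, inputStacks ko u⟩ : TM2.Cfg Γ p.Labels (Var Γ β)) := by
  have : (fun k => dite (k = ko) (fun h => by rw [h]; exact u) fun _ => []) =
      inputStacks ko u := by
    funext k
    by_cases h : k = ko
    · subst h; simp [inputStacks]
    · simp [inputStacks, h]
  rw [← this]
  rfl

/-- A program that writes `F x` on the output stack within polynomial time, but may leave anything
on the other stacks. -/
theorem Prog.polyTimeComputable {A : Type} {F : List A → List A} (p : Prog Γ (Var Γ β))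
    {ki ko : K} (v : Var Γ β) (ei : Γ ki ≃ A) (eo : Γ ko ≃ A) (q : Polynomial ℕ)
    (h : ∀ x, ∃ s', Does ko p (v, inputStacks ki (x.map ei.symm)) (q.eval x.length) s' ∧
      s'.2 ko = (F x).map eo.symm) : PolyTimeComputable (id : List A → List A) id F := by
  obtain ⟨b, hb⟩ := p.exists_length_le
  let r : Polynomial ℕ := q + (Polynomial.C (symbolList K).length *
    (3 * (Polynomial.X + Polynomial.C b * q) + 1) + 2)
  have hrun : ∀ x, Does ko (.seq p (cleanup ko v)) (v, inputStacks ki (x.map ei.symm))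
      (r.eval x.length)
      (v, inputStacks ko ((F x).map eo.symm)) := by
    intro x
    obtain ⟨s', h1, h2⟩ := h x
    have h3 := does_cleanup (ko := ko) (B := x.length + b * q.eval x.length) v s' fun k => by
      refine (hb h1 k).trans ?_
      gcongr
      by_cases hk : k = ki
      · subst hk; simp [inputStacks]
      · simp [inputStacks, hk]
    rw [h2] at h3
    exact (h1.seq h3).mono (by simp [r])
  choose n hn hrun using hrun
  refine ⟨{ tm := Prog.tm (.seq p (cleanup ko v)) ki ko v, inputAlphabet := ei,
            outputAlphabet := eo, time := r, outputsFun := fun x => ?_ }⟩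
  refine ⟨⟨n x, ?_⟩, hn x⟩
  have h1 := Prog.trace_of_run (m := Prog.code (.seq p (cleanup ko v)) none id)
    (o := Prog.isOutput _) (hrun x) none id (fun _ => rfl) (fun _ => rfl)
  have h2 := iterate_of_trace h1.silent
  have h3 := Prog.start_eq (.seq p (cleanup ko v)) ki ko v (x.map ei.symm)
  have h4 := Prog.haltList_eq (.seq p (cleanup ko v)) ki ko v ((F x).map eo.symm)
  refine Eq.trans ?_ (h2.trans (congrArg some h4.symm))
  exact congrArg _ (congrArg some h3)

/-- A function computed by a program with finite alphabets is computable. -/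
theorem Prog.computable {A : Type} [Primcodable A] {F : List A → List A} (p : Prog Γ (Var Γ β))
    {ki ko : K} (v : Var Γ β) (ei : Γ ki ≃ A) (eo : Γ ko ≃ A)
    (h : ∀ x, ∃ n s', Does ko p (v, inputStacks ki (x.map ei.symm)) n s' ∧
      s'.2 ko = (F x).map eo.symm) : Computable F := by
  have h' : ∀ x, ∃ n, ∃ c' : (p.machine ki ko v ei eo).tm.Cfg,
      (p.machine ki ko v ei eo).RunsTo ((p.machine ki ko v ei eo).start x)
        (List.replicate n none) c' ∧ c'.l = none ∧
      (c'.stk (p.machine ki ko v ei eo).tm.k₁).map (p.machine ki ko v ei eo).outputAlphabet =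
        F x := by
    intro x
    obtain ⟨_, s', ⟨n, -, h1⟩, h2⟩ := h x
    refine ⟨n, _, Prog.runsTo (ei := ei) (eo := eo) h1, rfl, ?_⟩
    refine (congrArg (List.map eo) h2).trans ?_
    simp
  obtain ⟨T, h1, h2⟩ := (p.machine ki ko v ei eo).exists_computable_haltsAt fun x => by
    obtain ⟨n, c', h3, h4, -⟩ := h' x
    exact ⟨_, h3.haltsAt h4⟩
  refine ((p.machine ki ko v ei eo).primrec_result.to_comp.comp Computable.id h1).of_eq fun x => ?_
  obtain ⟨n, c', h3, h4, h5⟩ := h' x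
  rw [← (h3.haltsAt h4).unique (h2 x), id, h3.config_eq, h5]

end PolyTime

/-! ### Running an enumeration machine for a polynomial number of steps -/

/-- The stacks of a machine with a clock: an input stack, auxiliary stacks, the output stack, and
the stacks of a simulated machine. -/
inductive ClockStack (KM : Type)
  | inp
  /-- a buffer for reversed words -/
  | rev
  /-- a copy of the input that is kept -/
  | word
  /-- the remaining number of steps, in unary -/
  | clock
  /-- a buffer for the multiplication of unary numbers -/
  | aux
  | out
  | m (k : KM)
  deriving DecidableEq

instance {KM : Type} [Finite KM] : Finite (ClockStack KM) := by
  refine Finite.of_surjective (fun x : Fin 6 ⊕ KM => match x with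
    | .inl 0 => ClockStack.inp
    | .inl 1 => .rev
    | .inl 2 => .word
    | .inl 3 => .clock
    | .inl 4 => .aux
    | .inl 5 => .out
    | .inr k => .m k) ?_
  rintro (_ | _ | _ | _ | _ | _ | k)
  exacts [⟨.inl 0, rfl⟩, ⟨.inl 1, rfl⟩, ⟨.inl 2, rfl⟩, ⟨.inl 3, rfl⟩, ⟨.inl 4, rfl⟩,
    ⟨.inl 5, rfl⟩, ⟨.inr k, rfl⟩]

namespace Clock

variable {A : Type} [Finite A] (M : EnumMachine A A)

instance : Finite M.tm.K := @Finite.of_fintype _ M.tm.kFin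
instance : Finite M.tm.Λ := @Finite.of_fintype _ M.tm.ΛFin
instance : Finite M.tm.σ := @Finite.of_fintype _ M.tm.σFin

/-- The alphabets of the stacks. -/
abbrev Alphabet : ClockStack M.tm.K → Type
  | .inp => A
  | .rev => A
  | .word => A
  | .clock => Unit
  | .aux => Unit
  | .out => A
  | .m k => M.tm.Γ k

instance : ∀ k, Finite (Alphabet M k)
  | .inp => ‹Finite A›
  | .rev => ‹Finite A›
  | .word => ‹Finite A›
  | .clock => inferInstanceAs (Finite Unit)
  | .aux => inferInstanceAs (Finite Unit)
  | .out => ‹Finite A›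
  | .m k => M.finite_alphabet k

/-- The label and the variable of the simulated machine. -/
abbrev State : Type := Option M.tm.Λ × M.tm.σ

/-- The representation of the simulated machine. -/
def layout : Layout M.tm.Γ (Alphabet M) M.tm.Λ M.tm.σ (State M) where
  emb := .m
  emb_injective _ _ h := by cases h; rfl
  wr _ := id
  rd _ := some
  get s := s
  set x _ := x
  get_set _ _ := rfl

theorem readable_layout (l : M.tm.Λ) : (layout M).Readable (M.tm.m l) :=
  Layout.readable_of_forall _ _ fun _ _ => rfl

theorem stacks_layout (S : ∀ k, List (Alphabet M k)) (T : ∀ k, List (M.tm.Γ k)) :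
    (layout M).Stacks S T ↔ ∀ k, S (.m k) = T k := by
  refine forall_congr' fun k => ?_
  change view some (S (.m k)) = _ ↔ _
  rw [view_some]

/-- The programs. -/
abbrev CProg : Type := Prog (Alphabet M) (Var (Alphabet M) (State M))

/-- The states of the programs. -/
abbrev Full : Type := Var (Alphabet M) (State M) × ∀ k, List (Alphabet M k)

/-- For every symbol on the clock stack, put as many symbols on the auxiliary stack as the word
has, and one more. -/
def multiplyLoop : CProg M :=
  .loop (popInto .clock) (fun v => (v.1 .clock).isSome)
    (.seq (transfer .word fun b => [⟨.rev, b⟩, ⟨.aux, ()⟩])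
      (.seq (transfer .rev fun b => [⟨.word, b⟩]) (.block (pushList [⟨.aux, ()⟩]))))

theorem does_multiplyLoop {ko : ClockStack M.tm.K} {x : List A} (n : ℕ) :
    ∀ s : Full M, s.2 .word = x → s.2 .rev = [] → (s.2 .clock).length = n →
    ∃ s' : Full M, s'.1.2 = s.1.2 ∧
      Does ko (multiplyLoop M) s (n * (6 * x.length + 4) + 1) s' ∧ s'.2 .clock = [] ∧
      (s'.2 .aux).length = (s.2 .aux).length + n * (x.length + 1) ∧
      ∀ k, k ≠ .clock → k ≠ .aux → s'.2 k = s.2 k := by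
  induction n with
  | zero =>
    intro s h1 h2 h3
    have h3' : s.2 .clock = [] := List.length_eq_zero_iff.1 h3
    have h4 := does_loop_exit (ko := ko) (b := popInto .clock) (s := s)
      (c := fun v : Var (Alphabet M) (State M) => (v.1 .clock).isSome)
      (p := .seq (transfer .word fun b => [⟨.rev, b⟩, ⟨.aux, ()⟩])
        (.seq (transfer .rev fun b => [⟨.word, b⟩]) (.block (pushList [⟨.aux, ()⟩])))) (by
        change (Function.update s.1.1 .clock (s.2 .clock).head? .clock).isSome = false
        rw [Function.update_self, h3']; rfl)
    refine ⟨exec (popInto .clock) s, rfl, h4.mono (by omega), ?_, ?_, fun k hk _ => ?_⟩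
    · rw [show s = (s.1, s.2) from rfl, exec_popInto]; simp [h3']
    · rw [show s = (s.1, s.2) from rfl, exec_popInto]; simp
    · rw [show s = (s.1, s.2) from rfl, exec_popInto]; simp [hk]
  | succ n ih =>
    intro s h1 h2 h3
    have e : exec (popInto .clock) s = ((Function.update s.1.1 .clock (s.2 .clock).head?, s.1.2),
      Function.update s.2 .clock (s.2 .clock).tail) := rfl
    obtain ⟨s₁, e1, g1, a1, a2, a3, a4⟩ := does_transfer_pair (ko := ko) (i := .word) (j := .rev)
      (k := .aux) (by simp) (by simp) (by simp) (fun b => b) (fun _ => ()) (exec (popInto .clock) s)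
    obtain ⟨s₂, e2, g2, b1, b2, b3⟩ := does_transfer_single (ko := ko) (i := .rev) (j := .word)
      (by simp) (fun b => b) s₁
    obtain ⟨s₃, e3, g3, c1, c2⟩ := does_push (ko := ko) (j := .aux) () s₂
    have k1 : (exec (popInto .clock) s).2 .word = x := by rw [e]; simpa using h1
    have k2 : (exec (popInto .clock) s).2 .rev = [] := by rw [e]; simpa using h2
    rw [k1] at g1 a2 a3
    rw [k2] at a2
    rw [a2] at g2 b2
    rw [a1] at b2
    obtain ⟨s₄, e4, g4, d1, d2, d3⟩ := ih s₃ (by rw [c2 _ (by simp), b2]; simp)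
      (by rw [c2 _ (by simp), b1]) (by
        rw [c2 _ (by simp), b3 _ (by simp) (by simp), a4 _ (by simp) (by simp) (by simp), e]
        simp [h3])
    refine ⟨s₄, ?_, (Does.loop_step ?_ (g1.seq (g2.seq g3)) g4).mono ?_, d1, ?_, fun k hk hk' => ?_⟩
    · rw [e4, e3, e2, e1, e]
    · rw [e]
      change (Function.update s.1.1 .clock (s.2 .clock).head? .clock).isSome = true
      rw [Function.update_self]
      cases h : s.2 .clock with
      | nil => simp [h] at h3
      | cons => rfl
    · simp only [List.map_id', List.append_nil, List.length_reverse]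
      rw [add_mul]
      omega
    · have k3 : (exec (popInto .clock) s).2 .aux = s.2 .aux := by rw [e]; simp
      rw [d2, c1, List.length_cons, b3 _ (by simp) (by simp), a3, k3]
      simp only [List.length_append, List.length_reverse, List.length_map]
      ring
    · rw [d3 k hk hk', c2 k hk']
      by_cases hw : k = .word
      · subst hw; rw [b2, h1]; simp
      by_cases hr : k = .rev
      · subst hr; rw [b1, h2]
      rw [b3 k hr hw, a4 k hw hr hk', e]
      simp [hk]

/-- Multiply the number of symbols on the clock stack by the length of the word plus one. -/
def multiply : CProg M := .seq (multiplyLoop M) (transfer .aux fun _ => [⟨.clock, ()⟩])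

theorem does_multiply {ko : ClockStack M.tm.K} {x : List A} (s : Full M) (hw : s.2 .word = x)
    (hr : s.2 .rev = []) (ha : s.2 .aux = []) : ∃ s' : Full M, s'.1.2 = s.1.2 ∧
      Does ko (multiply M) s ((s.2 .clock).length * (9 * x.length + 7) + 2) s' ∧
      (s'.2 .clock).length = (s.2 .clock).length * (x.length + 1) ∧
      ∀ k, k ≠ .clock → s'.2 k = s.2 k := by
  obtain ⟨s₁, e1, h1, a1, a2, a3⟩ := does_multiplyLoop M (ko := ko) _ s hw hr rfl
  obtain ⟨s₂, e2, h2, b1, b2, b3⟩ := does_transfer_single (ko := ko) (i := .aux) (j := .clock)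
    (by simp) (fun _ => ()) s₁
  rw [ha, List.length_nil, Nat.zero_add] at a2
  refine ⟨s₂, e2.trans e1, (h1.seq h2).mono (by rw [a2]; nlinarith), ?_, fun k hk => ?_⟩
  · rw [b2, a1, List.length_append, List.length_reverse, List.length_map, a2]
    rfl
  · by_cases h : k = .aux
    · subst h; rw [b1, ha]
    · rw [b3 k h hk, a3 k hk h]

/-- Set the clock to `C * (n + 1) ^ e`, for a word of length `n`. -/
def setClock (C : ℕ) : ℕ → CProg M
  | 0 => .block (pushList ((List.replicate C ()).map fun a => ⟨.clock, a⟩))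
  | e + 1 => .seq (setClock C e) (multiply M)

/-- The time needed to set the clock. -/
noncomputable def setClockTime (C : ℕ) : ℕ → Polynomial ℕ
  | 0 => 1
  | e + 1 =>
    setClockTime C e + (Polynomial.C C * (Polynomial.X + 1) ^ e * (9 * Polynomial.X + 7) + 2)

theorem does_setClock {ko : ClockStack M.tm.K} {x : List A} (C e : ℕ) (s : Full M)
    (hw : s.2 .word = x) (hr : s.2 .rev = []) (ha : s.2 .aux = []) (hc : s.2 .clock = []) :
    ∃ s' : Full M, s'.1.2 = s.1.2 ∧
      Does ko (setClock M C e) s ((setClockTime C e).eval x.length) s' ∧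
      (s'.2 .clock).length = C * (x.length + 1) ^ e ∧ ∀ k, k ≠ .clock → s'.2 k = s.2 k := by
  induction e with
  | zero =>
    have h := does_block (ko := ko)
      (pushList ((List.replicate C ()).map fun a => (⟨.clock, a⟩ : Σ k, Alphabet M k))) s
    rw [show s = (s.1, s.2) from rfl, exec_pushList, pushed_map] at h
    refine ⟨(s.1, Function.update s.2 .clock _), rfl, h.mono (by simp [setClockTime]), ?_,
      fun k hk => by simp [hk]⟩
    simp [hc]
  | succ e ih =>
    obtain ⟨s₁, e1, h1, a1, a2⟩ := ih
    obtain ⟨s₂, e2, h2, b1, b2⟩ := does_multiply M (ko := ko) (x := x) s₁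
      (by rw [a2 _ (by simp), hw]) (by rw [a2 _ (by simp), hr]) (by rw [a2 _ (by simp), ha])
    rw [a1] at h2 b1
    refine ⟨s₂, e2.trans e1, (h1.seq h2).mono (by simp [setClockTime]), by rw [b1]; ring,
      fun k hk => by rw [b2 k hk, a2 k hk]⟩

/-- Has the simulated machine reached its end or an output instruction? -/
def decided (l : Option M.tm.Λ) : Bool := l.elim true M.isOutput

/-- Simulate the machine until it is decided or the clock is empty. -/
def clockedLoop : CProg M :=
  .loop (popInto .clock) (fun v => (v.1 .clock).isSome && !decided M v.2.1)
    ((layout M).simStep M.tm.m fun _ => false)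

theorem does_clockedLoop {ko : ClockStack M.tm.K} {c c' : M.tm.Cfg} {τ} (h : M.RunsTo c τ c')
    (hc : c'.l = none) : ∀ s : Full M, (layout M).Rel s c →
    ∃ (j : ℕ) (c'' : M.tm.Cfg) (τ' : List (Option (List (M.tm.Γ M.tm.k₁)))) (s' : Full M),
      τ = List.replicate j none ++ τ' ∧ M.RunsTo c'' τ' c' ∧ (layout M).Rel s' c'' ∧
      Does ko (clockedLoop M) s (3 * (s.2 .clock).length + 1) s' ∧
      (decided M c''.l = true ∨ j = (s.2 .clock).length) ∧
      ∀ k, k ≠ .clock → (∀ i, k ≠ .m i) → s'.2 k = s.2 k := by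
  have hexit : ∀ s : Full M, ((s.2 .clock).head?.isSome && !decided M s.1.2.1) = false →
      Does ko (clockedLoop M) s (3 * (s.2 .clock).length + 1) (exec (popInto .clock) s) := by
    intro s hs
    refine (does_loop_exit (b := popInto .clock)
      (c := fun v : Var (Alphabet M) (State M) => (v.1 .clock).isSome && !decided M v.2.1) ?_).mono
      (Nat.le_add_left _ _)
    change ((Function.update s.1.1 .clock (s.2 .clock).head? .clock).isSome && _) = false
    rw [Function.update_self]
    exact hs
  have hrel : ∀ (s : Full M) (c : M.tm.Cfg), (layout M).Rel s c →
      (layout M).Rel (exec (popInto .clock) s) c := by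
    intro s c hs
    refine ⟨hs.1, hs.2.congr fun k => ?_⟩
    exact Function.update_of_ne (fun h : ClockStack.m k = .clock => by cases h) (s.2 .clock).tail _
  have hframe : ∀ (s : Full M) k, k ≠ .clock → (exec (popInto .clock) s).2 k = s.2 k := by
    intro s k hk
    change Function.update s.2 .clock _ k = s.2 k
    simp [hk]
  have hlabel : ∀ (s : Full M) (c : M.tm.Cfg), (layout M).Rel s c → s.1.2.1 = c.l :=
    fun s c hs => congrArg Prod.fst hs.1
  induction h with
  | nil c =>
    intro s hs
    have hd : decided M c.l = true := by rw [hc]; rfl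
    exact ⟨0, c, [], _, rfl, .nil c, hrel s c hs, hexit s (by rw [hlabel s c hs, hd]; simp),
      .inl hd, fun k hk _ => hframe s k hk⟩
  | cons l v S τ c' h ih =>
    intro s hs
    have hs' := hlabel s _ hs
    obtain hl | hl := Bool.eq_false_or_eq_true (M.isOutput l)
    · refine ⟨0, _, _, _, rfl, .cons l v S τ c' h, hrel s _ hs, hexit s ?_, .inl hl,
        fun k hk _ => hframe s k hk⟩
      rw [hs']
      simp [decided, hl]
    · cases hk : s.2 .clock with
      | nil =>
        exact ⟨0, _, _, _, rfl, .cons l v S τ c' h, hrel s _ hs,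
          hk ▸ hexit s (by rw [hk]; rfl), .inr rfl, fun k hk _ => hframe s k hk⟩
      | cons a t =>
        simp only [hl, Bool.false_eq_true, if_false] at h ih ⊢
        obtain ⟨s₁, h1, h2, h3⟩ := Layout.does_simStep (ko := ko) (readable_layout M)
          (hrel s _ hs)
        have h4 : s₁.2 .clock = t := by
          rw [h2 _ (by simp [layout])]
          change Function.update s.2 .clock (s.2 .clock).tail .clock = t
          rw [Function.update_self, hk]; rfl
        obtain ⟨j, c'', τ', s', g1, g2, g3, g4, g5, g6⟩ := ih hc s₁ h1
        rw [h4] at g4 g5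
        refine ⟨j + 1, c'', τ', s', by rw [g1]; rfl, g2, g3,
          (Does.loop_step (n₁ := 2) ?_ ⟨2, le_rfl, h3⟩ g4).mono ?_, g5.imp_right ?_, ?_⟩
        · change ((Function.update s.1.1 .clock (s.2 .clock).head? .clock).isSome &&
            !decided M s.1.2.1) = true
          rw [Function.update_self, hk, hs']
          simp [decided, hl]
        · rw [List.length_cons]; omega
        · rintro rfl; rfl
        · intro k hk hk'
          rw [g6 k hk hk', h2 k fun i => (hk' i).symm, hframe s k hk]

/-- Write the result: one of two fixed words if the simulated machine is decided, or the word
itself. -/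
def writeResult (x₀ x₁ : List A) : CProg M :=
  .switch fun v =>
    if decided M v.2.1 then
      .block (pushList (((v.2.1.elim x₀ fun _ => x₁).reverse).map fun a => ⟨.out, a⟩))
    else .seq (transfer .word fun b => [⟨.rev, b⟩]) (transfer .rev fun b => [⟨.out, b⟩])

theorem does_writeResult {ko : ClockStack M.tm.K} {x : List A} (x₀ x₁ : List A) (s : Full M)
    (hw : s.2 .word = x) (hr : s.2 .rev = []) (ho : s.2 .out = []) : ∃ s' : Full M,
      Does ko (writeResult M x₀ x₁) s (6 * x.length + 3) s' ∧
      s'.2 .out = if decided M s.1.2.1 then s.1.2.1.elim x₀ fun _ => x₁ else x := by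
  by_cases hd : decided M s.1.2.1 = true
  · have h := does_block (ko := ko) (pushList
      (((s.1.2.1.elim x₀ fun _ => x₁).reverse).map fun a => (⟨.out, a⟩ : Σ k, Alphabet M k))) s
    rw [show s = (s.1, s.2) from rfl, exec_pushList, pushed_map] at h
    simp only [List.map_id', List.reverse_reverse] at h
    refine ⟨(s.1, Function.update s.2 .out ((s.1.2.1.elim x₀ fun _ => x₁) ++ s.2 .out)),
      (Does.switch (n := 1) ?_).mono (by omega), ?_⟩
    · rw [if_pos hd]
      exact h
    · simp [hd, ho]
  · obtain ⟨s₁, e1, h1, a1, a2, a3⟩ := does_transfer_single (ko := ko) (i := .word) (j := .rev)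
      (by simp) (fun b => b) s
    obtain ⟨s₂, e2, h2, b1, b2, b3⟩ := does_transfer_single (ko := ko) (i := .rev) (j := .out)
      (by simp) (fun b => b) s₁
    rw [hw] at h1 a2
    rw [hr] at a2
    rw [a2] at h2 b2
    refine ⟨s₂, (Does.switch ?_).mono
      (by simp; omega : (3 * x.length + 1 + (3 * ((x.map fun b => b).reverse ++ []).length + 1)) + 1
        ≤ _), ?_⟩
    · rw [if_neg hd]
      exact h1.seq h2
    · rw [b2, a3 _ (by simp) (by simp), ho, if_neg hd]
      simp

/-- Copy the input. -/
def loadInput : CProg M :=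
  .seq (transfer .inp fun b => [⟨.rev, b⟩])
    (transfer .rev fun b => [⟨.word, b⟩, ⟨.m M.tm.k₀, M.inputAlphabet.symm b⟩])

theorem does_loadInput {ko : ClockStack M.tm.K} (x : List A) (s : Full M)
    (hs : s.2 = inputStacks .inp x) : ∃ s' : Full M, s'.1.2 = s.1.2 ∧
      Does ko (loadInput M) s (6 * x.length + 2) s' ∧ s'.2 .word = x ∧
      (layout M).Stacks s'.2 (inputStacks M.tm.k₀ (x.map M.inputAlphabet.symm)) ∧
      ∀ k, k ≠ .word → (∀ i, k ≠ .m i) → s'.2 k = [] := by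
  have h0 : ∀ k, k ≠ .inp → s.2 k = [] := fun k hk => by simp [hs, inputStacks, hk]
  have h0' : s.2 .inp = x := by simp [hs, inputStacks]
  obtain ⟨s₁, e1, h1, a1, a2, a3⟩ := does_transfer_single (ko := ko) (i := .inp) (j := .rev)
    (by simp) (fun b => b) s
  obtain ⟨s₂, e2, h2, b1, b2, b3, b4⟩ := does_transfer_pair (ko := ko) (i := .rev) (j := .word)
    (k := .m M.tm.k₀) (by simp) (by simp) (by simp) (fun b => b) M.inputAlphabet.symm s₁
  rw [h0'] at h1 a2
  rw [h0 _ (by simp)] at a2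
  rw [a2] at h2 b2 b3
  refine ⟨s₂, e2.trans e1, (h1.seq h2).mono (by simp; omega), ?_, ?_, fun k hk hk' => ?_⟩
  · rw [b2, a3 _ (by simp) (by simp), h0 _ (by simp)]; simp
  · rw [stacks_layout]
    intro k
    by_cases hk : k = M.tm.k₀
    · subst hk
      rw [b3, a3 _ (by simp) (by simp), h0 _ (by simp), inputStacks, Function.update_self]
      simp
    · rw [b4 _ (by simp) (by simp) (by simpa using hk), a3 _ (by simp) (by simp), h0 _ (by simp),
        inputStacks, Function.update_of_ne hk]
  · by_cases hr : k = .rev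
    · subst hr; exact b1
    rw [b4 k hr hk (hk' _)]
    by_cases hi : k = .inp
    · subst hi; exact a1
    rw [a3 k hi hr, h0 k hi]

/-- The whole program. -/
def prog (C e : ℕ) (x₀ x₁ : List A) : CProg M :=
  .seq (loadInput M) (.seq (setClock M C e) (.seq (clockedLoop M) (writeResult M x₀ x₁)))

/-- The initial value of the variable. -/
def init : Var (Alphabet M) (State M) := (fun _ => none, some M.tm.main, M.tm.initialState)

/-- Simulate `M` for `C * (|x| + 1) ^ e` steps, or until it halts (then there are no solutions) or
reaches an output instruction (then there are solutions).  If the clock runs out before, then the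
delay is larger than the number of simulated steps. -/
theorem exists_polyTimeComputable [Primcodable A] (C e : ℕ) (x₀ x₁ : List A) {d : List A → ℕ}
    {Sol : List A → Set (List A)} (hM : ∀ x, M.EnumeratesWithDelay x (Sol x) (d x)) :
    ∃ F : List A → List A, PolyTimeComputable (id : List A → List A) id F ∧ Computable F ∧
      ∀ x, (Sol x = ∅ ∧ F x = x₀) ∨ ((Sol x).Nonempty ∧ F x = x₁) ∨
        (F x = x ∧ C * (x.length + 1) ^ e < d x) := by
  let q : Polynomial ℕ := 12 * Polynomial.X + 6 + setClockTime C e +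
    3 * (Polynomial.C C * (Polynomial.X + 1) ^ e)
  have key : ∀ x : List A, ∃ y : List A, (∃ s' : Full M, Does .out (prog M C e x₀ x₁)
      (init M, inputStacks .inp x) (q.eval x.length) s' ∧
      s'.2 .out = y) ∧ ((Sol x = ∅ ∧ y = x₀) ∨ ((Sol x).Nonempty ∧ y = x₁) ∨
        (y = x ∧ C * (x.length + 1) ^ e < d x)) := by
    intro x
    obtain ⟨τ, c', h1, h2, -, h3, h4⟩ := (hM x).exists_runsTo
    obtain ⟨s₁, e1, p1, a1, a2, a3⟩ := does_loadInput M (ko := .out) x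
      (init M, inputStacks .inp x) rfl
    obtain ⟨s₂, e2, p2, b1, b2⟩ := does_setClock M (ko := .out) (x := x) C e s₁ a1
      (a3 _ (by simp) (by simp)) (a3 _ (by simp) (by simp)) (a3 _ (by simp) (by simp))
    obtain ⟨j, c'', τ', s₃, g1, g2, g3, p3, g4, g5⟩ := does_clockedLoop M (ko := .out) h1 h2 s₂
      ⟨by
        change s₂.1.2 = _
        rw [e2, e1]; rfl, by
        rw [EnumMachine.start, stk_initList]
        exact a2.congr fun k => b2 _ (by simp [layout])⟩
    rw [b1] at p3 g4
    obtain ⟨s₄, p4, hr⟩ := does_writeResult M (ko := .out) (x := x) x₀ x₁ s₃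
      (by rw [g5 _ (by simp) (by simp), b2 _ (by simp), a1])
      (by rw [g5 _ (by simp) (by simp), b2 _ (by simp), a3 _ (by simp) (by simp)])
      (by rw [g5 _ (by simp) (by simp), b2 _ (by simp), a3 _ (by simp) (by simp)])
    have hl : s₃.1.2.1 = c''.l := congrArg Prod.fst g3.1
    rw [hl] at hr
    have hq : 6 * x.length + 2 + ((setClockTime C e).eval x.length +
        (3 * (C * (x.length + 1) ^ e) + 1 + (6 * x.length + 3))) ≤ q.eval x.length := by
      simp [q]; omega
    refine ⟨_, ⟨s₄, (p1.seq (p2.seq (p3.seq p4))).mono hq, rfl⟩, ?_⟩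
    rw [hr]
    have h5 : τ.reduceOption = τ'.reduceOption := by
      rw [g1, List.reduceOption_append, reduceOption_replicate_none, List.nil_append]
    rw [h5] at h3
    obtain ⟨l, v, S⟩ := c''
    cases l with
    | none =>
      refine .inl ⟨?_, rfl⟩
      cases g2
      refine Set.eq_empty_of_forall_notMem fun w hw => ?_
      simpa using (h3 w).2 hw
    | some l =>
      cases hd : M.isOutput l with
      | true =>
        refine .inr (.inl ⟨?_, by simp [decided, hd]⟩)
        cases g2 with
        | nil => cases h2
        | cons l v S τ' c' h =>
          exact ⟨_, (h3 _).1 (by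
            simp only [hd, if_true, List.reduceOption_cons_of_some, List.map_cons]
            exact List.mem_cons_self)⟩
      | false =>
        refine .inr (.inr ⟨by simp [decided, hd], ?_⟩)
        have hj : j = C * (x.length + 1) ^ e := g4.resolve_left (by simp [decided, hd])
        cases g2 with
        | nil => cases h2
        | cons l v S τ' c' h =>
          simp only [hd, Bool.false_eq_true, if_false] at g1
          rw [g1, Paced.replicate_none_append] at h4
          have := Paced.le (g := 0 + j + 1) h4
          omega
  choose F hF using key
  have hF' : ∀ x, ∃ s', Does .out (prog M C e x₀ x₁)
      (init M, inputStacks .inp (x.map (Equiv.refl A).symm)) (q.eval x.length) s' ∧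
      s'.2 .out = (F x).map (Equiv.refl A).symm := by
    intro x
    obtain ⟨s', h1, h2⟩ := (hF x).1
    exact ⟨s', by simpa using h1, by simpa using h2⟩
  exact ⟨F, Prog.polyTimeComputable (prog M C e x₀ x₁) (ki := .inp) (ko := .out) (init M)
    (Equiv.refl A) (Equiv.refl A) q hF',
    Prog.computable (prog M C e x₀ x₁) (ki := .inp) (ko := .out) (init M) (Equiv.refl A)
      (Equiv.refl A) fun x => ⟨_, hF' x⟩, fun x => (hF x).2⟩

end Clock

end StackMachine

/-! ### Computable bounds -/

section Computable

open StackMachine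

variable {α β : Type} [Primcodable α] [Primcodable β]

theorem computable_sum_map {g : α → β → ℕ} {L : α → List β} (hg : Computable₂ g)
    (hL : Computable L) : Computable fun a => ((L a).map (g a)).sum := by
  have h1 : Computable₂ fun (a : α) (p : ℕ × ℕ) => ((L a)[p.1]?).elim p.2 fun b => p.2 + g a b := by
    refine (Computable.option_casesOn (o := fun q : α × ℕ × ℕ => (L q.1)[q.2.1]?)
      (f := fun q => q.2.2) (g := fun q b => q.2.2 + g q.1 b) ?_ ?_ ?_).of_eq fun q => ?_
    · exact Computable.list_getElem?.comp (hL.comp Computable.fst)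
        (Computable.fst.comp Computable.snd)
    · exact Computable.snd.comp Computable.snd
    · exact Primrec.nat_add.to_comp.comp
        (Computable.snd.comp (Computable.snd.comp Computable.fst))
        (hg.comp (Computable.fst.comp Computable.fst) Computable.snd)
    · change _ = ((L q.1)[q.2.1]?).elim q.2.2 fun b => q.2.2 + g q.1 b
      cases (L q.1)[q.2.1]? <;> rfl
  refine (Computable.nat_rec (Computable.list_length.comp hL) (Computable.const 0) h1).of_eq
    fun a => ?_
  have h2 : ∀ n, n ≤ (L a).length → Nat.rec (motive := fun _ => ℕ) 0
      (fun y IH => ((L a)[y]?).elim IH fun b => IH + g a b) n = (((L a).take n).map (g a)).sum := by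
    intro n hn
    induction n with
    | zero => rfl
    | succ n ih =>
      have h3 : n < (L a).length := hn
      rw [List.take_add_one, List.map_append, List.sum_append, ← ih (by omega)]
      simp [List.getElem?_eq_getElem h3]
  exact (h2 _ le_rfl).trans (by rw [List.take_length])

/-- All words of length at most `n`. -/
noncomputable def wordsUpTo (A : Type) [Finite A] (n : ℕ) : List (List A) :=
  n.rec [[]] fun _ l => [] :: l.flatMap fun w => (symbolList A).map fun a => a :: w

theorem mem_wordsUpTo {A : Type} [Finite A] {n : ℕ} {w : List A} (h : w.length ≤ n) :
    w ∈ wordsUpTo A n := by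
  induction n generalizing w with
  | zero => simp [wordsUpTo, List.length_eq_zero_iff.1 (Nat.le_zero.1 h)]
  | succ n ih =>
    cases w with
    | nil => exact List.mem_cons_self
    | cons a w =>
      refine List.mem_cons_of_mem _ (List.mem_flatMap.2 ⟨w, ih (by simpa using h), ?_⟩)
      exact List.mem_map_of_mem (mem_symbolList a)

theorem primrec_wordsUpTo (A : Type) [Finite A] [Primcodable A] : Primrec (wordsUpTo A) := by
  refine Primrec.nat_rec₁ _ (Primrec.list_cons.comp₂ (Primrec₂.const [])
    (Primrec.list_flatMap (Primrec.snd) ?_))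
  exact Primrec.list_map (Primrec.const _)
    (Primrec.list_cons.comp₂ Primrec₂.right (Primrec.snd.comp₂ Primrec₂.left))

/-- A computable function of two words is bounded in terms of a bound on the length of the first
one, if the second one is restricted to a finite set that is computable from the first one. -/
theorem exists_computable_bound {A : Type} [Finite A] [Primcodable A] {g : List A → List A → ℕ}
    {L : List A → List (List A)} {h : ℕ → ℕ} (hg : Computable₂ g) (hL : Computable L)
    (hh : Computable h) : ∃ H : ℕ → ℕ, Computable H ∧
      ∀ k y w, y.length ≤ h k → w ∈ L y → g y w ≤ H k := by
  refine ⟨fun k => ((wordsUpTo A (h k)).map fun y => ((L y).map (g y)).sum).sum, ?_, ?_⟩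
  · exact computable_sum_map ((computable_sum_map hg hL).comp Computable.snd)
      ((primrec_wordsUpTo A).to_comp.comp hh)
  · intro k y w hy hw
    exact (List.le_sum_of_mem (List.mem_map_of_mem hw)).trans
      (List.le_sum_of_mem (List.mem_map.2 ⟨y, mem_wordsUpTo hy, rfl⟩))

/-- The list of all elements can be computed without repetitions. -/
theorem ComputableFiniteSets.exists_nodup {A : Type} [Primcodable A] {S : α → Set (List A)}
    (h : ComputableFiniteSets S) : ∃ L : α → List (List A), Computable L ∧
      (∀ a w, w ∈ L a ↔ w ∈ S a) ∧ ∀ a, (L a).Nodup := by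
  classical
  obtain ⟨L, h1, h2⟩ := h
  have h3 : Primrec fun l : List (List A) =>
      l.foldr (fun w l => if w ∈ l then l else w :: l) [] := by
    refine Primrec.list_foldr (h := fun _ p => if p.1 ∈ p.2 then p.2 else p.1 :: p.2) Primrec.id
      (Primrec.const []) ?_
    have h4 : PrimrecPred fun q : List (List A) × List A × List (List A) => q.2.1 ∈ q.2.2 :=
      (Primrec.nat_lt.comp (Primrec.list_idxOf.comp (Primrec.fst.comp Primrec.snd)
        (Primrec.snd.comp Primrec.snd)) (Primrec.list_length.comp
          (Primrec.snd.comp Primrec.snd))).of_eq fun q =>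
            @List.idxOf_lt_length_iff (List A) instBEqOfDecidableEq inferInstance _ _
    exact Primrec.ite h4 (Primrec.snd.comp Primrec.snd) (Primrec.list_cons.comp
      (Primrec.fst.comp Primrec.snd) (Primrec.snd.comp Primrec.snd))
  have h4 : ∀ (l : List (List A)) w,
      w ∈ l.foldr (fun w l => if w ∈ l then l else w :: l) [] ↔ w ∈ l := by
    intro l w
    induction l with
    | nil => rfl
    | cons v l ih =>
      rw [List.foldr_cons, List.mem_cons, ← ih]
      split_ifs with h
      · exact ⟨.inr, fun h' => h'.elim (fun e => e ▸ h) id⟩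
      · exact List.mem_cons
  have h5 : ∀ l : List (List A), (l.foldr (fun w l => if w ∈ l then l else w :: l) []).Nodup := by
    intro l
    induction l with
    | nil => exact List.nodup_nil
    | cons v l ih =>
      rw [List.foldr_cons]
      split_ifs with h
      · exact ih
      · exact List.nodup_cons.2 ⟨h, ih⟩
  exact ⟨_, h3.to_comp.comp h1, fun a w => (h4 _ w).trans (h2 a w), fun a => h5 _⟩

/-- Split a word at the first separator. -/
def splitAtSeparator {A : Type} (z : List (Option A)) : List A × List A :=
  z.foldr (fun o s => o.elim ([], s.1) fun a => (a :: s.1, s.2)) ([], [])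

theorem splitAtSeparator_append {A : Type} (y w : List A) :
    splitAtSeparator (y.map some ++ none :: w.map some) = (y, w) := by
  have h : splitAtSeparator (w.map some) = (w, []) := by
    induction w with
    | nil => rfl
    | cons a w ih =>
      change (a :: (splitAtSeparator (w.map some)).1, (splitAtSeparator (w.map some)).2) = _
      rw [ih]
  induction y with
  | nil =>
    change ([], (splitAtSeparator (w.map some)).1) = _
    rw [h]
  | cons a y ih =>
    change (a :: (splitAtSeparator (y.map some ++ none :: w.map some)).1,
      (splitAtSeparator (y.map some ++ none :: w.map some)).2) = _
    rw [ih]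

theorem primrec_splitAtSeparator {A : Type} [Primcodable A] :
    Primrec (splitAtSeparator : List (Option A) → List A × List A) := by
  refine Primrec.list_foldr
    (h := fun _ (p : Option A × List A × List A) =>
      p.1.elim (([], p.2.1) : List A × List A) fun a => (a :: p.2.1, p.2.2)) Primrec.id
    (Primrec.const ([], [])) ?_
  refine (Primrec.option_casesOn
    (o := fun q : List (Option A) × Option A × List A × List A => q.2.1)
    (f := fun q => (([], q.2.2.1) : List A × List A)) (g := fun q a => (a :: q.2.2.1, q.2.2.2))
    (Primrec.fst.comp Primrec.snd) ?_ ?_).of_eq fun q => ?_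
  · exact Primrec.pair (Primrec.const [])
      (Primrec.fst.comp (Primrec.snd.comp Primrec.snd))
  · have h : Primrec fun r : (List (Option A) × Option A × List A × List A) × A => r.1.2.2 :=
      Primrec.snd.comp (Primrec.snd.comp Primrec.fst)
    exact Primrec.pair (Primrec.list_cons.comp Primrec.snd (Primrec.fst.comp h))
      (Primrec.snd.comp h)
  · change _ = q.2.1.elim ([], q.2.2.1) fun a => (a :: q.2.2.1, q.2.2.2)
    cases q.2.1 <;> rfl

theorem primrec_encodeItems {A : Type} [Primcodable A] :
    Primrec (Driver.encodeItems : List (List A) → List (Option A)) :=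
  Primrec.list_flatMap Primrec.id ((Primrec.list_append.comp
    (Primrec.list_map (Primrec.list_reverse.comp Primrec.id)
      (Primrec.option_some.comp₂ Primrec₂.right)) (Primrec.const [none])).comp₂ Primrec₂.right)

end Computable

theorem Polynomial.exists_eval_le (p : Polynomial ℕ) :
    ∃ C e, ∀ n, p.eval n ≤ C * (n + 1) ^ e := by
  refine ⟨∑ i ∈ Finset.range (p.natDegree + 1), p.coeff i, p.natDegree, fun n => ?_⟩
  rw [Polynomial.eval_eq_sum_range, Finset.sum_mul]
  refine Finset.sum_le_sum fun i hi => Nat.mul_le_mul_left _ ?_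
  exact (Nat.pow_le_pow_left (Nat.le_succ n) i).trans
    (Nat.pow_le_pow_right (Nat.succ_pos n) (by simpa [Nat.lt_succ_iff] using hi))

namespace StackMachine

/-- Every computable function on words is computed by a stack machine in computable time. -/
theorem exists_machine_of_computable_of_time {B C : Type} [Finite B] [Finite C] [Primcodable B]
    [Primcodable C] {F : List B → List C} (hF : Computable F) :
    ∃ (N : EnumMachine B C) (T : List B → ℕ), Computable T ∧ ∀ u, ∃ c',
      N.RunsTo (N.start u) (List.replicate (T u) none) c' ∧ c'.l = none ∧
        (c'.stk N.tm.k₁).map N.outputAlphabet = F u := by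
  obtain ⟨N, hN⟩ := exists_machine_of_computable hF
  obtain ⟨T, h1, h2⟩ := N.exists_computable_haltsAt fun u => by
    obtain ⟨n, c', h3, h4, -⟩ := hN u
    exact ⟨_, h3.haltsAt h4⟩
  refine ⟨N, T, h1, fun u => ?_⟩
  obtain ⟨n, c', h3, h4, h5⟩ := hN u
  have h6 := (h3.haltsAt h4).unique (h2 u)
  rw [List.length_replicate] at h6
  exact ⟨c', h6 ▸ h3, h4, h5⟩

/-- A polynomial-time machine as a silent computation. -/
theorem exists_trace_of_polyTime {A : Type} {F : List A → List A}
    (N : TM2ComputableInPolyTime (id : List A → List A) id F) (x : List A) :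
    ∃ τ c', Trace N.tm.m (fun _ => false) N.tm.k₁
        (initList N.tm (x.map N.inputAlphabet.symm)) τ c' ∧
      c'.l = none ∧ c'.stk N.tm.k₁ = (F x).map N.outputAlphabet.symm ∧
      τ.length ≤ N.time.eval x.length := by
  have h := N.outputsFun x
  refine ⟨_, _, exists_trace_of_iterate h.evals_in_steps, rfl, ?_, ?_⟩
  · simp [haltList]
  · rw [List.length_replicate]
    exact h.steps_le_m

end StackMachine

/-! ### The two implications -/

namespace ParamEnumProblem

open StackMachine

variable {A : Type} [Finite A] [Primcodable A] {E : ParamEnumProblem A}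

/-- Run the algorithm until it halts, and collect its outputs. -/
theorem computable_sol {M : EnumMachine A A} {d : List A → ℕ}
    (hM : ∀ x, M.EnumeratesWithDelay x (E.Sol x) (d x)) : ComputableFiniteSets E.Sol := by
  obtain ⟨T, h1, h2⟩ := M.exists_computable_haltsAt fun x => by
    obtain ⟨T, hT, -⟩ := hM x
    exact ⟨T, hT⟩
  refine ⟨fun x => M.outputs x (T x), M.primrec_outputs.to_comp.comp Computable.id h1,
    fun x w => ?_⟩
  obtain ⟨T', h3, -, h4, -⟩ := hM x
  change w ∈ M.outputs x (T x) ↔ _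
  rw [(h2 x).unique h3]
  exact h4 w

/-- The kernelization that belongs to an enumeration algorithm: if the algorithm finds out whether
there are solutions within a certain polynomial number of steps, then the instance is replaced by a
fixed one, and otherwise the instance is already short. -/
theorem exists_kernelization {M : EnumMachine A A} {t : ℕ → ℕ} {p : Polynomial ℕ}
    (ht : Computable t)
    (hM : ∀ x, M.EnumeratesWithDelay x (E.Sol x) (t (E.κ x) * p.eval x.length)) :
    ∃ K : List A → List A, PolyTimeComputable (id : List A → List A) id K ∧ Computable K ∧
      ∃ h : ℕ → ℕ, Computable h ∧ ∀ x, (x ∈ E.Q ↔ K x ∈ E.Q) ∧ (K x).length ≤ h (E.κ x) := by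
  classical
  obtain ⟨C, e, hp⟩ := p.exists_eval_le
  obtain ⟨x₀, h₀⟩ : ∃ x₀, (∃ x, x ∉ E.Q) → x₀ ∉ E.Q := by
    by_cases h : ∃ x, x ∉ E.Q
    · exact ⟨h.choose, fun _ => h.choose_spec⟩
    -- No instance without solutions exists, so that the word chosen here is never used.
    · exact ⟨[], fun h' => absurd h' h⟩
  obtain ⟨x₁, h₁⟩ : ∃ x₁, (∃ x, x ∈ E.Q) → x₁ ∈ E.Q := by
    by_cases h : ∃ x, x ∈ E.Q
    · exact ⟨h.choose, fun _ => h.choose_spec⟩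
    · exact ⟨[], fun h' => absurd h' h⟩
  -- The exponent gives one factor `|x| + 1` more than `p` needs, to be compared with `t (κ x)`;
  -- `C + 1` is positive.
  obtain ⟨K, hK, hK', hK''⟩ := Clock.exists_polyTimeComputable M (C + 1) (e + 1) x₀ x₁ hM
  refine ⟨K, hK, hK', fun k => t k + (x₀.length + x₁.length),
    Primrec.nat_add.to_comp.comp ht (Computable.const _), fun x => ?_⟩
  rcases hK'' x with ⟨h2, h3⟩ | ⟨h2, h3⟩ | ⟨h2, h3⟩
  · have hx : x ∉ E.Q := by
      rw [← E.sol_nonempty_iff, h2]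
      exact Set.not_nonempty_empty
    rw [h3]
    exact ⟨iff_of_false hx (h₀ ⟨x, hx⟩), by dsimp only; omega⟩
  · have hx : x ∈ E.Q := (E.sol_nonempty_iff x).1 h2
    rw [h3]
    exact ⟨iff_of_true hx (h₁ ⟨x, hx⟩), by dsimp only; omega⟩
  · rw [h2]
    refine ⟨Iff.rfl, ?_⟩
    have h4 : (C + 1) * (x.length + 1) ^ e * (x.length + 1) <
        (C + 1) * (x.length + 1) ^ e * t (E.κ x) := by
      calc (C + 1) * (x.length + 1) ^ e * (x.length + 1)
          = (C + 1) * (x.length + 1) ^ (e + 1) := by ring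
        _ < t (E.κ x) * p.eval x.length := h3
        _ ≤ t (E.κ x) * ((C + 1) * (x.length + 1) ^ e) := by
          refine Nat.mul_le_mul_left _ ((hp _).trans ?_)
          gcongr
          omega
        _ = _ := by ring
    have := lt_of_mul_lt_mul_left h4 (Nat.zero_le _)
    dsimp only
    omega

/-- The delay bound of the driver, as a product of a computable function of the parameter and a
polynomial. -/
theorem computable_driverBound {H t : ℕ → ℕ} (hH : Computable H) (ht : Computable t) :
    Computable fun k => (H k + 1) ^ 2 * (t k + 1) := by
  have h : Primrec fun q : ℕ × ℕ => (q.1 + 1) ^ 2 * (q.2 + 1) := by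
    refine (Primrec.nat_mul.comp (Primrec.nat_mul.comp (Primrec.succ.comp Primrec.fst)
      (Primrec.succ.comp Primrec.fst)) (Primrec.succ.comp Primrec.snd)).of_eq fun q => ?_
    rw [pow_two]
  exact h.to_comp.comp (hH.pair ht)

theorem eval_driverPolynomial (b n : ℕ) (p q : Polynomial ℕ) :
    (32 + 15 * Polynomial.X + 3 * q + Polynomial.C b * p).eval n =
      32 + 15 * n + 3 * q.eval n + b * p.eval n := by
  simp

/-- The solutions of `x` are all assigned to a single solution of `K x`, which is the first one in
a list of all solutions. -/
theorem exists_enumKernelization_of_delayFPT (h : E.DelayFPT) :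
    ComputableFiniteSets E.Sol ∧ ∃ K : List A → List A, E.IsEnumKernelization K := by
  classical
  obtain ⟨M, t, p, ht, hM⟩ := h
  have hSol := computable_sol hM
  refine ⟨hSol, ?_⟩
  obtain ⟨K, hK, hK', b, hb, hb'⟩ := exists_kernelization ht hM
  refine ⟨K, hK, ⟨b, hb, hb'⟩, ?_⟩
  obtain ⟨L, hL, hL'⟩ := hSol
  have hmem : ∀ {y w}, (L y).head? = some w → w ∈ E.Sol y := fun hw =>
    (hL' _ _).1 (List.mem_of_head? hw)
  have hdec : ∀ F : List A → List A, Computable F → Computable fun q : List A × List A =>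
      decide ((L (F q.1)).head? = some q.2) := fun F hF =>
    Primrec.eq.decide.to_comp.comp
      (Primrec.list_head?.to_comp.comp (hL.comp (hF.comp Computable.fst)))
      (Computable.option_some.comp Computable.snd)
  refine ⟨fun q => {v | v ∈ E.Sol q.1 ∧ (L (K q.1)).head? = some q.2}, ?_, ?_, ?_, ?_, ?_⟩
  · refine ⟨fun q => bif decide ((L (K q.1)).head? = some q.2) then L q.1 else [],
      Computable.cond (hdec K hK') (hL.comp Computable.fst) (Computable.const []), fun q w => ?_⟩
    by_cases hq : (L (K q.1)).head? = some q.2 <;> simp [hq, hL']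
  · exact fun x _ w _ v hv => hv.1
  · intro x _ w₁ _ w₂ _ hw
    refine Set.eq_empty_of_forall_notMem fun v hv => hw ?_
    exact Option.some.inj (hv.1.2.symm.trans hv.2.2)
  · intro x hx
    obtain ⟨w, hw⟩ := (E.sol_nonempty_iff _).2 ((hb' x).1.1 hx)
    obtain ⟨w₀, h₀⟩ : ∃ w₀, (L (K x)).head? = some w₀ := by
      have := (hL' _ _).2 hw
      cases hl : L (K x) with
      | nil => simp [hl] at this
      | cons w₀ l => exact ⟨w₀, rfl⟩
    ext v
    simp only [Set.mem_iUnion]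
    exact ⟨fun ⟨_, _, hv⟩ => hv.1, fun hv => ⟨w₀, hmem h₀, hv, h₀⟩⟩
  · obtain ⟨N⟩ := hK
    -- The list with one item, or with none: `M` is to be applied to `x` once if `w` is the solution
    -- that all solutions are assigned to, and not at all otherwise.
    let F : List (Option A) → List (Option A) := fun z =>
      bif decide ((L (splitAtSeparator z).1.reverse).head? = some (splitAtSeparator z).2) then
        Driver.encodeItems [[]] else Driver.encodeItems []
    have hF : Computable F := by
      have h1 : Computable fun z : List (Option A) =>
          ((splitAtSeparator z).1.reverse, (splitAtSeparator z).2) :=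
        (Primrec.pair (Primrec.list_reverse.comp (Primrec.fst.comp primrec_splitAtSeparator))
          (Primrec.snd.comp primrec_splitAtSeparator)).to_comp
      exact Computable.cond ((hdec id Computable.id).comp h1) (Computable.const _)
        (Computable.const _)
    obtain ⟨ML, T, hT, hML⟩ := exists_machine_of_computable_of_time hF
    obtain ⟨H, hH, hH'⟩ := exists_computable_bound (L := L) (h := b)
      (g := fun y w => T (y.reverse.map some ++ none :: w.map some) + y.length +
        2 * (w.length + 1) + 1) (by
        have h1 : Primrec fun q : List A × List A => q.1.reverse.map some ++ none :: q.2.map some :=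
          Primrec.list_append.comp (Primrec.list_map (Primrec.list_reverse.comp Primrec.fst)
            (Primrec.option_some.comp₂ Primrec₂.right)) (Primrec.list_cons.comp (Primrec.const none)
              (Primrec.list_map Primrec.snd (Primrec.option_some.comp₂ Primrec₂.right)))
        have h2 : Primrec fun q : List A × List A => q.1.length :=
          Primrec.list_length.comp Primrec.fst
        have h3 : Primrec fun q : List A × List A => 2 * (q.2.length + 1) :=
          Primrec.nat_mul.comp (Primrec.const 2)
            (Primrec.succ.comp (Primrec.list_length.comp Primrec.snd))
        exact Computable.succ.comp (Primrec.nat_add.to_comp.comp (Primrec.nat_add.to_comp.comp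
          (hT.comp h1.to_comp) h2.to_comp) h3.to_comp)) hL hb
    -- The item is not passed to `M`, hence `jv := none`.
    let D : Driver A (Option A) A :=
      { N := N.tm, inN := N.inputAlphabet, outN := N.outputAlphabet, L := ML, M := M, ι := id,
        jx := id, jv := none }
    obtain ⟨c, hc⟩ := D.exists_enumeratesWithDelay
    refine ⟨D.machine, _, 32 + 15 * Polynomial.X + 3 * N.time + Polynomial.C c * p,
      computable_driverBound hH ht, fun x hx w hw => ?_⟩
    rw [eval_driverPolynomial]
    obtain ⟨τN, cN, n1, n2, n3, n4⟩ := exists_trace_of_polyTime N x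
    obtain ⟨cL, l1, l2, l3⟩ := hML ((K x).reverse.map some ++ none :: w.map some)
    let vs : List (List A) := if (L (K x)).head? = some w then [[]] else []
    have hvs : F ((K x).reverse.map some ++ none :: w.map some) = Driver.encodeItems vs := by
      simp only [F, vs, splitAtSeparator_append, List.reverse_reverse]
      split_ifs with h <;> simp [h]
    have hvs' : (Driver.encodeItems vs).length ≤ 1 := by
      simp only [vs]
      split_ifs <;> simp [Driver.encodeItems]
    have hvs'' : ∀ v ∈ vs, v = [] ∧ (L (K x)).head? = some w := by
      intro v hv
      simp only [vs] at hv
      split_ifs at hv with h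
      · exact ⟨by simpa using hv, h⟩
      · simp at hv
    refine hc (x := x) (t := none :: w.map some) (vs := vs) (Sol := fun _ => E.Sol x)
      (by simp [encodePair, D]) (by simp) n1 n2 n3 l1 l2 (l3.trans hvs) (fun v _ => ?_) ?_ ?_ ?_ n4
      (d := t (E.κ x) * p.eval x.length) (mul_comm _ _).le ?_
    · have : x.map D.jx ++ D.itemInput v = x := by simp [Driver.itemInput, D]
      rw [this]
      exact hM x
    · simp only [vs]
      split_ifs <;> simp
    · intro v hv v' hv' hne
      exact absurd ((hvs'' v hv).1.trans (hvs'' v' hv').1.symm) hne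
    · intro v
      refine ⟨fun hv => ⟨[], ?_, hv.1⟩, fun ⟨v', hv', hv⟩ => ⟨hv, (hvs'' v' hv').2⟩⟩
      simp [vs, hv.2]
    · have := hH' (E.κ x) (K x) w (hb' x).2 ((hL' _ _).2 hw)
      simp only [List.length_cons, List.length_map]
      omega

/-- Enumerate the solutions `w` of the kernel, which takes a time that is bounded in terms of the
parameter, and apply the given machine to every pair `(x, w)`. -/
theorem delayFPT_of_enumKernelization (hSol : ComputableFiniteSets E.Sol) {K : List A → List A}
    (h : E.IsEnumKernelization K) : E.DelayFPT := by
  obtain ⟨⟨N⟩, ⟨b, hb, hb'⟩, f, -, -, hf₁, hf₂, M, t, p, ht, hM⟩ := h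
  obtain ⟨L, hL, hL', hL''⟩ := hSol.exists_nodup
  let F : List (Option A) → List (Option A) := fun z =>
    Driver.encodeItems (L (splitAtSeparator z).1.reverse)
  have hF : Computable F := primrec_encodeItems.to_comp.comp (hL.comp
    (Primrec.list_reverse.comp (Primrec.fst.comp primrec_splitAtSeparator)).to_comp)
  obtain ⟨ML, T, hT, hML⟩ := exists_machine_of_computable_of_time hF
  obtain ⟨H, hH, hH'⟩ := exists_computable_bound (L := fun _ : List A => [[]]) (h := b)
    (g := fun y _ => T (y.reverse.map some ++ none :: []) + y.length +
      (Driver.encodeItems (L y)).length) (by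
      have h1 : Primrec fun y : List A => y.reverse.map some ++ none :: [] :=
        Primrec.list_append.comp (Primrec.list_map Primrec.list_reverse
          (Primrec.option_some.comp₂ Primrec₂.right)) (Primrec.const _)
      have h2 : Computable fun y : List A => T (y.reverse.map some ++ none :: []) + y.length +
          (Driver.encodeItems (L y)).length :=
        Primrec.nat_add.to_comp.comp (Primrec.nat_add.to_comp.comp (hT.comp h1.to_comp)
          Computable.list_length) (Computable.list_length.comp
            (primrec_encodeItems.to_comp.comp hL))
      exact h2.comp Computable.fst) (Computable.const _) hb
  let D : Driver A A (Option A) :=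
    { N := N.tm, inN := N.inputAlphabet, outN := N.outputAlphabet, L := ML, M := M, ι := some,
      jx := some, jv := some id }
  obtain ⟨c, hc⟩ := D.exists_enumeratesWithDelay
  refine ⟨D.machine, _, 32 + 15 * Polynomial.X + 3 * N.time + Polynomial.C c * p,
    computable_driverBound hH ht, fun x => ?_⟩
  rw [eval_driverPolynomial, mul_comm]
  obtain ⟨τN, cN, n1, n2, n3, n4⟩ := exists_trace_of_polyTime N x
  obtain ⟨cL, l1, l2, l3⟩ := hML ((K x).reverse.map some ++ none :: [])
  have hvs : F ((K x).reverse.map some ++ none :: []) = Driver.encodeItems (L (K x)) := by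
    have := splitAtSeparator_append (K x).reverse []
    rw [List.map_nil] at this
    simp only [F, this, List.reverse_reverse]
  have hQ : ∀ v ∈ L (K x), x ∈ E.Q := fun v hv =>
    (hb' x).1.2 ((E.sol_nonempty_iff _).1 ⟨v, (hL' _ _).1 hv⟩)
  refine hc (x := x) (t := []) (vs := L (K x)) (Sol := fun w => f (x, w)) (by simp [D]) (by simp)
    n1 n2 n3 l1 l2 (l3.trans hvs) (fun v hv => ?_) (hL'' _) ?_ ?_ n4
    (d := p.eval x.length * t (E.κ x)) le_rfl ?_
  · have : x.map D.jx ++ D.itemInput v = encodePair (x, v) := by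
      simp [Driver.itemInput, D, encodePair]
    rw [this]
    exact hM x (hQ v hv) v ((hL' _ _).1 hv)
  · intro v hv w hw hvw
    exact Set.disjoint_iff_inter_eq_empty.2
      (hf₁ x (hQ v hv) v ((hL' _ _).1 hv) w ((hL' _ _).1 hw) hvw)
  · intro v
    constructor
    · intro hv
      have hx : x ∈ E.Q := (E.sol_nonempty_iff x).1 ⟨v, hv⟩
      rw [← hf₂ x hx, Set.mem_iUnion₂] at hv
      obtain ⟨w, hw, hv⟩ := hv
      exact ⟨w, (hL' _ _).2 hw, hv⟩
    · rintro ⟨w, hw, hv⟩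
      rw [← hf₂ x (hQ w hw), Set.mem_iUnion₂]
      exact ⟨w, (hL' _ _).1 hw, hv⟩
  · have := hH' (E.κ x) (K x) [] (hb' x).2 (by simp)
    simpa [add_assoc] using this

end ParamEnumProblem

theorem mainTheorem1 {A : Type} [Fintype A] [Primcodable A] (E : ParamEnumProblem A) :
    E.DelayFPT ↔
      ComputableFiniteSets E.Sol ∧ ∃ K : List A → List A, E.IsEnumKernelization K :=
  ⟨fun h => ParamEnumProblem.exists_enumKernelization_of_delayFPT h,
    fun ⟨hSol, _, hK⟩ => ParamEnumProblem.delayFPT_of_enumKernelization hSol hK⟩
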